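/- **Theorem 2 (Convergence rate for residual connection in aggregation).** Let $G=(V,E)$ be a finite undirected simple graph with $n=|V|\ge 1$, let $\mathcal N(u)$ be the set of neighbours of $u$, and let $\mathcal A=\mathcal A(G)\in\mathbb R^{n^2\times n^2}$ be the aggregation matrix indexed by $V\times V$, $$(\mathcal A K)(u,u')=\frac1{|\mathcal N(u)|+1}\,\frac1{|\mathcal N(u')|+1}\sum_{v\in\mathcal N(u)\cup\{u\}}\ \sum_{v'\in\mathcal N(u')\cup\{u'\}}K(v,v').$$ Assume that $\mathcal A$ is irreducible (it is then automatically aperiodic, its diagonal being positive). Let $0<\delta<1$ and $\tilde{\mathcal A}=(1-\delta)\mathcal A+\delta I$. Let $\phi$ be either the ReLU $\phi(x)=\max\{0,x\}$ (with $\phi'=1_{(0,\infty)}$) or $\phi=\tanh$, and let $\sigma_w,\sigma_b\in\mathbb R$ be on the edge of chaos: there is $q^*>0$ with $$\sigma_w^2\,\mathbb E[\phi(\sqrt{q^*}z)^2]+\sigma_b^2=q^*,\qquad \sigma_w^2\,\mathbb E[\phi'(\sqrt{q^*}z)^2]=1,\qquad z\sim\mathcal N(0,1)$$ (for ReLU this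 means $\sigma_w^2=2$, $\sigma_b=0$). Let $R\ge0$ be the number of MLP layers per propagation unit and let $h_u\in\mathbb R^d$ $(u\in V)$ be node features. Define the Gaussian process kernel $\Sigma^{(l)}_{(r)}$ and the graph neural tangent kernel $\Theta^{(l)}_{(r)}$ on $V\times V$, for $l\ge 0$ and $r\ge0$, by $\Theta^{(0)}_{(0)}(u,u')=\Sigma^{(0)}_{(0)}(u,u')=\langle h_u,h_{u'}\rangle$, $$\Sigma^{(l+1)}_{(0)}=\tilde{\mathcal A}\,\Sigma^{(l)}_{(R)},\qquad \Theta^{(l+1)}_{(0)}=\tilde{\mathcal A}\,\Theta^{(l)}_{(R)},$$ $$\Sigma^{(l)}_{(r)}(u,u')=\sigma_w^2\,\mathbb E[\phi(z_1)\phi(z_2)]+\sigma_b^2,\qquad \dot\Sigma^{(l)}_{(r)}(u,u')=\sigma_w^2\,\mathbb E[\phi'(z_1)\phi'(z_2)],$$ $$\Theta^{(l)}_{(r)}(u,u')=\Theta^{(l)}_{(r-1)}(u,u')\,\dot\Sigma^{(l)}_{(r)}(u,u')+\Sigma^{(l)}_{(r)}(u,u')\qquad(r\ge1),$$ where $(z_1,z_2)$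 is a centred Gaussian pair with covariance matrix $\begin{pmatrix}\Sigma^{(l)}_{(r-1)}(u,u)&\Sigma^{(l)}_{(r-1)}(u,u')\\ \Sigma^{(l)}_{(r-1)}(u',u)&\Sigma^{(l)}_{(r-1)}(u',u')\end{pmatrix}$. Then: 1. $\tilde{\mathcal A}$ is a (row-)stochastic matrix and has exactly one stationary distribution $\tilde\pi\in\mathbb R^{n^2}$, i.e. one probability vector with $\tilde\pi^T\tilde{\mathcal A}=\tilde\pi^T$. 2. There are constants $0<\tilde\alpha<1$ and $C>0$, a vector $\vec v\in\mathbb R^{n^2}$ and, for each $0\le r\le R$, a vector $\vec v'=\vec v'_r\in\mathbb R^{n^2}$, such that for all $0\le r\le R$, $l\ge0$ and $u,u'\in V$ $$\bigl|\Theta^{(l)}_{(r)}(u,u')-\tilde\pi^T\bigl(Rl\,\vec v+\vec v'\bigr)\bigr|\le C\,\tilde\alpha^{\,l}.$$ 3. If $n\ge2$, then all eigenvalues of $\mathcal A$ and of $\tilde{\mathcal A}$ are real and their second largest eigenvalues $\lambda_2$, $\tilde\lambda_2$ (eigenvalues counted with multiplicity, in non-increasing order) satisfy $$\tilde\lambda_2=(1-\delta)\lambda_2+\delta,\qquad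 \lambda_2<\tilde\lambda_2<1.$$ -/

import Mathlib

open MeasureTheory ProbabilityTheory Matrix

namespace GNTK

noncomputable section

/-- The ReLU activation `x ↦ max {0, x}`. Its `deriv` is the indicator of `(0, ∞)`. -/
def relu (x : ℝ) : ℝ := max 0 x

/-- The pair `(σ_w, σ_b)` is on the edge of chaos for `φ`: for a positive fixed point `q` of the
variance map `q ↦ σ_w² 𝔼[φ(√q z)²] + σ_b²`, `z ∼ N(0,1)`, one has `σ_w² 𝔼[φ'(√q z)²] = 1`. -/
def IsEdgeOfChaos (φ : ℝ → ℝ) (σw σb : ℝ) : Prop :=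
  ∃ q : ℝ, 0 < q ∧
    σw ^ 2 * ∫ z, φ (√q * z) ^ 2 ∂(gaussianReal 0 1) + σb ^ 2 = q ∧
    σw ^ 2 * ∫ z, deriv φ (√q * z) ^ 2 ∂(gaussianReal 0 1) = 1

section Graph

variable {V : Type*} [Fintype V] [DecidableEq V]

/-- The neighbourhood averaging matrix: row `u` is uniform on `N(u) ∪ {u}`. -/
def averagingMatrix (G : SimpleGraph V) [DecidableRel G.Adj] : Matrix V V ℝ :=
  of fun u v => if v ∈ insert u (G.neighborFinset u) then 1 / ((G.degree u : ℝ) + 1) else 0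

/-- The aggregation matrix `𝒜(G)` acting on vectorized kernels (functions on `V × V`):
`(𝒜 Θ)(u,u') = 1/(|N(u)|+1) · 1/(|N(u')|+1) · ∑_{v ∈ N(u) ∪ u} ∑_{v' ∈ N(u') ∪ u'} Θ(v,v')`. -/
def aggregation (G : SimpleGraph V) [DecidableRel G.Adj] : Matrix (V × V) (V × V) ℝ :=
  kroneckerMap (· * ·) (averagingMatrix G) (averagingMatrix G)

/-- The aggregation matrix with residual connection, `(1 - δ) 𝒜(G) + δ I`. -/
def residualAggregation (G : SimpleGraph V) [DecidableRel G.Adj] (δ : ℝ) :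
    Matrix (V × V) (V × V) ℝ :=
  (1 - δ) • aggregation G + δ • (1 : Matrix (V × V) (V × V) ℝ)

end Graph

/-- `𝔼[ψ(z₁) ψ(z₂)]` for a centred Gaussian pair `(z₁, z₂)` with covariance matrix
`[[K(u,u), K(u,u')], [K(u',u), K(u',u')]]`. -/
def gaussianPairing {V : Type*} (ψ : ℝ → ℝ) (K : V × V → ℝ) (u u' : V) : ℝ :=
  ∫ z : EuclideanSpace ℝ (Fin 2), ψ (z 0) * ψ (z 1)
    ∂(multivariateGaussian 0 !![K (u, u), K (u, u'); K (u', u), K (u', u')])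

section Kernels

variable {V : Type*} [Fintype V]

/-- The Gaussian process kernel `Σ^{(l)}_{(r)}` (arguments `l`, then `r`) of the infinitely wide
network with `R` MLP layers per propagation unit, aggregation matrix `A` and input features `h`:
`Σ^{(0)}_{(0)}` is the Gram kernel of the features, `Σ^{(l)}_{(0)} = A Σ^{(l-1)}_{(R)}`, and
`Σ^{(l)}_{(r)}(u,u') = σ_w² 𝔼[φ(z₁) φ(z₂)] + σ_b²` with covariance from `Σ^{(l)}_{(r-1)}`. -/
def gpk (A : Matrix (V × V) (V × V) ℝ) (φ : ℝ → ℝ) (σw σb : ℝ) (R : ℕ) {d : ℕ}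
    (h : V → EuclideanSpace ℝ (Fin d)) : ℕ → ℕ → V × V → ℝ
  | 0, 0 => fun p => inner ℝ (h p.1) (h p.2)
  | l + 1, 0 => A *ᵥ gpk A φ σw σb R h l R
  | l, r + 1 => fun p =>
      σw ^ 2 * gaussianPairing φ (gpk A φ σw σb R h l r) p.1 p.2 + σb ^ 2
termination_by l r => (l, r)

/-- The derivative kernel `Σ̇^{(l)}_{(r+1)}(u,u') = σ_w² 𝔼[φ'(z₁) φ'(z₂)]` with covariance from
`Σ^{(l)}_{(r)}`. -/
def gpkDeriv (A : Matrix (V × V) (V × V) ℝ) (φ : ℝ → ℝ) (σw σb : ℝ) (R : ℕ) {d : ℕ}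
    (h : V → EuclideanSpace ℝ (Fin d)) (l r : ℕ) (p : V × V) : ℝ :=
  σw ^ 2 * gaussianPairing (deriv φ) (gpk A φ σw σb R h l r) p.1 p.2

/-- The graph neural tangent kernel `Θ^{(l)}_{(r)}`: `Θ^{(0)}_{(0)} = Σ^{(0)}_{(0)}`,
`Θ^{(l)}_{(0)} = A Θ^{(l-1)}_{(R)}` and
`Θ^{(l)}_{(r)} = Θ^{(l)}_{(r-1)} Σ̇^{(l)}_{(r)} + Σ^{(l)}_{(r)}` entrywise. -/
def gntk (A : Matrix (V × V) (V × V) ℝ) (φ : ℝ → ℝ) (σw σb : ℝ) (R : ℕ) {d : ℕ}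
    (h : V → EuclideanSpace ℝ (Fin d)) : ℕ → ℕ → V × V → ℝ
  | 0, 0 => gpk A φ σw σb R h 0 0
  | l + 1, 0 => A *ᵥ gntk A φ σw σb R h l R
  | l, r + 1 => fun p =>
      gntk A φ σw σb R h l r p * gpkDeriv A φ σw σb R h l r p + gpk A φ σw σb R h l (r + 1) p
termination_by l r => (l, r)

end Kernels

section Spectrum

variable {ι : Type*} [Fintype ι]

/-- `π` is a probability vector with `πᵀ M = πᵀ`. -/
def IsStationaryDistribution (M : Matrix ι ι ℝ) (π : ι → ℝ) : Prop :=
  (∀ i, 0 ≤ π i) ∧ ∑ i, π i = 1 ∧ π ᵥ* M = π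

/-- All eigenvalues of `M` are real and, listed with multiplicity in non-increasing order
`λ₁ ≥ λ₂ ≥ ⋯`, the second one is `μ`. -/
def IsSecondLargestEigenvalue [DecidableEq ι] (M : Matrix ι ι ℝ) (μ : ℝ) : Prop :=
  ∃ ev : Fin (Fintype.card ι) → ℝ, Antitone ev ∧
    M.charpoly = ∏ i, (Polynomial.X - Polynomial.C (ev i)) ∧
    ∃ h : 1 < Fintype.card ι, ev ⟨1, h⟩ = μ

end Spectrum

end

end GNTK

/-! Write `Ã` for `residualAggregation G δ`. It dominates `(1 - δ) 𝒜` entrywise and has a positive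
diagonal, so irreducibility of `𝒜` gives it an entrywise positive power. Doeblin's argument then
makes `Ã ^ l *ᵥ x` converge geometrically to the constant `π ⬝ᵥ x` (`exists_ergodic_bound`), which
forces uniqueness of `π`; existence is explicit, with weights proportional to `(deg u + 1)(deg u' +
1)`. The same weights put `𝒜` in detailed balance, so `𝒜` is similar to a symmetric matrix. Its
spectrum is real, `x ↦ (1 - δ) x + δ` carries it to that of `Ã`, and ergodicity keeps the second
eigenvalue below `1`.

For the tangent kernel it suffices that `Σ` tends to a constant `q` and `Σ̇` to `1`, both
geometrically. Each layer then adds `q` to `Θ` up to an exponentially small relative error and each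
aggregation averages, so `Θ` is `R l q` plus a constant plus an exponentially small remainder
(`exists_affine_asymptotics`).

For ReLU a layer never lowers an entry of `Σ` and never raises the maximum, so `Σ` is a
super-iterate of `Ã` with non-increasing maximum and converges
(`exists_limit_of_monotone_iteration`); the limit depends on the features.

For `tanh` the slope at the fixed point is exactly `1`, so a layer alone does not contract
off-diagonal entries geometrically. The diagonal does contract, because the bias is nonzero
(`sq_bias_pos`), and `Ã` spreads that gain to all pairs (`exists_decay_of_damped_iteration`). The
lower bound for one layer (`sub_le_tanhStep`) needs nonnegative covariances. These hold eventually: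
by Price's identity a layer multiplies `K` entrywise by a nonnegative positive semidefinite kernel
and adds the bias, and the gain accumulates (`DominatesNonneg`). -/

namespace GNTK

/-! ### Geometric decay from contraction over a window -/

section Geometric

/-- A sequence that contracts over a window of `k` steps, up to an exponentially small error, decays
exponentially. -/
theorem exists_geometric_bound_of_window_contraction {f : ℕ → ℝ} {k : ℕ} (hk : 0 < k)
    {β : ℝ} (hβ0 : 0 ≤ β) (hβ1 : β < 1) {C₀ α₀ : ℝ} (hC₀ : 0 ≤ C₀) (hα0 : 0 ≤ α₀) (hα1 : α₀ < 1)
    (hf : ∀ l, f (l + k) ≤ β * f l + C₀ * α₀ ^ l) :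
    ∃ α C : ℝ, 0 < α ∧ α < 1 ∧ 0 < C ∧ ∀ l, f l ≤ C * α ^ l := by
  -- Rates close enough to `1` satisfy this; the gap `α ^ k - β` will absorb the forcing term.
  obtain ⟨α₁, h10, h11, h1k⟩ : ∃ a : ℝ, 0 < a ∧ a < 1 ∧ β < a ^ k := by
    have hcont : Filter.Tendsto (fun a : ℝ => a ^ k) (nhdsWithin 1 (Set.Iio 1)) (nhds (1 ^ k)) :=
      ((continuous_pow k).tendsto 1).mono_left nhdsWithin_le_nhds
    have h1 : ∀ᶠ a in nhdsWithin (1 : ℝ) (Set.Iio 1), β < a ^ k :=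
      hcont.eventually (lt_mem_nhds (by simpa using hβ1))
    have h2 : ∀ᶠ a in nhdsWithin (1 : ℝ) (Set.Iio 1), 0 < a :=
      nhdsWithin_le_nhds (lt_mem_nhds one_pos)
    obtain ⟨a, ha⟩ := (h1.and (h2.and self_mem_nhdsWithin)).exists
    exact ⟨a, ha.2.1, ha.2.2, ha.1⟩
  set α := max α₀ α₁ with hα
  have hpos : 0 < α := lt_max_of_lt_right h10
  have hlt : α < 1 := max_lt hα1 h11
  have hαk : β < α ^ k := h1k.trans_le (pow_le_pow_left₀ h10.le (le_max_right _ _) k)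
  -- The sum pays for the first window `l < k`; the middle term gives `C₀ ≤ C * (α ^ k - β)`, which
  -- closes the induction.
  set C := 1 + C₀ / (α ^ k - β) + ∑ l ∈ Finset.range k, |f l| / α ^ l with hC
  have hs : 0 ≤ ∑ l ∈ Finset.range k, |f l| / α ^ l :=
    Finset.sum_nonneg fun l _ => by positivity
  have hd : 0 ≤ C₀ / (α ^ k - β) := div_nonneg hC₀ (by linarith)
  have hCpos : 0 < C := by positivity
  refine ⟨α, C, hpos, hlt, hCpos, fun l => ?_⟩
  induction l using Nat.strong_induction_on with
  | _ l ih =>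
    rcases lt_or_ge l k with hl | hl
    · have h1 : |f l| / α ^ l ≤ C := by
        have := Finset.single_le_sum (f := fun l => |f l| / α ^ l)
          (fun i _ => by positivity) (Finset.mem_range.2 hl)
        linarith
      rw [div_le_iff₀ (by positivity)] at h1
      exact (le_abs_self _).trans h1
    · obtain ⟨m, rfl⟩ := Nat.exists_eq_add_of_le' hl
      have hm := ih m (by omega)
      have h0 : α₀ ^ m ≤ α ^ m := pow_le_pow_left₀ hα0 (le_max_left _ _) m
      have h2 : C₀ ≤ C * (α ^ k - β) := by
        have hne : 0 < α ^ k - β := by linarith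
        rw [← div_le_iff₀ hne]
        linarith
      calc f (m + k) ≤ β * f m + C₀ * α₀ ^ m := hf m
        _ ≤ β * (C * α ^ m) + C₀ * α ^ m := by gcongr
        _ ≤ β * (C * α ^ m) + C * (α ^ k - β) * α ^ m := by gcongr
        _ = C * α ^ (m + k) := by ring

end Geometric

/-! ### Ergodicity of stochastic matrices -/

section Stochastic

variable {ι : Type*} [Fintype ι]

theorem mulVec_mono {M : Matrix ι ι ℝ} (hM : ∀ i j, 0 ≤ M i j) {x y : ι → ℝ} (h : x ≤ y) :
    M *ᵥ x ≤ M *ᵥ y := fun i =>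
  Finset.sum_le_sum fun j _ => mul_le_mul_of_nonneg_left (h j) (hM i j)

theorem IsStationaryDistribution.dotProduct_mem_Icc {M : Matrix ι ι ℝ} {π : ι → ℝ}
    (hπ : IsStationaryDistribution M π) {x : ι → ℝ} {a b : ℝ} (hx : ∀ i, a ≤ x i ∧ x i ≤ b) :
    a ≤ π ⬝ᵥ x ∧ π ⬝ᵥ x ≤ b := by
  have h1 : ∀ c : ℝ, c = ∑ i, π i * c := fun c => by rw [← Finset.sum_mul, hπ.2.1, one_mul]
  constructor
  · rw [h1 a]
    exact Finset.sum_le_sum fun i _ => mul_le_mul_of_nonneg_left (hx i).1 (hπ.1 i)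
  · rw [h1 b]
    exact Finset.sum_le_sum fun i _ => mul_le_mul_of_nonneg_left (hx i).2 (hπ.1 i)

theorem IsStationaryDistribution.dotProduct_mulVec {M : Matrix ι ι ℝ} {π : ι → ℝ}
    (hπ : IsStationaryDistribution M π) (x : ι → ℝ) : π ⬝ᵥ (M *ᵥ x) = π ⬝ᵥ x := by
  rw [Matrix.dotProduct_mulVec, hπ.2.2]

theorem IsStationaryDistribution.dotProduct_const {M : Matrix ι ι ℝ} {π : ι → ℝ}
    (hπ : IsStationaryDistribution M π) (c : ℝ) : π ⬝ᵥ (fun _ => c) = c := by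
  simp [dotProduct, ← Finset.sum_mul, hπ.2.1]

variable [DecidableEq ι]

theorem mulVec_const {M : Matrix ι ι ℝ} (hM : M ∈ rowStochastic ℝ ι) (c : ℝ) :
    M *ᵥ (fun _ => c) = fun _ => c := by
  funext i
  simp [mulVec, dotProduct, ← Finset.sum_mul, sum_row_of_mem_rowStochastic hM i]

theorem mulVec_le_const {M : Matrix ι ι ℝ} (hM : M ∈ rowStochastic ℝ ι) {x : ι → ℝ} {c : ℝ}
    (h : ∀ i, x i ≤ c) (i : ι) : (M *ᵥ x) i ≤ c := by
  have := mulVec_mono (M := M) (fun _ _ => nonneg_of_mem_rowStochastic hM) (show x ≤ fun _ => c from h) i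
  rwa [mulVec_const hM] at this

theorem const_le_mulVec {M : Matrix ι ι ℝ} (hM : M ∈ rowStochastic ℝ ι) {x : ι → ℝ} {c : ℝ}
    (h : ∀ i, c ≤ x i) (i : ι) : c ≤ (M *ᵥ x) i := by
  have := mulVec_mono (M := M) (fun _ _ => nonneg_of_mem_rowStochastic hM) (show (fun _ => c) ≤ x from h) i
  rwa [mulVec_const hM] at this

theorem norm_mulVec_le {M : Matrix ι ι ℝ} (hM : M ∈ rowStochastic ℝ ι) (x : ι → ℝ) :
    ‖M *ᵥ x‖ ≤ ‖x‖ := by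
  refine (pi_norm_le_iff_of_nonneg (norm_nonneg _)).2 fun i => ?_
  rw [Real.norm_eq_abs, abs_le]
  have h := fun j => abs_le.1 ((Real.norm_eq_abs _).symm.trans_le (norm_le_pi_norm x j))
  exact ⟨const_le_mulVec hM (fun j => (h j).1) i, mulVec_le_const hM (fun j => (h j).2) i⟩

theorem pow_mulVec_succ (M : Matrix ι ι ℝ) (l : ℕ) (x : ι → ℝ) :
    M ^ (l + 1) *ᵥ x = M *ᵥ (M ^ l *ᵥ x) := by
  rw [pow_succ', mulVec_mulVec]

/-- An entrywise lower bound on a stochastic matrix makes it contract oscillations. -/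
theorem doeblin_contraction {M : Matrix ι ι ℝ} (hM : M ∈ rowStochastic ℝ ι) {c : ℝ}
    (hc : ∀ i j, c ≤ M i j) {x : ι → ℝ} {m r : ℝ} (hx : ∀ i, m ≤ x i ∧ x i ≤ m + r) :
    ∃ m', ∀ i, m' ≤ (M *ᵥ x) i ∧ (M *ᵥ x) i ≤ m' + (1 - Fintype.card ι * c) * r := by
  -- Split off `c` from every entry of `M`: that part sends `x` to a constant vector, and the rest
  -- has nonnegative entries with row sums `1 - card ι * c`.
  refine ⟨c * ∑ j, x j + (1 - Fintype.card ι * c) * m, fun i => ?_⟩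
  have hsum : ∑ j, (M i j - c) = 1 - Fintype.card ι * c := by
    simp [Finset.sum_sub_distrib, sum_row_of_mem_rowStochastic hM i]
  have hsplit : (M *ᵥ x) i = c * ∑ j, x j + ∑ j, (M i j - c) * x j := by
    simp [mulVec, dotProduct, sub_mul, Finset.sum_sub_distrib, Finset.mul_sum]
  rw [hsplit]
  constructor
  · rw [← hsum, Finset.sum_mul]
    gcongr with j
    · linarith [hc i j]
    · exact (hx j).1
  · rw [add_assoc, ← mul_add, ← hsum, Finset.sum_mul]
    gcongr with j
    · linarith [hc i j]
    · exact (hx j).2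

/-- A positive diagonal lets a path wait, so an entry positive at one power stays positive at all
later ones; an exponent above all the individual ones then serves every pair. -/
theorem exists_pos_pow_of_pos_diag {M : Matrix ι ι ℝ} (h0 : ∀ i j, 0 ≤ M i j)
    (hd : ∀ i, 0 < M i i) (hM : ∀ i j, ∃ k, 0 < (M ^ k) i j) :
    ∃ k > 0, ∀ i j, 0 < (M ^ k) i j := by
  have hnn : ∀ k i j, 0 ≤ (M ^ k) i j := by
    intro k
    induction k with
    | zero => intro i j; simp only [pow_zero, one_apply]; split_ifs <;> simp
    | succ k ih =>
      intro i j
      rw [pow_succ, mul_apply]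
      exact Finset.sum_nonneg fun l _ => mul_nonneg (ih i l) (h0 l j)
  have hstep : ∀ i j k, 0 < (M ^ k) i j → ∀ n, 0 < (M ^ (k + n)) i j := by
    intro i j k hk n
    induction n with
    | zero => exact hk
    | succ n ih =>
      rw [← add_assoc, pow_succ, mul_apply]
      exact lt_of_lt_of_le (mul_pos ih (hd j))
        (Finset.single_le_sum (f := fun l => (M ^ (k + n)) i l * M l j)
          (fun l _ => mul_nonneg (hnn _ _ _) (h0 _ _)) (Finset.mem_univ j))
  choose k hk using hM
  refine ⟨(∑ p : ι × ι, k p.1 p.2) + 1, Nat.succ_pos _, fun i j => ?_⟩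
  have hle : k i j ≤ (∑ p : ι × ι, k p.1 p.2) + 1 :=
    (Finset.single_le_sum (f := fun p : ι × ι => k p.1 p.2) (fun _ _ => Nat.zero_le _)
      (Finset.mem_univ (i, j))).trans (Nat.le_succ _)
  obtain ⟨n, hn⟩ := Nat.exists_eq_add_of_le hle
  rw [hn]
  exact hstep i j _ (hk i j) n

theorem IsStationaryDistribution.dotProduct_pow_mulVec {M : Matrix ι ι ℝ} {π : ι → ℝ}
    (hπ : IsStationaryDistribution M π) (l : ℕ) (x : ι → ℝ) : π ⬝ᵥ (M ^ l *ᵥ x) = π ⬝ᵥ x := by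
  induction l with
  | zero => simp
  | succ l ih => rw [pow_mulVec_succ, hπ.dotProduct_mulVec, ih]

variable [Nonempty ι]

/-- A matrix with a positive power has a power that is bounded below by a positive constant. -/
theorem exists_pow_lower_bound {M : Matrix ι ι ℝ} (hpos : ∃ k > 0, ∀ i j, 0 < (M ^ k) i j) :
    ∃ k > 0, ∃ c > 0, ∀ i j, c ≤ (M ^ k) i j := by
  obtain ⟨k, hk, h⟩ := hpos
  obtain ⟨p, -, hp⟩ := Finset.exists_min_image (Finset.univ : Finset (ι × ι))
    (fun p => (M ^ k) p.1 p.2) Finset.univ_nonempty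
  exact ⟨k, hk, _, h p.1 p.2, fun i j => hp (i, j) (Finset.mem_univ _)⟩

theorem card_mul_le_one {M : Matrix ι ι ℝ} (hM : M ∈ rowStochastic ℝ ι) {c : ℝ}
    (hc : ∀ i j, c ≤ M i j) : Fintype.card ι * c ≤ 1 := by
  obtain ⟨i⟩ := ‹Nonempty ι›
  rw [← sum_row_of_mem_rowStochastic hM i, ← nsmul_eq_mul]
  exact Finset.card_nsmul_le_sum _ _ _ fun j _ => hc i j

/-- Exponential ergodicity of a stochastic matrix with a positive power. -/
theorem exists_ergodic_bound {M : Matrix ι ι ℝ} (hM : M ∈ rowStochastic ℝ ι)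
    (hpos : ∃ k > 0, ∀ i j, 0 < (M ^ k) i j) :
    ∃ α C : ℝ, 0 < α ∧ α < 1 ∧ 0 < C ∧ ∀ π, IsStationaryDistribution M π →
      ∀ (l : ℕ) (x : ι → ℝ) (i : ι), |(M ^ l *ᵥ x) i - π ⬝ᵥ x| ≤ C * α ^ l * ‖x‖ := by
  obtain ⟨k, hk, c, hc0, hc⟩ := exists_pow_lower_bound hpos
  have hMk : ∀ l, M ^ l ∈ rowStochastic ℝ ι := fun l => pow_mem hM l
  have hcard := card_mul_le_one (hMk k) hc
  have hcardpos : (0 : ℝ) < Fintype.card ι := by exact_mod_cast Fintype.card_pos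
  set β := 1 - Fintype.card ι * c with hβ
  have hβ0 : 0 ≤ β := by linarith
  have hβ1 : β < 1 := by nlinarith
  -- Every completed block of `k` steps multiplies the oscillation by at most `β`.
  have hosc : ∀ (l : ℕ) (x : ι → ℝ) , ∃ m, ∀ i, m ≤ (M ^ l *ᵥ x) i ∧
      (M ^ l *ᵥ x) i ≤ m + β ^ (l / k) * (2 * ‖x‖) := by
    intro l
    induction l using Nat.strong_induction_on with
    | _ l ih =>
      intro x
      rcases lt_or_ge l k with hl | hl
      · refine ⟨-‖x‖, fun i => ?_⟩
        have h := (norm_le_pi_norm (M ^ l *ᵥ x) i).trans (norm_mulVec_le (hMk l) x)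
        rw [Real.norm_eq_abs, abs_le] at h
        rw [Nat.div_eq_of_lt hl]
        exact ⟨h.1, by linarith [h.2]⟩
      · obtain ⟨n, rfl⟩ := Nat.exists_eq_add_of_le hl
        obtain ⟨m, hm⟩ := ih n (by omega) x
        obtain ⟨m', hm'⟩ := doeblin_contraction (hMk k) hc hm
        refine ⟨m', fun i => ?_⟩
        rw [pow_add, ← mulVec_mulVec, Nat.add_div_left _ hk, pow_succ', mul_assoc]
        exact hm' i
  obtain ⟨α, C, hα0, hα1, hC, hb⟩ := exists_geometric_bound_of_window_contraction
    (f := fun l => β ^ (l / k) * 2) hk hβ0 hβ1 (C₀ := 0) (α₀ := 0) le_rfl le_rfl one_pos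
    (fun l => by
      simp only [zero_mul, add_zero]
      rw [Nat.add_div_right _ hk, pow_succ', mul_assoc])
  refine ⟨α, C, hα0, hα1, hC, fun π hπ l x i => ?_⟩
  obtain ⟨m, hm⟩ := hosc l x
  -- Stationarity places `π ⬝ᵥ x` between the same bounds as the entries of `M ^ l *ᵥ x`.
  have h1 := hπ.dotProduct_mem_Icc hm
  rw [hπ.dotProduct_pow_mulVec] at h1
  have h2 : β ^ (l / k) * (2 * ‖x‖) ≤ C * α ^ l * ‖x‖ := by
    rw [← mul_assoc]
    exact mul_le_mul_of_nonneg_right (hb l) (norm_nonneg _)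
  have := hm i
  rw [abs_le]
  constructor <;> linarith [h1.1, h1.2]

end Stochastic

/-! ### The aggregation matrices and their stationary distribution -/

section Aggregation

variable {V : Type*} [Fintype V] [DecidableEq V] (G : SimpleGraph V) [DecidableRel G.Adj]

theorem averagingMatrix_apply (u v : V) : averagingMatrix G u v =
    if v ∈ insert u (G.neighborFinset u) then 1 / ((G.degree u : ℝ) + 1) else 0 := rfl

theorem mem_insert_neighborFinset_comm (u v : V) :
    v ∈ insert u (G.neighborFinset u) ↔ u ∈ insert v (G.neighborFinset v) := by
  simp [eq_comm, G.adj_comm]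

theorem card_insert_neighborFinset (u : V) :
    ((insert u (G.neighborFinset u)).card : ℝ) = G.degree u + 1 := by
  rw [Finset.card_insert_of_notMem (by simp), G.card_neighborFinset_eq_degree]
  push_cast
  ring

theorem averagingMatrix_nonneg (u v : V) : 0 ≤ averagingMatrix G u v := by
  rw [averagingMatrix_apply]
  split_ifs <;> positivity

theorem averagingMatrix_mem_rowStochastic : averagingMatrix G ∈ rowStochastic ℝ V := by
  rw [mem_rowStochastic_iff_sum]
  refine ⟨averagingMatrix_nonneg G, fun u => ?_⟩
  simp only [averagingMatrix_apply]
  rw [Finset.sum_ite_mem, Finset.univ_inter, Finset.sum_const, nsmul_eq_mul,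
    card_insert_neighborFinset]
  field_simp

theorem aggregation_apply (p q : V × V) :
    aggregation G p q = averagingMatrix G p.1 q.1 * averagingMatrix G p.2 q.2 := rfl

theorem aggregation_mem_rowStochastic : aggregation G ∈ rowStochastic ℝ (V × V) := by
  rw [mem_rowStochastic_iff_sum]
  have hP := averagingMatrix_mem_rowStochastic G
  refine ⟨fun p q => mul_nonneg (averagingMatrix_nonneg G _ _) (averagingMatrix_nonneg G _ _),
    fun p => ?_⟩
  simp only [aggregation_apply]
  rw [Fintype.sum_prod_type, ← Finset.sum_mul_sum, sum_row_of_mem_rowStochastic hP,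
    sum_row_of_mem_rowStochastic hP, one_mul]

variable {δ : ℝ}

theorem residualAggregation_mem_rowStochastic (hδ0 : 0 ≤ δ) (hδ1 : δ ≤ 1) :
    residualAggregation G δ ∈ rowStochastic ℝ (V × V) :=
  convex_rowStochastic (aggregation_mem_rowStochastic G) (one_mem _) (by linarith) hδ0 (by ring)

theorem residualAggregation_mulVec (x : V × V → ℝ) :
    residualAggregation G δ *ᵥ x = (1 - δ) • (aggregation G *ᵥ x) + δ • x := by
  simp [residualAggregation, add_mulVec, smul_mulVec]

/-- `(1 - δ) 𝒜` is an entrywise lower bound, so positive paths of `𝒜` survive, and `δ` on the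
diagonal supplies the waiting steps. -/
theorem exists_pos_pow_residualAggregation (hirr : (aggregation G).IsIrreducible) (hδ0 : 0 < δ)
    (hδ1 : δ < 1) : ∃ k > 0, ∀ p q, 0 < (residualAggregation G δ ^ k) p q := by
  have hst := residualAggregation_mem_rowStochastic G hδ0.le hδ1.le
  have hA := aggregation_mem_rowStochastic G
  have hle : ∀ p q, (1 - δ) * aggregation G p q ≤ residualAggregation G δ p q := by
    intro p q
    simp only [residualAggregation, Matrix.add_apply, Matrix.smul_apply, smul_eq_mul, one_apply]
    split_ifs <;> nlinarith
  refine exists_pos_pow_of_pos_diag (fun p q => nonneg_of_mem_rowStochastic hst) (fun p => ?_)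
    fun p q => ?_
  · simp only [residualAggregation, Matrix.add_apply, Matrix.smul_apply, smul_eq_mul, one_apply_eq, mul_one]
    have : 0 ≤ aggregation G p p := nonneg_of_mem_rowStochastic hA
    nlinarith
  · obtain ⟨k, -, hk⟩ := (isIrreducible_iff_exists_pow_pos hirr.nonneg).1 hirr p q
    refine ⟨k, ?_⟩
    have hpow : ∀ n p q, (1 - δ) ^ n * (aggregation G ^ n) p q ≤
        (residualAggregation G δ ^ n) p q := by
      intro n
      induction n with
      | zero => intro p q; simp
      | succ n ih =>
        intro p q
        rw [pow_succ, pow_succ, mul_apply, pow_succ, mul_apply, Finset.mul_sum]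
        refine Finset.sum_le_sum fun r _ => ?_
        have h1 : 0 ≤ aggregation G r q := nonneg_of_mem_rowStochastic hA
        have h2 : 0 ≤ (residualAggregation G δ ^ n) p r :=
          nonneg_of_mem_rowStochastic (pow_mem hst n)
        calc (1 - δ) ^ n * (1 - δ) * ((aggregation G ^ n) p r * aggregation G r q)
            = ((1 - δ) ^ n * (aggregation G ^ n) p r) * ((1 - δ) * aggregation G r q) := by ring
          _ ≤ (residualAggregation G δ ^ n) p r * residualAggregation G δ r q :=
            mul_le_mul (ih p r) (hle r q) (mul_nonneg (by linarith) h1) h2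
    exact (mul_pos (pow_pos (by linarith) k) hk).trans_le (hpow k p q)

/-- Membership in closed neighbourhoods is symmetric, so `deg + 1` is an invariant measure of the
averaging walk; its tensor square is one for `𝒜`. -/
theorem sum_degree_mul_averagingMatrix (v : V) :
    ∑ u, ((G.degree u : ℝ) + 1) * averagingMatrix G u v = G.degree v + 1 := by
  have h : ∀ u, ((G.degree u : ℝ) + 1) * averagingMatrix G u v =
      if u ∈ insert v (G.neighborFinset v) then 1 else 0 := by
    intro u
    rw [averagingMatrix_apply, if_congr (mem_insert_neighborFinset_comm G u v) rfl rfl]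
    split_ifs
    · field_simp
    · simp
  simp only [h]
  rw [Finset.sum_ite_mem, Finset.univ_inter, Finset.sum_const, nsmul_eq_mul,
    card_insert_neighborFinset, mul_one]

theorem exists_isStationaryDistribution [Nonempty V] :
    ∃ π, IsStationaryDistribution (residualAggregation G δ) π := by
  set Z : ℝ := ∑ u, ((G.degree u : ℝ) + 1) with hZ
  have hZpos : 0 < Z := Finset.sum_pos (fun u _ => by positivity) Finset.univ_nonempty
  have hA : (fun p : V × V => ((G.degree p.1 : ℝ) + 1) / Z * (((G.degree p.2 : ℝ) + 1) / Z))
      ᵥ* aggregation G =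
      fun p : V × V => ((G.degree p.1 : ℝ) + 1) / Z * (((G.degree p.2 : ℝ) + 1) / Z) := by
    funext q
    simp only [vecMul, dotProduct, aggregation_apply]
    rw [Fintype.sum_prod_type]
    have h : ∀ u v : V, ((G.degree u : ℝ) + 1) / Z * (((G.degree v : ℝ) + 1) / Z) *
        (averagingMatrix G u q.1 * averagingMatrix G v q.2) =
        (((G.degree u : ℝ) + 1) * averagingMatrix G u q.1 / Z) *
        (((G.degree v : ℝ) + 1) * averagingMatrix G v q.2 / Z) := fun u v => by ring
    simp only [h]
    rw [← Finset.sum_mul_sum, ← Finset.sum_div, ← Finset.sum_div, sum_degree_mul_averagingMatrix,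
      sum_degree_mul_averagingMatrix]
  refine ⟨fun p : V × V => ((G.degree p.1 : ℝ) + 1) / Z * (((G.degree p.2 : ℝ) + 1) / Z),
    fun p => ?_, ?_, ?_⟩
  · positivity
  · have h := Finset.sum_mul_sum Finset.univ Finset.univ
      (fun u => ((G.degree u : ℝ) + 1) / Z) (fun u => ((G.degree u : ℝ) + 1) / Z)
    rw [← Finset.sum_div, ← hZ, div_self hZpos.ne', one_mul] at h
    rw [Fintype.sum_prod_type]
    exact h.symm
  · rw [residualAggregation, vecMul_add, vecMul_smul, vecMul_smul, hA, vecMul_one, ← add_smul]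
    simp

theorem existsUnique_isStationaryDistribution [Nonempty V]
    (hirr : (aggregation G).IsIrreducible) (hδ0 : 0 < δ) (hδ1 : δ < 1) :
    ∃! π, IsStationaryDistribution (residualAggregation G δ) π := by
  obtain ⟨π, hπ⟩ := exists_isStationaryDistribution G (δ := δ)
  refine ⟨π, hπ, fun π' hπ' => ?_⟩
  obtain ⟨α, C, hα0, hα1, hC, hb⟩ := exists_ergodic_bound
    (residualAggregation_mem_rowStochastic G hδ0.le hδ1.le)
    (exists_pos_pow_residualAggregation G hirr hδ0 hδ1)
  -- Both products are the limit of the same entry of `Ã ^ l *ᵥ x`.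
  have hdot : ∀ x, π' ⬝ᵥ x = π ⬝ᵥ x := by
    intro x
    obtain ⟨i⟩ : Nonempty (V × V) := inferInstance
    have hlim : Filter.Tendsto (fun l : ℕ => C * α ^ l * ‖x‖) Filter.atTop (nhds 0) := by
      simpa using ((tendsto_pow_atTop_nhds_zero_of_lt_one hα0.le hα1).const_mul C).mul_const ‖x‖
    have h1 : ∀ π, IsStationaryDistribution (residualAggregation G δ) π → Filter.Tendsto
        (fun l : ℕ => (residualAggregation G δ ^ l *ᵥ x) i) Filter.atTop (nhds (π ⬝ᵥ x)) := by
      intro π hπ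
      rw [tendsto_iff_norm_sub_tendsto_zero]
      exact squeeze_zero (fun _ => norm_nonneg _) (fun l => hb π hπ l x i) hlim
    exact tendsto_nhds_unique (h1 π' hπ') (h1 π hπ)
  funext i
  simpa using hdot (Pi.single i 1)

end Aggregation

/-! ### Second eigenvalues through detailed balance -/

section Spectrum

variable {ι : Type*} [Fintype ι] [DecidableEq ι]

/-- An eigenvector of an ergodic stochastic matrix for an eigenvalue `≥ 1` is constant. -/
theorem eq_const_of_mulVec_eq_smul [Nonempty ι] {M : Matrix ι ι ℝ} (hM : M ∈ rowStochastic ℝ ι)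
    (hpos : ∃ k > 0, ∀ i j, 0 < (M ^ k) i j) {π : ι → ℝ} (hπ : IsStationaryDistribution M π)
    {x : ι → ℝ} {μ : ℝ} (hμ : 1 ≤ μ) (hx : M *ᵥ x = μ • x) : ∀ i, x i = π ⬝ᵥ x := by
  obtain ⟨α, C, hα0, hα1, hC, hb⟩ := exists_ergodic_bound hM hpos
  have hpow : ∀ l : ℕ, M ^ l *ᵥ x = μ ^ l • x := by
    intro l
    induction l with
    | zero => simp
    | succ l ih => rw [pow_mulVec_succ, ih, mulVec_smul, hx, smul_smul, pow_succ]
  intro i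
  have hbound : ∀ l : ℕ, |x i - π ⬝ᵥ x| ≤ C * α ^ l * ‖x‖ := by
    intro l
    have h := hb π hπ l x i
    rw [hpow, Pi.smul_apply, smul_eq_mul] at h
    -- For `μ = 1` the ergodic bound already concerns `x` itself; for `μ > 1` stationarity forces `π
    -- ⬝ᵥ x = 0`, and the factor `μ ^ l` only helps.
    rcases hμ.eq_or_lt with rfl | hlt
    · simpa using h
    · have h0 : π ⬝ᵥ x = 0 := by
        have h1 := hπ.dotProduct_mulVec x
        rw [hx, dotProduct_smul, smul_eq_mul] at h1
        have h2 : (μ - 1) * (π ⬝ᵥ x) = 0 := by linarith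
        exact (mul_eq_zero.1 h2).resolve_left (by linarith)
      rw [h0, sub_zero] at h ⊢
      rw [abs_mul, abs_of_nonneg (by positivity)] at h
      exact (le_mul_of_one_le_left (abs_nonneg _) (one_le_pow₀ hμ)).trans h
  have hlim : Filter.Tendsto (fun l : ℕ => C * α ^ l * ‖x‖) Filter.atTop (nhds 0) := by
    simpa using ((tendsto_pow_atTop_nhds_zero_of_lt_one hα0.le hα1).const_mul C).mul_const ‖x‖
  have h0 := ge_of_tendsto' hlim hbound
  exact sub_eq_zero.1 (abs_eq_zero.1 (le_antisymm h0 (abs_nonneg _)))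

theorem diagonal_inv_mul_diagonal {w : ι → ℝ} (hw : ∀ i, 0 < w i) :
    diagonal w * diagonal (fun i => (w i)⁻¹) = 1 := by
  rw [diagonal_mul_diagonal, ← diagonal_one]
  congr 1
  funext i
  exact mul_inv_cancel₀ (hw i).ne'

theorem charpoly_diagonal_conj {w : ι → ℝ} (hw : ∀ i, 0 < w i) (B : Matrix ι ι ℝ) :
    (diagonal (fun i => (w i)⁻¹) * B * diagonal w).charpoly = B.charpoly := by
  rw [mul_assoc, charpoly_mul_comm, mul_assoc, diagonal_inv_mul_diagonal hw, mul_one]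

theorem IsHermitian.charpoly_eq_prod_eigenvalues₀ {B : Matrix ι ι ℝ} (hB : B.IsHermitian)
    (f : ℝ → ℝ) :
    (cfc f B).charpoly = ∏ i, (Polynomial.X - Polynomial.C (f (hB.eigenvalues₀ i))) := by
  rw [hB.charpoly_cfc_eq f]
  exact Fintype.prod_equiv (Fintype.equivOfCardEq (Fintype.card_fin _)).symm _ _ fun i => rfl

/-- The second largest eigenvalues of a matrix `M` in detailed balance with weights `w²`, and of
its residual version, when the residual version is an ergodic stochastic matrix. -/
theorem exists_secondLargestEigenvalue_of_reversible [Nonempty ι] {M : Matrix ι ι ℝ} {w : ι → ℝ}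
    (hw : ∀ i, 0 < w i) (hrev : ∀ i j, w i ^ 2 * M i j = w j ^ 2 * M j i)
    (hcard : 1 < Fintype.card ι) {δ : ℝ} (hδ0 : 0 < δ) (hδ1 : δ < 1)
    (hst : (1 - δ) • M + δ • (1 : Matrix ι ι ℝ) ∈ rowStochastic ℝ ι)
    (hpos : ∃ k > 0, ∀ i j, 0 < (((1 - δ) • M + δ • (1 : Matrix ι ι ℝ)) ^ k) i j)
    {π : ι → ℝ} (hπ : IsStationaryDistribution ((1 - δ) • M + δ • (1 : Matrix ι ι ℝ)) π) :
    ∃ lam lamRes : ℝ, IsSecondLargestEigenvalue M lam ∧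
      IsSecondLargestEigenvalue ((1 - δ) • M + δ • (1 : Matrix ι ι ℝ)) lamRes ∧
      lamRes = (1 - δ) * lam + δ ∧ lam < lamRes ∧ lamRes < 1 := by
  -- Detailed balance says exactly that this conjugate of `M` is symmetric; it has the same
  -- characteristic polynomial.
  set B : Matrix ι ι ℝ := diagonal w * M * diagonal (fun i => (w i)⁻¹) with hBdef
  have hBapp : ∀ i j, B i j = w i * M i j * (w j)⁻¹ := fun i j => by
    simp [hBdef, diagonal_mul, mul_diagonal]
  have hB : B.IsHermitian := by
    ext i j
    rw [conjTranspose_apply, star_trivial, hBapp, hBapp]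
    have h := hrev i j
    have hi := (hw i).ne'
    have hj := (hw j).ne'
    field_simp
    linarith
  have hinv : diagonal (fun i => (w i)⁻¹) * diagonal w = 1 := by
    rw [← diagonal_inv_mul_diagonal hw, diagonal_mul_diagonal, diagonal_mul_diagonal]
    simp_rw [mul_comm]
  have hM : M = diagonal (fun i => (w i)⁻¹) * B * diagonal w := by
    rw [hBdef, mul_assoc, mul_assoc, hinv, mul_one, ← mul_assoc, hinv, one_mul]
  have hcfc : cfc (fun x : ℝ => (1 - δ) * x + δ) B = (1 - δ) • B + δ • (1 : Matrix ι ι ℝ) := by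
    have hsa : IsSelfAdjoint B := hB
    rw [cfc_add_const δ (fun x : ℝ => (1 - δ) * x) B, cfc_const_mul_id (1 - δ) B]
    rw [Algebra.algebraMap_eq_smul_one]
  have hres : (1 - δ) • M + δ • (1 : Matrix ι ι ℝ) = diagonal (fun i => (w i)⁻¹) *
      ((1 - δ) • B + δ • (1 : Matrix ι ι ℝ)) * diagonal w := by
    rw [mul_add, add_mul, mul_smul_comm, smul_mul_assoc, ← hM, mul_smul_comm, mul_one,
      smul_mul_assoc, hinv]
  set ev := hB.eigenvalues₀ with hev
  have hmono : Antitone ev := hB.eigenvalues₀_antitone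
  -- Undoing the conjugation gives an eigenvector of the residual matrix with eigenvalue at least
  -- `1`, hence a constant one.
  have hconst : ∀ i, 1 ≤ hB.eigenvalues i → ∃ c : ℝ, ∀ j, hB.eigenvectorBasis i j = c * w j := by
    intro i hi
    set v : ι → ℝ := ⇑(hB.eigenvectorBasis i) with hv
    have hBv : B *ᵥ v = hB.eigenvalues i • v := hB.mulVec_eigenvectorBasis i
    set x : ι → ℝ := diagonal (fun i => (w i)⁻¹) *ᵥ v with hx
    have hvx : diagonal w *ᵥ x = v := by
      rw [hx, mulVec_mulVec, diagonal_inv_mul_diagonal hw, one_mulVec]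
    have hMx : M *ᵥ x = hB.eigenvalues i • x := by
      rw [hM, ← mulVec_mulVec, hvx, ← mulVec_mulVec, hBv, mulVec_smul]
    have hRx : ((1 - δ) • M + δ • (1 : Matrix ι ι ℝ)) *ᵥ x =
        ((1 - δ) * hB.eigenvalues i + δ) • x := by
      rw [add_mulVec, smul_mulVec, smul_mulVec, hMx, one_mulVec, smul_smul, ← add_smul]
    have hc := eq_const_of_mulVec_eq_smul hst hpos hπ (by nlinarith) hRx
    refine ⟨π ⬝ᵥ x, fun j => ?_⟩
    change v j = _
    rw [← hvx, mulVec_diagonal, hc j, mul_comm]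
  set e : Fin (Fintype.card ι) ≃ ι := Fintype.equivOfCardEq (Fintype.card_fin _) with he
  have hev_eq : ∀ k, hB.eigenvalues (e k) = ev k := fun k => by
    simp [hev, he, Matrix.IsHermitian.eigenvalues]
  -- Otherwise two orthonormal eigenvectors would both be nonzero multiples of the positive vector
  -- `w`.
  have hlt : ev ⟨1, hcard⟩ < 1 := by
    by_contra! hge
    have h0 : 1 ≤ ev ⟨0, by omega⟩ := hge.trans (hmono (by simp))
    obtain ⟨c₀, hc₀⟩ := hconst (e ⟨0, by omega⟩) (by rw [hev_eq]; exact h0)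
    obtain ⟨c₁, hc₁⟩ := hconst (e ⟨1, hcard⟩) (by rw [hev_eq]; exact hge)
    have horth := hB.eigenvectorBasis.orthonormal.2
      (show e ⟨0, by omega⟩ ≠ e ⟨1, hcard⟩ by simp)
    have hn₀ := hB.eigenvectorBasis.orthonormal.1 (e ⟨0, by omega⟩)
    have hn₁ := hB.eigenvectorBasis.orthonormal.1 (e ⟨1, hcard⟩)
    have hne : ∀ (k : Fin (Fintype.card ι)) (c : ℝ), ‖hB.eigenvectorBasis (e k)‖ = 1 →
        (∀ j, hB.eigenvectorBasis (e k) j = c * w j) → c ≠ 0 := by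
      rintro k c hn hc rfl
      have : hB.eigenvectorBasis (e k) = 0 := by ext j; simp [hc j]
      rw [this] at hn
      simp at hn
    have h2 : ∑ j, c₁ * w j * (c₀ * w j) = 0 := by
      beta_reduce at horth
      rw [PiLp.inner_apply] at horth
      simp only [hc₀, hc₁] at horth
      simpa using horth
    have h3 : ∑ j, c₁ * w j * (c₀ * w j) = c₁ * c₀ * ∑ j, w j ^ 2 := by
      rw [Finset.mul_sum]
      exact Finset.sum_congr rfl fun j _ => by ring
    have h4 : 0 < ∑ j, w j ^ 2 :=
      Finset.sum_pos (fun j _ => pow_pos (hw j) 2) Finset.univ_nonempty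
    rw [h3] at h2
    have := mul_ne_zero (mul_ne_zero (hne _ c₁ hn₁ hc₁) (hne _ c₀ hn₀ hc₀)) h4.ne'
    exact this h2
  refine ⟨ev ⟨1, hcard⟩, (1 - δ) * ev ⟨1, hcard⟩ + δ, ⟨ev, hmono, ?_, hcard, rfl⟩,
    ⟨fun i => (1 - δ) * ev i + δ, fun i j hij => ?_, ?_, hcard, rfl⟩, rfl, by nlinarith,
    by nlinarith⟩
  · have h := IsHermitian.charpoly_eq_prod_eigenvalues₀ hB (fun x => x)
    rw [cfc_id' ℝ B (show IsSelfAdjoint B from hB)] at h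
    rw [hM, charpoly_diagonal_conj hw, h]
  · have := hmono hij
    have h1 : 0 ≤ 1 - δ := by linarith
    simp only
    nlinarith
  · rw [hres, charpoly_diagonal_conj hw, ← hcfc,
      IsHermitian.charpoly_eq_prod_eigenvalues₀ hB]

variable {V : Type*} [Fintype V] [DecidableEq V] (G : SimpleGraph V) [DecidableRel G.Adj]

theorem averagingMatrix_reversible (u v : V) : ((G.degree u : ℝ) + 1) * averagingMatrix G u v =
    ((G.degree v : ℝ) + 1) * averagingMatrix G v u := by
  rw [averagingMatrix_apply, averagingMatrix_apply,
    if_congr (mem_insert_neighborFinset_comm G u v) rfl rfl]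
  split_ifs
  · field_simp
  · simp

theorem exists_secondLargestEigenvalue_aggregation [Nontrivial V]
    (hirr : (aggregation G).IsIrreducible) {δ : ℝ} (hδ0 : 0 < δ) (hδ1 : δ < 1) :
    ∃ lam lamRes : ℝ, IsSecondLargestEigenvalue (aggregation G) lam ∧
      IsSecondLargestEigenvalue (residualAggregation G δ) lamRes ∧
      lamRes = (1 - δ) * lam + δ ∧ lam < lamRes ∧ lamRes < 1 := by
  obtain ⟨π, hπ⟩ := exists_isStationaryDistribution G (δ := δ)
  refine exists_secondLargestEigenvalue_of_reversible
    (w := fun p : V × V => √(((G.degree p.1 : ℝ) + 1) * ((G.degree p.2 : ℝ) + 1)))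
    (fun p => by positivity) (fun p q => ?_) Fintype.one_lt_card hδ0 hδ1
    (residualAggregation_mem_rowStochastic G hδ0.le hδ1.le)
    (exists_pos_pow_residualAggregation G hirr hδ0 hδ1) hπ
  rw [Real.sq_sqrt (by positivity), Real.sq_sqrt (by positivity), aggregation_apply,
    aggregation_apply, mul_mul_mul_comm, averagingMatrix_reversible G p.1,
    averagingMatrix_reversible G p.2, mul_mul_mul_comm]

end Spectrum

/-! ### Gaussian pairs described by characteristic functions -/

section GaussianPair

theorem posSemidef_two_by_two {a b c : ℝ}
    (h : ∀ s t : ℝ, 0 ≤ a * s ^ 2 + 2 * c * s * t + b * t ^ 2) :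
    (!![a, c; c, b] : Matrix (Fin 2) (Fin 2) ℝ).PosSemidef := by
  refine PosSemidef.of_dotProduct_mulVec_nonneg ?_ fun x => ?_
  · ext i j
    fin_cases i <;> fin_cases j <;> simp
  · have := h (x 0) (x 1)
    simp only [dotProduct, mulVec, Fin.sum_univ_two, Pi.star_apply, star_trivial, of_apply,
      cons_val_zero, cons_val_one, cons_val', cons_val_fin_one]
    linarith

/-- `𝔼[f(z₁) g(z₂)]` for a centred Gaussian pair with variances `a`, `b` and covariance `c`. -/
noncomputable def pairing (f g : ℝ → ℝ) (a b c : ℝ) : ℝ :=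
  ∫ z : EuclideanSpace ℝ (Fin 2), f (z 0) * g (z 1) ∂(multivariateGaussian 0 !![a, c; c, b])

variable {Ω Ω' : Type*} [MeasurableSpace Ω] [MeasurableSpace Ω']

/-- `(X, Y)` is a centred Gaussian pair under `μ` with variances `a`, `b` and covariance `c`. -/
structure IsGaussianPair (μ : Measure Ω) (X Y : Ω → ℝ) (a b c : ℝ) : Prop where
  measurable_left : Measurable X
  measurable_right : Measurable Y
  integral_exp (s t : ℝ) : ∫ ω, Complex.exp ((s * X ω + t * Y ω : ℝ) * Complex.I) ∂μ =
    Complex.exp ((-(a * s ^ 2 + 2 * c * s * t + b * t ^ 2) / 2 : ℝ))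

variable {μ : Measure Ω} {ν : Measure Ω'} {X Y : Ω → ℝ} {a b c : ℝ}

namespace IsGaussianPair

/-- A characteristic function is bounded by `1`, so the structure itself forces the covariance to be
positive semidefinite. -/
theorem quadratic_nonneg [IsProbabilityMeasure μ] (h : IsGaussianPair μ X Y a b c) (s t : ℝ) :
    0 ≤ a * s ^ 2 + 2 * c * s * t + b * t ^ 2 := by
  have h1 : ‖∫ ω, Complex.exp ((s * X ω + t * Y ω : ℝ) * Complex.I) ∂μ‖ ≤ 1 := by
    refine (norm_integral_le_of_norm_le_const (C := 1)
      (Filter.Eventually.of_forall fun ω => ?_)).trans (by simp)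
    rw [Complex.norm_exp_ofReal_mul_I]
  rw [h.integral_exp, ← Complex.ofReal_exp, Complex.norm_real, Real.norm_eq_abs, Real.abs_exp,
    Real.exp_le_one_iff] at h1
  linarith

theorem posSemidef [IsProbabilityMeasure μ] (h : IsGaussianPair μ X Y a b c) :
    (!![a, c; c, b] : Matrix (Fin 2) (Fin 2) ℝ).PosSemidef :=
  posSemidef_two_by_two h.quadratic_nonneg

theorem measurable_pair (h : IsGaussianPair μ X Y a b c) :
    Measurable fun ω => (WithLp.toLp 2 ![X ω, Y ω] : EuclideanSpace ℝ (Fin 2)) := by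
  have hX := h.measurable_left
  have hY := h.measurable_right
  refine (PiLp.continuous_toLp 2 _).measurable.comp (measurable_pi_lambda _ fun i => ?_)
  fin_cases i
  · exact hX
  · exact hY

theorem map_eq [IsProbabilityMeasure μ] (h : IsGaussianPair μ X Y a b c) :
    μ.map (fun ω => (WithLp.toLp 2 ![X ω, Y ω] : EuclideanSpace ℝ (Fin 2))) =
      multivariateGaussian 0 !![a, c; c, b] := by
  have := Measure.isProbabilityMeasure_map (μ := μ) h.measurable_pair.aemeasurable
  refine Measure.ext_of_charFun (funext fun x => ?_)
  rw [charFun_multivariateGaussian h.posSemidef, charFun_apply,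
    integral_map h.measurable_pair.aemeasurable (by fun_prop)]
  have h1 := h.integral_exp (x 0) (x 1)
  have h2 : ∀ ω, inner ℝ (WithLp.toLp 2 ![X ω, Y ω] : EuclideanSpace ℝ (Fin 2)) x =
      x 0 * X ω + x 1 * Y ω := fun ω => by
    simp [PiLp.inner_apply]
  simp only [h2]
  rw [h1]
  congr 1
  simp only [inner_zero_right, Complex.ofReal_zero, zero_mul, zero_sub]
  rw [← neg_div]
  simp only [dotProduct, mulVec, Fin.sum_univ_two, of_apply, cons_val_zero, cons_val_one, cons_val',
    cons_val_fin_one]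
  push_cast
  ring

/-- The law depends on the covariance alone, so a `pairing` may be computed in whichever realization
suits the argument. -/
theorem integral_eq_pairing [IsProbabilityMeasure μ] (h : IsGaussianPair μ X Y a b c)
    {f g : ℝ → ℝ} (hf : Measurable f) (hg : Measurable g) :
    ∫ ω, f (X ω) * g (Y ω) ∂μ = pairing f g a b c := by
  rw [pairing, ← h.map_eq, integral_map h.measurable_pair.aemeasurable
    (Measurable.aestronglyMeasurable (by fun_prop))]
  rfl

theorem symm (h : IsGaussianPair μ X Y a b c) : IsGaussianPair μ Y X b a c :=
  ⟨h.measurable_right, h.measurable_left, fun s t => by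
    rw [← (by ring : a * t ^ 2 + 2 * c * t * s + b * s ^ 2 = b * s ^ 2 + 2 * c * s * t + a * t ^ 2),
      ← h.integral_exp t s]
    simp_rw [add_comm]⟩

theorem linear (h : IsGaussianPair μ X Y a b c) (p q p' q' : ℝ) :
    IsGaussianPair μ (fun ω => p * X ω + q * Y ω) (fun ω => p' * X ω + q' * Y ω)
      (p ^ 2 * a + 2 * p * q * c + q ^ 2 * b) (p' ^ 2 * a + 2 * p' * q' * c + q' ^ 2 * b)
      (p * p' * a + (p * q' + q * p') * c + q * q' * b) := by
  have hX := h.measurable_left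
  have hY := h.measurable_right
  refine ⟨by fun_prop, by fun_prop, fun s t => ?_⟩
  have h1 := h.integral_exp (s * p + t * p') (s * q + t * q')
  refine Eq.trans ?_ (h1.trans ?_)
  · congr 1
    funext ω
    congr 3
    ring
  · congr 2
    ring

theorem prod [SFinite μ] [SFinite ν] (h : IsGaussianPair μ X Y a b c) {X' Y' : Ω' → ℝ}
    {a' b' c' : ℝ} (h' : IsGaussianPair ν X' Y' a' b' c') :
    IsGaussianPair (μ.prod ν) (fun ω => X ω.1 + X' ω.2) (fun ω => Y ω.1 + Y' ω.2)
      (a + a') (b + b') (c + c') := by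
  have hX := h.measurable_left
  have hY := h.measurable_right
  have hX' := h'.measurable_left
  have hY' := h'.measurable_right
  refine ⟨by fun_prop, by fun_prop, fun s t => ?_⟩
  have h1 : ∀ ω : Ω × Ω', Complex.exp
      ((s * (X ω.1 + X' ω.2) + t * (Y ω.1 + Y' ω.2) : ℝ) * Complex.I) =
      Complex.exp ((s * X ω.1 + t * Y ω.1 : ℝ) * Complex.I) *
      Complex.exp ((s * X' ω.2 + t * Y' ω.2 : ℝ) * Complex.I) := fun ω => by
    rw [← Complex.exp_add]
    congr 1
    push_cast
    ring
  simp only [h1]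
  rw [integral_prod_mul (fun ω => Complex.exp ((s * X ω + t * Y ω : ℝ) * Complex.I))
    (fun ω => Complex.exp ((s * X' ω + t * Y' ω : ℝ) * Complex.I)), h.integral_exp,
    h'.integral_exp, ← Complex.exp_add, ← Complex.ofReal_add]
  congr 2
  ring

end IsGaussianPair

/-- Completely correlated coordinates; with `q = 0` it also serves as noise on the first coordinate
alone. -/
theorem isGaussianPair_gaussianReal (p q : ℝ) :
    IsGaussianPair (gaussianReal 0 1) (fun x => p * x) (fun x => q * x) (p ^ 2) (q ^ 2)
      (p * q) := by
  refine ⟨by fun_prop, by fun_prop, fun s t => ?_⟩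
  have h := charFun_gaussianReal (μ := 0) (v := 1) (s * p + t * q)
  rw [charFun_apply_real] at h
  refine Eq.trans ?_ (h.trans ?_)
  · congr 1
    funext x
    congr 2
    push_cast
    ring
  · congr 1
    push_cast
    ring

theorem isGaussianPair_multivariateGaussian {ι : Type*} [Fintype ι] [DecidableEq ι]
    {K : Matrix ι ι ℝ} (hK : K.PosSemidef) (u v : ι) :
    IsGaussianPair (multivariateGaussian 0 K) (fun z => z u) (fun z => z v) (K u u) (K v v)
      (K u v) := by
  refine ⟨by fun_prop, by fun_prop, fun s t => ?_⟩
  have hsymm : K v u = K u v := by simpa using congrFun₂ hK.isHermitian u v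
  have h := charFun_multivariateGaussian (μ := 0) hK
    (s • EuclideanSpace.single u 1 + t • EuclideanSpace.single v 1)
  rw [charFun_apply] at h
  refine Eq.trans ?_ (h.trans ?_)
  · congr 1
    funext z
    congr 2
    simp [inner_add_right, inner_smul_right, EuclideanSpace.inner_single_right]
  · congr 1
    simp [add_dotProduct, mulVec_add, mulVec_smul, hsymm]
    ring

/-- Transfer of expectations along an identity of laws with a scaled standard Gaussian. -/
theorem integral_comp_of_map_eq {Z : Ω → ℝ} (hZ : Measurable Z) {σ : ℝ}
    (h : μ.map Z = (gaussianReal 0 1).map (fun x => σ * x)) {f : ℝ → ℝ} (hf : Measurable f) :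
    ∫ ω, f (Z ω) ∂μ = ∫ x, f (σ * x) ∂(gaussianReal 0 1) := by
  rw [← integral_map hZ.aemeasurable hf.aestronglyMeasurable, h,
    integral_map (by fun_prop) hf.aestronglyMeasurable]

theorem integrable_comp_of_map_eq {Z : Ω → ℝ} (hZ : Measurable Z) {σ : ℝ}
    (h : μ.map Z = (gaussianReal 0 1).map (fun x => σ * x)) {f : ℝ → ℝ} (hf : Measurable f)
    (hint : Integrable (fun x => f (σ * x)) (gaussianReal 0 1)) :
    Integrable (fun ω => f (Z ω)) μ := by
  have h1 := (integrable_map_measure (μ := gaussianReal 0 1) (f := fun x => σ * x)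
    hf.aestronglyMeasurable (by fun_prop)).2 hint
  rw [← h] at h1
  exact (integrable_map_measure hf.aestronglyMeasurable hZ.aemeasurable).1 h1

variable [IsProbabilityMeasure μ]

namespace IsGaussianPair

theorem map_left_eq_map_eval (h : IsGaussianPair μ X Y a b c) :
    μ.map X = (multivariateGaussian 0 !![a, c; c, b]).map (fun z => z 0) := by
  rw [← h.map_eq, Measure.map_map (by fun_prop) h.measurable_pair]
  rfl

/-- `(X, X)` and `(√a x, √a x)` realize the same covariance, so their first marginals agree. -/
theorem map_left (h : IsGaussianPair μ X Y a b c) :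
    μ.map X = (gaussianReal 0 1).map (fun x => √a * x) := by
  have ha : 0 ≤ a := by simpa using h.quadratic_nonneg 1 0
  have h1 := h.linear 1 0 1 0
  have h2 := isGaussianPair_gaussianReal (√a) (√a)
  have h4 := h1.map_left_eq_map_eval
  have h5 := h2.map_left_eq_map_eval
  simp only [one_mul, zero_mul, add_zero] at h4
  rw [h4, h5]
  congr 2
  ext i j
  fin_cases i <;> fin_cases j <;> simp [Real.sq_sqrt ha, Real.mul_self_sqrt ha]

theorem map_right (h : IsGaussianPair μ X Y a b c) :
    μ.map Y = (gaussianReal 0 1).map (fun x => √b * x) := h.symm.map_left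

theorem map_sub (h : IsGaussianPair μ X Y a b c) :
    μ.map (fun ω => X ω - Y ω) = (gaussianReal 0 1).map (fun x => √(a + b - 2 * c) * x) := by
  have h1 := (h.linear 1 (-1) 0 0).map_left
  have h2 : (fun ω => 1 * X ω + -1 * Y ω) = fun ω => X ω - Y ω := by
    funext ω
    ring
  rwa [h2, show (1 : ℝ) ^ 2 * a + 2 * 1 * (-1) * c + (-1) ^ 2 * b = a + b - 2 * c by ring] at h1

end IsGaussianPair

theorem integrable_sq_gaussianReal (σ : ℝ) :
    Integrable (fun x => (σ * x) ^ 2) (gaussianReal 0 1) := by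
  have h : MemLp id 2 (gaussianReal 0 1) := memLp_id_gaussianReal 2
  simpa [mul_pow] using (h.integrable_sq.const_mul (σ ^ 2))

theorem integral_sq_gaussianReal (σ : ℝ) : ∫ x, (σ * x) ^ 2 ∂(gaussianReal 0 1) = σ ^ 2 := by
  have h := variance_id_gaussianReal (μ := 0) (v := 1)
  rw [variance_of_integral_eq_zero (by fun_prop) (by simp)] at h
  simp only [mul_pow, integral_const_mul]
  simp only [id_eq] at h
  rw [h]
  simp

namespace IsGaussianPair

theorem integrable_left_sq (h : IsGaussianPair μ X Y a b c) :
    Integrable (fun ω => X ω ^ 2) μ :=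
  integrable_comp_of_map_eq h.measurable_left h.map_left (f := fun x => x ^ 2) (by fun_prop)
    (integrable_sq_gaussianReal _)

theorem integral_left_sq (h : IsGaussianPair μ X Y a b c) : ∫ ω, X ω ^ 2 ∂μ = a := by
  rw [integral_comp_of_map_eq h.measurable_left h.map_left (f := fun x => x ^ 2) (by fun_prop),
    integral_sq_gaussianReal, Real.sq_sqrt (by simpa using h.quadratic_nonneg 1 0)]

theorem integral_sub_sq (h : IsGaussianPair μ X Y a b c) :
    ∫ ω, (X ω - Y ω) ^ 2 ∂μ = a + b - 2 * c := by
  have h1 := integral_comp_of_map_eq (h.measurable_left.sub h.measurable_right) h.map_sub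
    (f := fun x => x ^ 2) (by fun_prop)
  simp only [Pi.sub_apply] at h1
  rw [h1, integral_sq_gaussianReal, Real.sq_sqrt (by linarith [h.quadratic_nonneg 1 (-1)])]

theorem integrable_sub_sq (h : IsGaussianPair μ X Y a b c) :
    Integrable (fun ω => (X ω - Y ω) ^ 2) μ :=
  integrable_comp_of_map_eq (h.measurable_left.sub h.measurable_right) h.map_sub
    (f := fun x => x ^ 2) (by fun_prop) (integrable_sq_gaussianReal _)

theorem integrable_mul (h : IsGaussianPair μ X Y a b c) :
    Integrable (fun ω => X ω * Y ω) μ := by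
  have hX := h.measurable_left
  have hY := h.measurable_right
  refine (h.integrable_left_sq.add h.symm.integrable_left_sq).mono'
    (Measurable.aestronglyMeasurable (by fun_prop)) (Filter.Eventually.of_forall fun ω => ?_)
  rw [Real.norm_eq_abs, abs_le]
  simp only [Pi.add_apply]
  constructor <;> nlinarith [sq_nonneg (X ω - Y ω), sq_nonneg (X ω + Y ω)]

theorem integral_mul (h : IsGaussianPair μ X Y a b c) : ∫ ω, X ω * Y ω ∂μ = c := by
  have h1 : ∀ ω, X ω * Y ω = (X ω ^ 2 + Y ω ^ 2 - (X ω - Y ω) ^ 2) / 2 := fun ω => by ring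
  simp only [h1]
  have h2 : Integrable (fun ω => X ω ^ 2 + Y ω ^ 2) μ :=
    h.integrable_left_sq.add h.symm.integrable_left_sq
  rw [integral_div, integral_sub h2 h.integrable_sub_sq, integral_add h.integrable_left_sq h.symm.integrable_left_sq,
    h.integral_left_sq, h.symm.integral_left_sq, h.integral_sub_sq]
  ring

end IsGaussianPair

end GaussianPair

/-! ### Perturbed iterations of an ergodic matrix -/

section Recursion

variable {ι : Type*} [Fintype ι]

theorem abs_apply_le_norm (x : ι → ℝ) (i : ι) : |x i| ≤ ‖x‖ := norm_le_pi_norm x i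

/-- Discrete Grönwall: a step multiplies `1 + ‖T r‖` by at most `1 + ε` and adds at most `|q|`. -/
theorem norm_le_growth_of_approx_shift {R : ℕ} {q ε : ℝ} {T : ℕ → ι → ℝ} (hε : 0 ≤ ε)
    (hstep : ∀ r < R, ∀ i, |T (r + 1) i - (T r i + q)| ≤ ε * (1 + |T r i|)) :
    ∀ r ≤ R, 1 + ‖T r‖ ≤ (1 + ε) ^ r * (1 + ‖T 0‖ + r * |q|) := by
  intro r hr
  induction r with
  | zero => simp
  | succ r ih =>
    have ih := ih (by omega)
    have h1 : ‖T (r + 1)‖ ≤ (1 + ε) * (1 + ‖T r‖) + |q| - 1 := by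
      refine (pi_norm_le_iff_of_nonneg ?_).2 fun i => ?_
      · nlinarith [norm_nonneg (T r), abs_nonneg q, mul_nonneg hε (norm_nonneg (T r))]
      · have h2 := hstep r (by omega) i
        have h3 : |T r i| ≤ ‖T r‖ := norm_le_pi_norm (T r) i
        have h4 : |T (r + 1) i| ≤ |T (r + 1) i - (T r i + q)| + (|T r i| + |q|) := by
          have := abs_add_le (T (r + 1) i - (T r i + q)) (T r i + q)
          rw [sub_add_cancel] at this
          linarith [abs_add_le (T r i) q]
        rw [Real.norm_eq_abs]
        nlinarith
    have h5 : 1 ≤ (1 + ε) ^ (r + 1) := one_le_pow₀ (by linarith)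
    have h6 := mul_le_mul_of_nonneg_left ih (show 0 ≤ 1 + ε by linarith)
    have h7 := mul_le_mul_of_nonneg_right h5 (abs_nonneg q)
    push_cast
    rw [pow_succ] at h7 ⊢
    nlinarith

variable [DecidableEq ι] [Nonempty ι]

/-- Iterates of an ergodic stochastic matrix, perturbed by exponentially small errors, converge
exponentially fast to a constant vector. -/
theorem exists_limit_of_perturbed_iteration {M : Matrix ι ι ℝ} (hM : M ∈ rowStochastic ℝ ι)
    (hpos : ∃ k > 0, ∀ i j, 0 < (M ^ k) i j) {π : ι → ℝ} (hπ : IsStationaryDistribution M π)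
    {y : ℕ → ι → ℝ} {E σ : ℝ} (hσ0 : 0 ≤ σ) (hσ1 : σ < 1)
    (hy : ∀ l, ‖y (l + 1) - M *ᵥ y l‖ ≤ E * σ ^ l) :
    ∃ κ α C : ℝ, 0 < α ∧ α < 1 ∧ 0 < C ∧ ∀ l i, |y l i - κ| ≤ C * α ^ l := by
  obtain ⟨α₁, C₁, hα₁, hα₁', hC₁, herg⟩ := exists_ergodic_bound hM hpos
  have hE : 0 ≤ E := by simpa using (norm_nonneg _).trans (hy 0)
  set e : ℕ → ι → ℝ := fun l => y (l + 1) - M *ᵥ y l with he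
  have hye : ∀ l, y (l + 1) = M *ᵥ y l + e l := fun l => by simp [he]
  have hdot : ∀ x : ι → ℝ, |π ⬝ᵥ x| ≤ ‖x‖ := fun x =>
    abs_le.2 (hπ.dotProduct_mem_Icc fun i => abs_le.1 (abs_apply_le_norm x i))
  -- The `π`-mean `p` has geometrically small increments and so converges; the remaining part `z`
  -- has mean zero and is contracted by powers of `M`.
  set p : ℕ → ℝ := fun l => π ⬝ᵥ y l with hp
  have hpstep : ∀ l, p (l + 1) = p l + π ⬝ᵥ e l := fun l => by
    simp only [hp]
    rw [hye, dotProduct_add, hπ.dotProduct_mulVec]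
  have hpdist : ∀ l, dist (p l) (p (l + 1)) ≤ E * σ ^ l := fun l => by
    rw [hpstep, Real.dist_eq, sub_add_cancel_left, abs_neg]
    exact (hdot _).trans (hy l)
  obtain ⟨κ, hκ⟩ := cauchySeq_tendsto_of_complete (cauchySeq_of_le_geometric σ E hσ1 hpdist)
  have hpκ : ∀ l, |p l - κ| ≤ E / (1 - σ) * σ ^ l := fun l => by
    have := dist_le_of_le_geometric_of_tendsto σ E hσ1 hpdist hκ l
    rw [Real.dist_eq] at this
    exact this.trans_eq (by ring)
  set z : ℕ → ι → ℝ := fun l => y l - fun _ => p l with hz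
  have hπz : ∀ l, π ⬝ᵥ z l = 0 := fun l => by
    simp only [hz, dotProduct_sub]
    rw [hπ.dotProduct_const, sub_self]
  have hzstep : ∀ l, ‖z (l + 1) - M *ᵥ z l‖ ≤ 2 * E * σ ^ l := fun l => by
    have h1 : z (l + 1) - M *ᵥ z l = e l - fun _ => π ⬝ᵥ e l := by
      simp only [hz]
      rw [mulVec_sub, mulVec_const hM, hye, hpstep]
      funext i
      simp only [Pi.sub_apply, Pi.add_apply]
      ring
    rw [h1]
    refine (norm_sub_le _ _).trans ?_
    have h2 : ‖(fun _ => π ⬝ᵥ e l : ι → ℝ)‖ ≤ E * σ ^ l :=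
      (pi_norm_le_iff_of_nonneg (by positivity)).2 fun i => (hdot _).trans (hy l)
    linarith [hy l]
  have hzpow : ∀ n l, ‖z (l + n) - M ^ n *ᵥ z l‖ ≤ n * (2 * E) * σ ^ l := by
    intro n l
    induction n with
    | zero => simp
    | succ n ih =>
      have h1 : z (l + (n + 1)) - M ^ (n + 1) *ᵥ z l =
          (z (l + n + 1) - M *ᵥ z (l + n)) + M *ᵥ (z (l + n) - M ^ n *ᵥ z l) := by
        rw [pow_mulVec_succ, mulVec_sub M (z (l + n)) (M ^ n *ᵥ z l), ← add_assoc]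
        exact (sub_add_sub_cancel (z (l + n + 1)) (M *ᵥ z (l + n)) (M *ᵥ (M ^ n *ᵥ z l))).symm
      rw [h1]
      refine (norm_add_le _ _).trans ?_
      have h2 : σ ^ (l + n) ≤ σ ^ l := pow_le_pow_of_le_one hσ0 hσ1.le (Nat.le_add_right _ _)
      have h3 := (norm_mulVec_le hM (z (l + n) - M ^ n *ᵥ z l)).trans ih
      have h4 := (hzstep (l + n)).trans (mul_le_mul_of_nonneg_left h2 (by positivity))
      push_cast
      linarith
  -- A window long enough that `M ^ (n + 1)` halves mean-zero vectors.
  obtain ⟨n, hn⟩ : ∃ n : ℕ, C₁ * α₁ ^ (n + 1) ≤ 1 / 2 := by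
    obtain ⟨n, hn⟩ := exists_pow_lt_of_lt_one (show 0 < 1 / (2 * C₁) by positivity) hα₁'
    refine ⟨n, ?_⟩
    have h1 : α₁ ^ (n + 1) ≤ α₁ ^ n := pow_le_pow_of_le_one hα₁.le hα₁'.le (Nat.le_succ n)
    have h2 := mul_le_mul_of_nonneg_left (h1.trans hn.le) hC₁.le
    exact h2.trans_eq (by field_simp)
  obtain ⟨α₂, C₂, hα₂, hα₂', hC₂, hb⟩ := exists_geometric_bound_of_window_contraction
    (f := fun l => ‖z l‖) (k := n + 1) (Nat.succ_pos n) (β := 1 / 2) (by norm_num) (by norm_num)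
    (C₀ := (n + 1 : ℕ) * (2 * E)) (α₀ := σ) (by positivity) hσ0 hσ1 (fun l => by
      have h1 : ‖M ^ (n + 1) *ᵥ z l‖ ≤ 1 / 2 * ‖z l‖ := by
        refine (pi_norm_le_iff_of_nonneg (by positivity)).2 fun i => ?_
        have := herg π hπ (n + 1) (z l) i
        rw [hπz, sub_zero] at this
        exact this.trans (mul_le_mul_of_nonneg_right hn (norm_nonneg _))
      have h2 := hzpow (n + 1) l
      have h3 := norm_le_insert' (z (l + (n + 1))) (M ^ (n + 1) *ᵥ z l)
      linarith)
  have hE' : 0 ≤ E / (1 - σ) := div_nonneg hE (by linarith)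
  refine ⟨κ, max α₂ σ, C₂ + E / (1 - σ), lt_max_of_lt_left hα₂, max_lt hα₂' hσ1, by positivity,
    fun l i => ?_⟩
  have h1 : |y l i - p l| ≤ C₂ * α₂ ^ l := (abs_apply_le_norm (z l) i).trans (hb l)
  have h2 : C₂ * α₂ ^ l ≤ C₂ * max α₂ σ ^ l := by
    gcongr
    exact le_max_left _ _
  have h3 : E / (1 - σ) * σ ^ l ≤ E / (1 - σ) * max α₂ σ ^ l := by
    gcongr
    exact le_max_right _ _
  have h4 := abs_sub_le (y l i) (p l) κ
  linarith [hpκ l]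

/-- A recursion that adds approximately `q` in each of the `R` inner steps and applies an ergodic
stochastic matrix in the outer step grows like `R l q` plus a constant. -/
theorem exists_affine_asymptotics {M : Matrix ι ι ℝ} (hM : M ∈ rowStochastic ℝ ι)
    (hpos : ∃ k > 0, ∀ i j, 0 < (M ^ k) i j) {π : ι → ℝ} (hπ : IsStationaryDistribution M π)
    {T : ℕ → ℕ → ι → ℝ} {R : ℕ} {q C₀ α₀ : ℝ} (hC₀ : 0 ≤ C₀) (hα0 : 0 ≤ α₀) (hα1 : α₀ < 1)
    (hzero : ∀ l, T (l + 1) 0 = M *ᵥ T l R)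
    (hstep : ∀ l, ∀ r < R, ∀ i, |T l (r + 1) i - (T l r i + q)| ≤
      C₀ * α₀ ^ l * (1 + |T l r i|)) :
    ∃ α C : ℝ, 0 < α ∧ α < 1 ∧ 0 < C ∧ ∃ κ : ℕ → ℝ, ∀ r ≤ R, ∀ l i,
      |T l r i - (R * l * q + κ r)| ≤ C * α ^ l := by
  -- The error is relative to `|T|`, which is not yet controlled. Writing `α₀ ^ l = σ ^ l * σ ^ l`
  -- spends one factor on bounding `f l = σ ^ l * (1 + ‖T l 0‖)` and keeps the other as an absolute
  -- error.
  set σ := √α₀ with hσ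
  have hσ0 : 0 ≤ σ := Real.sqrt_nonneg _
  have hσ1 : σ < 1 := by rw [hσ, Real.sqrt_lt' one_pos]; simpa using hα1
  have hσα : ∀ l : ℕ, α₀ ^ l = σ ^ l * σ ^ l := fun l => by
    rw [← mul_pow, Real.mul_self_sqrt hα0]
  have hgrow : ∀ l, ∀ r ≤ R, 1 + ‖T l r‖ ≤
      (1 + C₀ * α₀ ^ l) ^ r * (1 + ‖T l 0‖ + r * |q|) := fun l =>
    norm_le_growth_of_approx_shift (by positivity) (hstep l)
  set f : ℕ → ℝ := fun l => σ ^ l * (1 + ‖T l 0‖) with hf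
  have hfstep : ∀ l, f (l + 1) ≤ σ * (1 + C₀ * α₀ ^ l) ^ R * (f l + R * |q| * σ ^ l) := by
    intro l
    have h1 : 1 + ‖T (l + 1) 0‖ ≤ (1 + C₀ * α₀ ^ l) ^ R * (1 + ‖T l 0‖ + R * |q|) := by
      rw [hzero]
      linarith [norm_mulVec_le hM (T l R), hgrow l R le_rfl]
    calc f (l + 1) = σ ^ (l + 1) * (1 + ‖T (l + 1) 0‖) := rfl
      _ ≤ σ ^ (l + 1) * ((1 + C₀ * α₀ ^ l) ^ R * (1 + ‖T l 0‖ + R * |q|)) := by gcongr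
      _ = σ * (1 + C₀ * α₀ ^ l) ^ R * (σ ^ l * (1 + ‖T l 0‖) + R * |q| * σ ^ l) := by ring
  -- The growth factor of `f` tends to `σ`, so it is eventually below the midpoint of `σ` and `1`.
  obtain ⟨L, hL⟩ : ∃ L : ℕ, ∀ l ≥ L, σ * (1 + C₀ * α₀ ^ l) ^ R ≤ (1 + σ) / 2 := by
    have hlim : Filter.Tendsto (fun l : ℕ => σ * (1 + C₀ * α₀ ^ l) ^ R) Filter.atTop
        (nhds (σ * (1 + C₀ * 0) ^ R)) :=
      ((((tendsto_pow_atTop_nhds_zero_of_lt_one hα0 hα1).const_mul C₀).const_add 1).pow R).const_mul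
        σ
    have hlt : σ * (1 + C₀ * 0) ^ R < (1 + σ) / 2 := by
      rw [mul_zero, add_zero, one_pow, mul_one]
      linarith
    have h := hlim.eventually (gt_mem_nhds hlt)
    obtain ⟨L, hL⟩ := Filter.eventually_atTop.1 h
    exact ⟨L, fun l hl => (hL l hl).le⟩
  obtain ⟨B, hB0, hB⟩ : ∃ B, 0 < B ∧ ∀ l, f l ≤ B := by
    obtain ⟨α, C, hα, hα', hC, hb⟩ := exists_geometric_bound_of_window_contraction
      (f := fun l => f (l + L)) (k := 1) one_pos (β := (1 + σ) / 2) (by linarith) (by linarith)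
      (C₀ := R * |q|) (α₀ := σ) (by positivity) hσ0 hσ1 (fun l => by
        have h1 := hfstep (l + L)
        have h2 : σ ^ (l + L) ≤ σ ^ l := pow_le_pow_of_le_one hσ0 hσ1.le (Nat.le_add_right _ _)
        have h3 := hL (l + L) (Nat.le_add_left _ _)
        have h4 : 0 ≤ f (l + L) := by positivity
        have h5 : 0 ≤ R * |q| * σ ^ (l + L) := by positivity
        rw [show l + 1 + L = l + L + 1 by omega]
        calc f (l + L + 1) ≤ _ := h1
          _ ≤ (1 + σ) / 2 * (f (l + L) + R * |q| * σ ^ (l + L)) := by gcongr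
          _ ≤ (1 + σ) / 2 * f (l + L) + 1 * (R * |q| * σ ^ (l + L)) := by
            rw [mul_add]; gcongr; linarith
          _ ≤ (1 + σ) / 2 * f (l + L) + R * |q| * σ ^ l := by rw [one_mul]; gcongr)
    have hfn : ∀ l, 0 ≤ f l := fun l => by positivity
    refine ⟨C + ∑ l ∈ Finset.range L, f l, by
      have := Finset.sum_nonneg (s := Finset.range L) (f := f) fun l _ => hfn l
      linarith, fun l => ?_⟩
    rcases lt_or_ge l L with hl | hl
    · have := Finset.single_le_sum (f := f) (fun i _ => hfn i) (Finset.mem_range.2 hl)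
      linarith
    · obtain ⟨m, rfl⟩ := Nat.exists_eq_add_of_le' hl
      have h1 := hb m
      have h2 : C * α ^ m ≤ C * 1 := by gcongr; exact pow_le_one₀ hα.le hα'.le
      have := Finset.sum_nonneg (s := Finset.range L) (f := f) fun l _ => hfn l
      linarith
  set E := C₀ * ((1 + C₀) ^ R * (B + R * |q|)) with hE
  have hE0 : 0 ≤ E := by positivity
  have hinner : ∀ l, ∀ r < R, ∀ i, |T l (r + 1) i - (T l r i + q)| ≤ E * σ ^ l := by
    intro l r hr i
    have h1 := hgrow l r hr.le
    have h2 : |T l r i| ≤ ‖T l r‖ := norm_le_pi_norm (T l r) i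
    have h3 : (1 + C₀ * α₀ ^ l) ^ r ≤ (1 + C₀) ^ R :=
      calc (1 + C₀ * α₀ ^ l) ^ r ≤ (1 + C₀ * 1) ^ r := by
            gcongr; exact pow_le_one₀ hα0 hα1.le
        _ ≤ (1 + C₀) ^ R := by rw [mul_one]; exact pow_le_pow_right₀ (by linarith) hr.le
    have h4 : σ ^ l * (1 + ‖T l 0‖ + r * |q|) ≤ B + R * |q| := by
      have h5 : σ ^ l * (r * |q|) ≤ 1 * (R * |q|) := by
        gcongr
        exact pow_le_one₀ hσ0 hσ1.le
      have h6 : σ ^ l * (1 + ‖T l 0‖) ≤ B := hB l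
      linarith
    calc |T l (r + 1) i - (T l r i + q)| ≤ C₀ * α₀ ^ l * (1 + |T l r i|) := hstep l r hr i
      _ ≤ C₀ * α₀ ^ l * ((1 + C₀) ^ R * (1 + ‖T l 0‖ + r * |q|)) := by
        have : (1 + C₀ * α₀ ^ l) ^ r * (1 + ‖T l 0‖ + r * |q|) ≤
            (1 + C₀) ^ R * (1 + ‖T l 0‖ + r * |q|) := by gcongr
        gcongr
        linarith
      _ = C₀ * ((1 + C₀) ^ R * (σ ^ l * (1 + ‖T l 0‖ + r * |q|))) * σ ^ l := by
        rw [hσα]; ring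
      _ ≤ E * σ ^ l := by rw [hE]; gcongr
  have hcum : ∀ l, ∀ r ≤ R, ∀ i, |T l r i - (T l 0 i + r * q)| ≤ r * E * σ ^ l := by
    intro l r hr i
    induction r with
    | zero => simp
    | succ r ih =>
      have ih := ih (by omega)
      have h1 := hinner l r (by omega) i
      have h2 := abs_add_le (T l (r + 1) i - (T l r i + q)) (T l r i - (T l 0 i + r * q))
      rw [show T l (r + 1) i - (T l r i + q) + (T l r i - (T l 0 i + r * q)) =
        T l (r + 1) i - (T l 0 i + ((r + 1 : ℕ) : ℝ) * q) by push_cast; ring] at h2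
      push_cast at h2 ⊢
      linarith
  -- Once the drift `R l q` is removed, the values at `r = 0` follow `M` up to a geometric error.
  obtain ⟨κ, α, C, hα, hα', hC, hlim⟩ := exists_limit_of_perturbed_iteration hM hpos hπ
    (y := fun l => T l 0 - fun _ => R * l * q) (E := R * E) hσ0 hσ1 (fun l => by
      refine (pi_norm_le_iff_of_nonneg (by positivity)).2 fun i => ?_
      have h1 : (T (l + 1) 0 - fun _ => R * ((l + 1 : ℕ) : ℝ) * q) -
          M *ᵥ (T l 0 - fun _ => R * l * q) =
          M *ᵥ (T l R - T l 0 - fun _ => (R * q : ℝ)) := by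
        rw [hzero, mulVec_sub, mulVec_sub, mulVec_sub, mulVec_const hM, mulVec_const hM]
        funext j
        simp only [Pi.sub_apply]
        push_cast
        ring
      rw [h1]
      refine (norm_le_pi_norm (M *ᵥ (T l R - T l 0 - fun _ => (R * q : ℝ))) i).trans
        ((norm_mulVec_le hM _).trans ?_)
      refine (pi_norm_le_iff_of_nonneg (by positivity)).2 fun j => ?_
      have := hcum l R le_rfl j
      rwa [← sub_sub] at this)
  refine ⟨max α σ, C + R * E, lt_max_of_lt_left hα, max_lt hα' hσ1, by positivity,
    fun r => κ + r * q, fun r hr l i => ?_⟩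
  have h1 := hlim l i
  have h2 := hcum l r hr i
  simp only [Pi.sub_apply] at h1
  have h3 : C * α ^ l ≤ C * max α σ ^ l := by
    gcongr
    exact le_max_left _ _
  have h4 : r * E * σ ^ l ≤ R * E * max α σ ^ l := by
    gcongr
    exact le_max_right _ _
  have h5 := abs_add_le (T l r i - (T l 0 i + r * q)) (T l 0 i - R * l * q - κ)
  rw [show T l r i - (T l 0 i + r * q) + (T l 0 i - R * l * q - κ) =
    T l r i - (R * l * q + (κ + r * q)) by ring] at h5
  linarith

end Recursion

/-! ### Positive semidefinite kernels and the operations preserving them -/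

section PSD

variable {V : Type*} [Fintype V]

/-- `K` is a symmetric positive semidefinite kernel on `V`. -/
structure IsPSDKernel (K : V × V → ℝ) : Prop where
  symm (u v : V) : K (v, u) = K (u, v)
  sum_nonneg (x : V → ℝ) : 0 ≤ ∑ u, ∑ v, x u * x v * K (u, v)

namespace IsPSDKernel

variable {K L : V × V → ℝ}

theorem posSemidef (hK : IsPSDKernel K) : (of fun u v => K (u, v)).PosSemidef := by
  refine PosSemidef.of_dotProduct_mulVec_nonneg ?_ fun x => ?_
  · ext u v
    simpa using hK.symm u v
  · refine (hK.sum_nonneg x).trans_eq ?_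
    simp only [dotProduct, mulVec, Pi.star_apply, star_trivial, of_apply, Finset.mul_sum]
    exact Finset.sum_congr rfl fun u _ => Finset.sum_congr rfl fun v _ => by ring

theorem of_posSemidef (hK : (of fun u v => K (u, v)).PosSemidef) : IsPSDKernel K := by
  refine ⟨fun u v => by simpa using congrFun₂ hK.isHermitian u v, fun x => ?_⟩
  refine (hK.dotProduct_mulVec_nonneg x).trans_eq ?_
  simp only [dotProduct, mulVec, Pi.star_apply, star_trivial, of_apply, Finset.mul_sum]
  exact Finset.sum_congr rfl fun u _ => Finset.sum_congr rfl fun v _ => by ring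

theorem mul (hK : IsPSDKernel K) (hL : IsPSDKernel L) : IsPSDKernel (K * L) :=
  of_posSemidef (hK.posSemidef.hadamard hL.posSemidef)

theorem add (hK : IsPSDKernel K) (hL : IsPSDKernel L) : IsPSDKernel (K + L) :=
  ⟨fun u v => by simp [hK.symm u v, hL.symm u v], fun x => by
    simp only [Pi.add_apply, mul_add, Finset.sum_add_distrib]
    exact add_nonneg (hK.sum_nonneg x) (hL.sum_nonneg x)⟩

theorem smul (hK : IsPSDKernel K) {c : ℝ} (hc : 0 ≤ c) : IsPSDKernel (c • K) :=
  ⟨fun u v => by simp [hK.symm u v], fun x => by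
    refine (mul_nonneg hc (hK.sum_nonneg x)).trans_eq ?_
    simp only [Finset.mul_sum, Pi.smul_apply, smul_eq_mul]
    exact Finset.sum_congr rfl fun u _ => Finset.sum_congr rfl fun v _ => by ring⟩

theorem const {c : ℝ} (hc : 0 ≤ c) : IsPSDKernel (fun _ : V × V => c) :=
  ⟨fun _ _ => rfl, fun x => by
    simp only [← Finset.sum_mul, ← Finset.mul_sum]
    exact mul_nonneg (mul_self_nonneg _) hc⟩

theorem gram {E : Type*} [NormedAddCommGroup E] [InnerProductSpace ℝ E] (h : V → E) :
    IsPSDKernel (fun p : V × V => inner ℝ (h p.1) (h p.2)) :=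
  ⟨fun u v => real_inner_comm _ _, fun x => by
    have h1 : (0 : ℝ) ≤ inner ℝ (∑ u, x u • h u) (∑ u, x u • h u) := real_inner_self_nonneg
    refine h1.trans_eq ?_
    rw [sum_inner]
    refine Finset.sum_congr rfl fun u _ => ?_
    rw [inner_sum]
    refine Finset.sum_congr rfl fun v _ => ?_
    rw [real_inner_smul_left, real_inner_smul_right]
    ring⟩

theorem quadratic_nonneg (hK : IsPSDKernel K) (u v : V) (s t : ℝ) :
    0 ≤ K (u, u) * s ^ 2 + 2 * K (u, v) * s * t + K (v, v) * t ^ 2 := by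
  classical
  refine (hK.sum_nonneg (Pi.single u s + Pi.single v t)).trans_eq ?_
  simp only [Pi.add_apply, add_mul, mul_add, Finset.sum_add_distrib, Pi.single_apply, ite_mul,
    zero_mul, mul_ite, mul_zero, Finset.sum_ite_eq', Finset.mem_univ, if_true]
  simp [hK.symm u v]
  ring

theorem diag_nonneg (hK : IsPSDKernel K) (u : V) : 0 ≤ K (u, u) := by
  simpa using hK.quadratic_nonneg u u 1 0

theorem two_mul_le (hK : IsPSDKernel K) (u v : V) : 2 * K (u, v) ≤ K (u, u) + K (v, v) := by
  have := hK.quadratic_nonneg u v 1 (-1)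
  linarith

theorem neg_two_mul_le (hK : IsPSDKernel K) (u v : V) : -2 * K (u, v) ≤ K (u, u) + K (v, v) := by
  have := hK.quadratic_nonneg u v 1 1
  linarith

theorem apply_le (hK : IsPSDKernel K) {B : ℝ} (hB : ∀ u, K (u, u) ≤ B) (p : V × V) : K p ≤ B := by
  have := hK.two_mul_le p.1 p.2
  linarith [hB p.1, hB p.2]

theorem neg_le_apply (hK : IsPSDKernel K) {B : ℝ} (hB : ∀ u, K (u, u) ≤ B) (p : V × V) :
    -B ≤ K p := by
  have := hK.neg_two_mul_le p.1 p.2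
  linarith [hB p.1, hB p.2]

theorem isGaussianPair [DecidableEq V] (hK : IsPSDKernel K) (u v : V) :
    IsGaussianPair (multivariateGaussian 0 (of fun u v => K (u, v))) (fun z => z u) (fun z => z v)
      (K (u, u)) (K (v, v)) (K (u, v)) :=
  isGaussianPair_multivariateGaussian hK.posSemidef u v

theorem gaussianPairing_eq (hK : IsPSDKernel K) (ψ : ℝ → ℝ) (u v : V) :
    gaussianPairing ψ K u v = pairing ψ ψ (K (u, u)) (K (v, v)) (K (u, v)) := by
  rw [gaussianPairing, hK.symm u v, pairing]

/-- The quadratic form is the second moment of `∑ u, x u * g u`. -/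
theorem integral_mul {Ω : Type*} [MeasurableSpace Ω] {μ : Measure Ω} {g : V → Ω → ℝ}
    (hg : ∀ u v, Integrable (fun ω => g u ω * g v ω) μ) :
    IsPSDKernel fun p : V × V => ∫ ω, g p.1 ω * g p.2 ω ∂μ := by
  refine ⟨fun u v => by simp_rw [mul_comm], fun x => ?_⟩
  have h1 : ∑ u, ∑ v, x u * x v * ∫ ω, g u ω * g v ω ∂μ = ∫ ω, (∑ u, x u * g u ω) ^ 2 ∂μ := by
    have h2 : ∀ ω, (∑ u, x u * g u ω) ^ 2 = ∑ u, ∑ v, x u * x v * (g u ω * g v ω) := fun ω => by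
      rw [sq, Finset.sum_mul_sum]
      exact Finset.sum_congr rfl fun u _ => Finset.sum_congr rfl fun v _ => by ring
    simp only [h2]
    rw [integral_finsetSum _ fun u _ => integrable_finsetSum _ fun v _ => (hg u v).const_mul _]
    refine Finset.sum_congr rfl fun u _ => ?_
    rw [integral_finsetSum _ fun v _ => (hg u v).const_mul _]
    exact Finset.sum_congr rfl fun v _ => (integral_const_mul _ _).symm
  rw [h1]
  exact integral_nonneg fun ω => sq_nonneg _

/-- A single Gaussian vector with covariance `K` realizes all the pairs at once, which exhibits a
Gram kernel. The linear growth bound supplies square integrability. -/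
theorem pairing [DecidableEq V] (hK : IsPSDKernel K) {ψ : ℝ → ℝ} (hψ : Measurable ψ)
    (hgrow : ∀ x, |ψ x| ≤ 1 + |x|) :
    IsPSDKernel (fun p : V × V => pairing ψ ψ (K (p.1, p.1)) (K (p.2, p.2)) (K p)) := by
  have hint : ∀ p : V × V, GNTK.pairing ψ ψ (K (p.1, p.1)) (K (p.2, p.2)) (K p) =
      ∫ z, ψ (z p.1) * ψ (z p.2) ∂(multivariateGaussian 0 (of fun u v => K (u, v))) := fun p =>
    ((hK.isGaussianPair p.1 p.2).integral_eq_pairing hψ hψ).symm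
  simp only [hint]
  have hsq : ∀ u, Integrable (fun z : EuclideanSpace ℝ V => ψ (z u) ^ 2)
      (multivariateGaussian 0 (of fun u v => K (u, v))) := fun u => by
    refine (((hK.isGaussianPair u u).integrable_left_sq.const_mul 2).add
      (integrable_const (2 : ℝ))).mono' (Measurable.aestronglyMeasurable (by fun_prop))
      (Filter.Eventually.of_forall fun z => ?_)
    have h1 := hgrow (z u)
    rw [Real.norm_eq_abs, abs_pow]
    simp only [Pi.add_apply]
    rw [← sq_abs (z u)]
    nlinarith [abs_nonneg (ψ (z u)), abs_nonneg (z u), sq_nonneg (1 - |z u|)]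
  refine integral_mul (g := fun u (z : EuclideanSpace ℝ V) => ψ (z u)) fun u v => ?_
  refine ((hsq u).add (hsq v)).mono' (Measurable.aestronglyMeasurable (by fun_prop))
    (Filter.Eventually.of_forall fun z => ?_)
  rw [Real.norm_eq_abs, abs_le]
  simp only [Pi.add_apply]
  constructor <;> nlinarith [sq_nonneg (ψ (z u) - ψ (z v)), sq_nonneg (ψ (z u) + ψ (z v))]

variable [DecidableEq V] {G : SimpleGraph V} [DecidableRel G.Adj]

/-- On matrices aggregation is `K ↦ P K Pᵀ` with `P` the averaging matrix. -/
theorem aggregation (hK : IsPSDKernel K) : IsPSDKernel (aggregation G *ᵥ K) := by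
  refine of_posSemidef ?_
  have h := hK.posSemidef.mul_mul_conjTranspose_same (averagingMatrix G)
  convert h using 1
  ext u v
  simp only [of_apply, mulVec, dotProduct, aggregation_apply, mul_apply, conjTranspose_apply,
    star_trivial, Finset.sum_mul]
  rw [Fintype.sum_prod_type, Finset.sum_comm]
  exact Finset.sum_congr rfl fun i _ => Finset.sum_congr rfl fun j _ => by ring

theorem residualAggregation {δ : ℝ} (hδ0 : 0 ≤ δ) (hδ1 : δ ≤ 1) (hK : IsPSDKernel K) :
    IsPSDKernel (residualAggregation G δ *ᵥ K) := by
  rw [residualAggregation_mulVec]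
  exact (hK.aggregation.smul (by linarith)).add (hK.smul hδ0)

end IsPSDKernel

end PSD

/-! ### Unfolding the recursions; semidefiniteness of the Gaussian process kernel -/

section GPK

variable {V : Type*} [Fintype V] (A : Matrix (V × V) (V × V) ℝ) (φ : ℝ → ℝ) (σw σb : ℝ) (R : ℕ)
  {d : ℕ} (h : V → EuclideanSpace ℝ (Fin d))

theorem gpk_zero_zero : gpk A φ σw σb R h 0 0 = fun p => inner ℝ (h p.1) (h p.2) := by
  rw [gpk]

theorem gpk_succ_zero (l : ℕ) : gpk A φ σw σb R h (l + 1) 0 = A *ᵥ gpk A φ σw σb R h l R := by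
  rw [gpk]

theorem gpk_succ (l r : ℕ) : gpk A φ σw σb R h l (r + 1) = fun p =>
    σw ^ 2 * gaussianPairing φ (gpk A φ σw σb R h l r) p.1 p.2 + σb ^ 2 := by
  rw [gpk]

theorem gntk_succ_zero (l : ℕ) : gntk A φ σw σb R h (l + 1) 0 = A *ᵥ gntk A φ σw σb R h l R := by
  rw [gntk]

theorem gntk_succ (l r : ℕ) : gntk A φ σw σb R h l (r + 1) = fun p =>
    gntk A φ σw σb R h l r p * gpkDeriv A φ σw σb R h l r p + gpk A φ σw σb R h l (r + 1) p := by
  rw [gntk]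

variable [DecidableEq V] {G : SimpleGraph V} [DecidableRel G.Adj] {δ : ℝ}

theorem isPSDKernel_gpk (hδ0 : 0 ≤ δ) (hδ1 : δ ≤ 1) {φ : ℝ → ℝ} (hφ : Measurable φ)
    (hgrow : ∀ x, |φ x| ≤ 1 + |x|) (l r : ℕ) :
    IsPSDKernel (gpk (residualAggregation G δ) φ σw σb R h l r) := by
  have hstep : ∀ l r, IsPSDKernel (gpk (residualAggregation G δ) φ σw σb R h l r) →
      IsPSDKernel (gpk (residualAggregation G δ) φ σw σb R h l (r + 1)) := by
    intro l r hK
    rw [gpk_succ]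
    simp only [hK.gaussianPairing_eq]
    exact ((hK.pairing hφ hgrow).smul (sq_nonneg σw)).add (.const (sq_nonneg σb))
  have hzero : ∀ l, IsPSDKernel (gpk (residualAggregation G δ) φ σw σb R h l 0) → ∀ r,
      IsPSDKernel (gpk (residualAggregation G δ) φ σw σb R h l r) := by
    intro l hl r
    induction r with
    | zero => exact hl
    | succ r ih => exact hstep l r ih
  refine hzero l ?_ r
  induction l with
  | zero =>
    rw [gpk_zero_zero]
    exact .gram h
  | succ l ih =>
    rw [gpk_succ_zero]
    exact (hzero l ih R).residualAggregation hδ0 hδ1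

end GPK

/-! ### From convergence of `Σ` and `Σ̇` to asymptotics of `Θ` -/

section Convergence

variable {V : Type*} [Fintype V] [DecidableEq V] [Nonempty V] {A : Matrix (V × V) (V × V) ℝ}
  {φ : ℝ → ℝ} {σw σb : ℝ} {R d : ℕ} {h : V → EuclideanSpace ℝ (Fin d)}

/-- Exponential convergence of the Gaussian process kernel to a constant and of the derivative kernel
to `1` gives the asymptotics of the neural tangent kernel. -/
theorem exists_gntk_asymptotics (hA : A ∈ rowStochastic ℝ (V × V))
    (hpos : ∃ k > 0, ∀ i j, 0 < (A ^ k) i j) {π : V × V → ℝ} (hπ : IsStationaryDistribution A π)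
    {q C₀ α₀ : ℝ} (hC₀ : 0 ≤ C₀) (hα0 : 0 ≤ α₀) (hα1 : α₀ < 1)
    (hgpk : ∀ l, ∀ r < R, ∀ p, |gpk A φ σw σb R h l (r + 1) p - q| ≤ C₀ * α₀ ^ l)
    (hderiv : ∀ l, ∀ r < R, ∀ p, |gpkDeriv A φ σw σb R h l r p - 1| ≤ C₀ * α₀ ^ l) :
    ∃ α C : ℝ, 0 < α ∧ α < 1 ∧ 0 < C ∧
      ∃ v : V × V → ℝ, ∀ r ≤ R, ∃ v' : V × V → ℝ, ∀ (l : ℕ) (u u' : V),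
        |gntk A φ σw σb R h l r (u, u') - π ⬝ᵥ (((R : ℝ) * (l : ℝ)) • v + v')| ≤ C * α ^ l := by
  obtain ⟨α, C, hα, hα', hC, κ, hκ⟩ := exists_affine_asymptotics hA hpos hπ
    (T := gntk A φ σw σb R h) (R := R) (q := q) hC₀ hα0 hα1 (gntk_succ_zero A φ σw σb R h)
    (fun l r hr p => by
      rw [gntk_succ]
      have h1 := hgpk l r hr p
      have h2 := hderiv l r hr p
      have h3 := abs_add_le (gntk A φ σw σb R h l r p * (gpkDeriv A φ σw σb R h l r p - 1))
        (gpk A φ σw σb R h l (r + 1) p - q)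
      rw [abs_mul] at h3
      have h4 := mul_le_mul_of_nonneg_left h2 (abs_nonneg (gntk A φ σw σb R h l r p))
      rw [show gntk A φ σw σb R h l r p * gpkDeriv A φ σw σb R h l r p +
        gpk A φ σw σb R h l (r + 1) p - (gntk A φ σw σb R h l r p + q) =
        gntk A φ σw σb R h l r p * (gpkDeriv A φ σw σb R h l r p - 1) +
        (gpk A φ σw σb R h l (r + 1) p - q) by ring]
      linarith)
  -- Constant vectors suffice because `π` has total mass `1`.
  refine ⟨α, C, hα, hα', hC, fun _ => q, fun r hr => ⟨fun _ => κ r, fun l u u' => ?_⟩⟩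
  rw [dotProduct_add, dotProduct_smul, hπ.dotProduct_const, hπ.dotProduct_const, smul_eq_mul]
  exact hκ r hr l (u, u')

/-- The term `B / β ^ L` pays for the indices below `L`. -/
theorem exists_bound_of_eventual_bound {x : ℕ → ℝ} {B C β : ℝ} {L : ℕ} (hβ0 : 0 < β)
    (hβ1 : β ≤ 1) (hB : ∀ l, x l ≤ B) (hB0 : 0 ≤ B) (hC : 0 ≤ C)
    (hx : ∀ l ≥ L, x l ≤ C * β ^ l) (l : ℕ) : x l ≤ (C + B / β ^ L) * β ^ l := by
  rw [add_mul]
  rcases lt_or_ge l L with hl | hl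
  · have h1 : B ≤ B / β ^ L * β ^ l := by
      rw [div_mul_eq_mul_div, le_div_iff₀ (by positivity)]
      exact mul_le_mul_of_nonneg_left (pow_le_pow_of_le_one hβ0.le hβ1 hl.le) hB0
    have h2 : 0 ≤ C * β ^ l := by positivity
    linarith [hB l]
  · have h2 : 0 ≤ B / β ^ L * β ^ l := by positivity
    linarith [hx l hl]

end Convergence

/-! ### Elementary facts on the standard Gaussian -/

section Pairing

theorem isGaussianPair_eval {a b c : ℝ}
    (h : ∀ s t : ℝ, 0 ≤ a * s ^ 2 + 2 * c * s * t + b * t ^ 2) :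
    IsGaussianPair (multivariateGaussian 0 !![a, c; c, b])
      (fun z : EuclideanSpace ℝ (Fin 2) => z 0) (fun z => z 1) a b c := by
  simpa using isGaussianPair_multivariateGaussian (posSemidef_two_by_two h) 0 1

theorem gaussianReal_map_neg_eq : (gaussianReal 0 1).map (fun x => -x) = gaussianReal 0 1 := by
  rw [gaussianReal_map_neg]
  simp

theorem integral_comp_neg_gaussianReal (f : ℝ → ℝ) :
    ∫ x, f (-x) ∂(gaussianReal 0 1) = ∫ x, f x ∂(gaussianReal 0 1) := by
  conv_rhs => rw [← gaussianReal_map_neg_eq]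
  exact ((MeasurableEquiv.neg ℝ).measurableEmbedding.integral_map f).symm

/-- The standard Gaussian density is at most `1`. -/
theorem integral_indicator_Ioc_gaussianReal_le {s : ℝ} (hs : 0 ≤ s) :
    ∫ x, (Set.Ioc 0 s).indicator 1 x ∂(gaussianReal 0 1) ≤ s := by
  rw [integral_gaussianReal_eq_integral_smul one_ne_zero]
  have h1 : ∀ x, gaussianPDFReal 0 1 x ≤ 1 := fun x => by
    rw [gaussianPDFReal]
    have h2 : (1 : ℝ) ≤ √(2 * Real.pi * (1 : NNReal)) := by
      rw [Real.one_le_sqrt]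
      have := Real.pi_gt_three
      push_cast
      linarith
    have h3 : Real.exp (-(x - 0) ^ 2 / (2 * (1 : NNReal))) ≤ 1 := by
      rw [Real.exp_le_one_iff]
      push_cast
      nlinarith [sq_nonneg (x - 0)]
    exact mul_le_one₀ (inv_le_one_of_one_le₀ h2) (Real.exp_pos _).le h3
  have h4 : ∫ x, (Set.Ioc 0 s).indicator (1 : ℝ → ℝ) x = s := by
    rw [integral_indicator measurableSet_Ioc]
    simp [hs]
  conv_rhs => rw [← h4]
  refine integral_mono_of_nonneg (Filter.Eventually.of_forall fun x => ?_)
    ((integrable_indicator_iff measurableSet_Ioc).2 (integrableOn_const (by simp)))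
    (Filter.Eventually.of_forall fun x => ?_)
  · exact mul_nonneg (gaussianPDFReal_nonneg 0 1 x) (Set.indicator_nonneg (fun _ _ => zero_le_one) x)
  · simp only [smul_eq_mul]
    exact mul_le_of_le_one_left (Set.indicator_nonneg (fun _ _ => zero_le_one) x) (h1 x)

end Pairing

/-! ### Gaussian expectations of ReLU and its derivative -/

section ReLU

theorem measurable_relu : Measurable relu := by
  unfold relu
  fun_prop

theorem relu_nonneg (x : ℝ) : 0 ≤ relu x := le_max_left _ _

theorem abs_relu_le (x : ℝ) : |relu x| ≤ |x| := by
  rw [abs_of_nonneg (relu_nonneg x), relu]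
  exact max_le (abs_nonneg x) (le_abs_self x)

theorem relu_sq_add_relu_neg_sq (x : ℝ) : relu x ^ 2 + relu (-x) ^ 2 = x ^ 2 := by
  rcases le_total 0 x with hx | hx
  · rw [relu, relu, max_eq_right hx, max_eq_left (by linarith)]
    ring
  · rw [relu, relu, max_eq_left hx, max_eq_right (by linarith)]
    ring

/-- For equal signs both sides agree; for opposite signs the left side is nonpositive and the right
side vanishes. -/
theorem mul_le_relu_mul_relu (x y : ℝ) : x * y ≤ relu x * relu y + relu (-x) * relu (-y) := by
  unfold relu
  rcases le_total 0 x with hx | hx <;> rcases le_total 0 y with hy | hy <;>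
    simp [hx, hy] <;> nlinarith

theorem deriv_relu : deriv relu = (Set.Ioi 0).indicator 1 := by
  funext x
  rcases lt_trichotomy x 0 with hx | rfl | hx
  · rw [Set.indicator_of_notMem (by simpa using hx.le)]
    have h : relu =ᶠ[nhds x] fun _ => 0 := by
      filter_upwards [gt_mem_nhds hx] with y hy
      exact max_eq_left hy.le
    rw [h.deriv_eq, deriv_const]
  · rw [Set.indicator_of_notMem (by simp)]
    -- At the kink `deriv` takes its default value `0`, in agreement with the indicator of the open
    -- half-line.
    refine deriv_zero_of_not_differentiableAt fun hd => ?_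
    have h1 : HasDerivWithinAt relu (deriv relu 0) (Set.Iic 0) 0 := hd.hasDerivAt.hasDerivWithinAt
    have h2 : HasDerivWithinAt relu (deriv relu 0) (Set.Ici 0) 0 := hd.hasDerivAt.hasDerivWithinAt
    have h3 : HasDerivWithinAt relu 0 (Set.Iic 0) 0 :=
      (hasDerivWithinAt_const 0 _ (0 : ℝ)).congr (fun y hy => max_eq_left hy) (by simp [relu])
    have h4 : HasDerivWithinAt relu 1 (Set.Ici 0) 0 :=
      (hasDerivWithinAt_id 0 _).congr (fun y hy => max_eq_right hy) (by simp [relu])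
    have h5 := (uniqueDiffWithinAt_Iic (0 : ℝ)).eq_deriv _ h1 h3
    have h6 := (uniqueDiffWithinAt_Ici (0 : ℝ)).eq_deriv _ h2 h4
    linarith
  · rw [Set.indicator_of_mem (by simpa using hx)]
    have h : relu =ᶠ[nhds x] id := by
      filter_upwards [lt_mem_nhds hx] with y hy
      exact max_eq_right hy.le
    rw [h.deriv_eq, deriv_id]
    rfl

theorem measurable_deriv_relu : Measurable (deriv relu) := measurable_deriv relu

theorem deriv_relu_nonneg (x : ℝ) : 0 ≤ deriv relu x := by
  rw [deriv_relu]
  exact Set.indicator_nonneg (fun _ _ => zero_le_one) x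

theorem deriv_relu_le_one (x : ℝ) : deriv relu x ≤ 1 := by
  rw [deriv_relu]
  exact Set.indicator_le_self' (f := 1) (fun _ _ => zero_le_one) x

theorem integrable_of_bounded {Ω : Type*} [MeasurableSpace Ω] {μ : Measure Ω}
    [IsFiniteMeasure μ] {f : Ω → ℝ} (hf : Measurable f) {B : ℝ} (hB : ∀ ω, |f ω| ≤ B) :
    Integrable f μ :=
  (integrable_const B).mono' hf.aestronglyMeasurable (Filter.Eventually.of_forall hB)

theorem integral_deriv_relu_gaussianReal {σ : ℝ} (hσ : 0 < σ) :
    ∫ x, deriv relu (σ * x) ∂(gaussianReal 0 1) = 1 / 2 := by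
  have hint : Integrable (fun x => deriv relu (σ * x)) (gaussianReal 0 1) :=
    integrable_of_bounded (measurable_deriv_relu.comp (measurable_const_mul σ)) (B := 1) fun x =>
      abs_le.2 ⟨by linarith [deriv_relu_nonneg (σ * x)], deriv_relu_le_one _⟩
  have hint' : Integrable (fun x => deriv relu (σ * -x)) (gaussianReal 0 1) :=
    integrable_of_bounded (measurable_deriv_relu.comp (by fun_prop)) (B := 1) fun x =>
      abs_le.2 ⟨by linarith [deriv_relu_nonneg (σ * -x)], deriv_relu_le_one _⟩
  have h1 := integral_comp_neg_gaussianReal fun x => deriv relu (σ * x)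
  have h2 : ∫ x, deriv relu (σ * x) + deriv relu (σ * -x) ∂(gaussianReal 0 1) = 1 := by
    have h3 : (fun x => deriv relu (σ * x) + deriv relu (σ * -x)) =ᵐ[gaussianReal 0 1]
        fun _ => 1 := by
      have : NullSingletonClass (gaussianReal 0 1) := nullSingletonClass_gaussianReal one_ne_zero
      filter_upwards [ae_iff.2 (show gaussianReal 0 1 {x | ¬ x ≠ 0} = 0 by simp)] with x hx
      rw [deriv_relu]
      rcases lt_or_gt_of_ne hx with hx | hx
      · rw [Set.indicator_of_notMem (by simp; nlinarith), Set.indicator_of_mem (by simp; nlinarith)]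
        simp
      · rw [Set.indicator_of_mem (by simp; nlinarith), Set.indicator_of_notMem (by simp; nlinarith)]
        simp
    rw [integral_congr_ae h3]
    simp
  rw [integral_add hint hint', h1] at h2
  linarith

theorem integrable_relu_sq (σ : ℝ) : Integrable (fun x => relu (σ * x) ^ 2) (gaussianReal 0 1) :=
  (integrable_sq_gaussianReal σ).mono'
    ((measurable_relu.comp (measurable_const_mul σ)).pow_const 2).aestronglyMeasurable
    (Filter.Eventually.of_forall fun x => by
      rw [Real.norm_eq_abs, abs_pow, ← sq_abs (σ * x)]
      exact pow_le_pow_left₀ (abs_nonneg _) (abs_relu_le _) 2)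

theorem integral_relu_sq_gaussianReal (σ : ℝ) :
    ∫ x, relu (σ * x) ^ 2 ∂(gaussianReal 0 1) = σ ^ 2 / 2 := by
  have h1 := integral_comp_neg_gaussianReal fun x => relu (σ * x) ^ 2
  have h2 := integral_sq_gaussianReal σ
  rw [integral_congr_ae (Filter.Eventually.of_forall fun x =>
    (relu_sq_add_relu_neg_sq (σ * x)).symm)] at h2
  have h3 : Integrable (fun x => relu (-(σ * x)) ^ 2) (gaussianReal 0 1) := by
    simpa using integrable_relu_sq (-σ)
  rw [integral_add (integrable_relu_sq σ) h3] at h2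
  simp only [mul_neg] at h1
  linarith

/-- Homogeneity makes the two expectations `q / 2` and `1 / 2`. The parameters are thus fixed by the
conditions, whereas `q` is not. -/
theorem IsEdgeOfChaos.relu_eq {σw σb : ℝ} (h : IsEdgeOfChaos relu σw σb) :
    σw ^ 2 = 2 ∧ σb ^ 2 = 0 := by
  obtain ⟨q, hq, h1, h2⟩ := h
  have h3 : ∀ x, deriv relu x ^ 2 = deriv relu x := fun x => by
    rw [deriv_relu]
    by_cases hx : x ∈ Set.Ioi (0 : ℝ) <;> simp [hx]
  simp only [h3] at h2
  rw [integral_deriv_relu_gaussianReal (Real.sqrt_pos.2 hq)] at h2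
  have h4 : σw ^ 2 = 2 := by linarith
  rw [integral_relu_sq_gaussianReal, Real.sq_sqrt hq.le, h4] at h1
  exact ⟨h4, by linarith⟩

variable {Ω : Type*} [MeasurableSpace Ω] {μ : Measure Ω} {X Y : Ω → ℝ} {a b c : ℝ}

namespace IsGaussianPair

theorem neg (h : IsGaussianPair μ X Y a b c) :
    IsGaussianPair μ (fun ω => -X ω) (fun ω => -Y ω) a b c := by
  simpa using h.linear (-1) 0 0 (-1)

variable [IsProbabilityMeasure μ]

theorem integrable_relu_left_sq (h : IsGaussianPair μ X Y a b c) :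
    Integrable (fun ω => relu (X ω) ^ 2) μ :=
  integrable_comp_of_map_eq h.measurable_left h.map_left (f := fun x => relu x ^ 2)
    (measurable_relu.pow_const 2) (integrable_relu_sq _)

theorem integral_relu_left_sq (h : IsGaussianPair μ X Y a b c) :
    ∫ ω, relu (X ω) ^ 2 ∂μ = a / 2 := by
  rw [integral_comp_of_map_eq h.measurable_left h.map_left (f := fun x => relu x ^ 2)
    (measurable_relu.pow_const 2), integral_relu_sq_gaussianReal,
    Real.sq_sqrt (by simpa using h.quadratic_nonneg 1 0)]

theorem integrable_relu_mul (h : IsGaussianPair μ X Y a b c) :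
    Integrable (fun ω => relu (X ω) * relu (Y ω)) μ := by
  refine (h.integrable_relu_left_sq.add h.symm.integrable_relu_left_sq).mono'
    ((measurable_relu.comp h.measurable_left).mul
      (measurable_relu.comp h.measurable_right)).aestronglyMeasurable
    (Filter.Eventually.of_forall fun ω => ?_)
  rw [Real.norm_eq_abs, abs_of_nonneg (mul_nonneg (relu_nonneg _) (relu_nonneg _))]
  simp only [Pi.add_apply]
  nlinarith [sq_nonneg (relu (X ω) - relu (Y ω)), sq_nonneg (relu (X ω)), sq_nonneg (relu (Y ω))]

/-- `(-X, -Y)` has the law of `(X, Y)`, so `mul_le_relu_mul_relu` integrates to this. At `σ_w² = 2`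
a layer therefore never lowers an entry. -/
theorem le_two_mul_pairing_relu (h : IsGaussianPair μ X Y a b c) :
    c ≤ 2 * pairing relu relu a b c := by
  have h1 := h.neg.integral_eq_pairing measurable_relu measurable_relu
  have h2 := h.integral_eq_pairing measurable_relu measurable_relu
  have h3 := integral_mono h.integrable_mul (h.integrable_relu_mul.add h.neg.integrable_relu_mul)
    fun ω => mul_le_relu_mul_relu (X ω) (Y ω)
  rw [h.integral_mul, integral_add' h.integrable_relu_mul h.neg.integrable_relu_mul, h1, h2] at h3
  linarith

/-- From `2 x y ≤ x² + y²` and `𝔼[relu(X)²] = a / 2`. A layer therefore never raises the maximum of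
the kernel. -/
theorem two_mul_pairing_relu_le (h : IsGaussianPair μ X Y a b c) :
    2 * pairing relu relu a b c ≤ (a + b) / 2 := by
  have h2 := h.integral_eq_pairing measurable_relu measurable_relu
  have h3 := integral_mono (h.integrable_relu_mul.const_mul 2)
    (h.integrable_relu_left_sq.add h.symm.integrable_relu_left_sq)
    fun ω => by
      simp only [Pi.add_apply]
      nlinarith [sq_nonneg (relu (X ω) - relu (Y ω))]
  rw [integral_const_mul, integral_add' h.integrable_relu_left_sq h.symm.integrable_relu_left_sq,
    h2, h.integral_relu_left_sq, h.symm.integral_relu_left_sq] at h3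
  linarith

theorem pairing_relu_nonneg (h : IsGaussianPair μ X Y a b c) : 0 ≤ pairing relu relu a b c := by
  rw [← h.integral_eq_pairing measurable_relu measurable_relu]
  exact integral_nonneg fun ω => mul_nonneg (relu_nonneg _) (relu_nonneg _)

theorem pairing_deriv_relu_mem_Icc (h : IsGaussianPair μ X Y a b c) :
    0 ≤ pairing (deriv relu) (deriv relu) a b c ∧
      pairing (deriv relu) (deriv relu) a b c ≤ 1 := by
  rw [← h.integral_eq_pairing measurable_deriv_relu measurable_deriv_relu]
  have h1 : ∀ ω, 0 ≤ deriv relu (X ω) * deriv relu (Y ω) := fun ω =>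
    mul_nonneg (deriv_relu_nonneg _) (deriv_relu_nonneg _)
  have h2 : ∀ ω, deriv relu (X ω) * deriv relu (Y ω) ≤ 1 := fun ω =>
    mul_le_one₀ (deriv_relu_le_one _) (deriv_relu_nonneg _) (deriv_relu_le_one _)
  refine ⟨integral_nonneg h1, ?_⟩
  have h3 := integral_mono_of_nonneg (μ := μ) (Filter.Eventually.of_forall h1)
    (integrable_const (1 : ℝ)) (Filter.Eventually.of_forall h2)
  simpa using h3

/-- If the two coordinates of a Gaussian pair are close, they have the same sign with high
probability. -/
theorem abs_two_mul_pairing_deriv_relu_sub_one_le (h : IsGaussianPair μ X Y a b c) (ha : 0 < a)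
    {t : ℝ} (ht : 0 < t) : |2 * pairing (deriv relu) (deriv relu) a b c - 1| ≤
      2 * (t / √a + (a + b - 2 * c) / t ^ 2) := by
  have hX := h.measurable_left
  have hY := h.measurable_right
  have hsa : 0 < √a := Real.sqrt_pos.2 ha
  have hmX := measurable_deriv_relu.comp hX
  have hmY := measurable_deriv_relu.comp hY
  have hint1 : Integrable (fun ω => deriv relu (X ω)) μ :=
    integrable_of_bounded hmX (B := 1) fun ω =>
      abs_le.2 ⟨by linarith [deriv_relu_nonneg (X ω)], deriv_relu_le_one _⟩
  have hint2 : Integrable (fun ω => deriv relu (X ω) * deriv relu (Y ω)) μ :=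
    integrable_of_bounded (hmX.mul hmY) (B := 1) fun ω => by
      have h1 := mul_nonneg (deriv_relu_nonneg (X ω)) (deriv_relu_nonneg (Y ω))
      exact abs_le.2 ⟨by linarith,
        mul_le_one₀ (deriv_relu_le_one _) (deriv_relu_nonneg _) (deriv_relu_le_one _)⟩
  have hmi : Measurable ((Set.Ioc 0 t).indicator (1 : ℝ → ℝ)) :=
    measurable_one.indicator measurableSet_Ioc
  have hint3 : Integrable (fun ω => (Set.Ioc 0 t).indicator (1 : ℝ → ℝ) (X ω)) μ :=
    integrable_of_bounded (hmi.comp hX) (B := 1) fun ω => by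
      rw [abs_of_nonneg (Set.indicator_nonneg (f := 1) (fun _ _ => zero_le_one) _)]
      exact Set.indicator_le_self' (f := 1) (fun _ _ => zero_le_one) _
  have hhalf : ∫ ω, deriv relu (X ω) ∂μ = 1 / 2 := by
    rw [integral_comp_of_map_eq hX h.map_left measurable_deriv_relu,
      integral_deriv_relu_gaussianReal hsa]
  have hsmall : ∫ ω, (Set.Ioc 0 t).indicator (1 : ℝ → ℝ) (X ω) ∂μ ≤ t / √a := by
    rw [integral_comp_of_map_eq hX h.map_left hmi]
    refine le_of_eq_of_le ?_ (integral_indicator_Ioc_gaussianReal_le (s := t / √a) (by positivity))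
    congr 1
    funext x
    have h1 : √a * x ∈ Set.Ioc 0 t ↔ x ∈ Set.Ioc 0 (t / √a) := by
      rw [Set.mem_Ioc, Set.mem_Ioc, le_div_iff₀ hsa, mul_pos_iff_of_pos_left hsa, mul_comm x]
    by_cases hx : x ∈ Set.Ioc 0 (t / √a)
    · rw [Set.indicator_of_mem hx, Set.indicator_of_mem (h1.2 hx)]
      rfl
    · rw [Set.indicator_of_notMem hx, Set.indicator_of_notMem (fun h2 => hx (h1.1 h2))]
  -- If `X > 0 ≥ Y`, then either `X ≤ t` or `X - Y > t`; the latter is paid for as in Chebyshev's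
  -- inequality.
  have hpt : ∀ ω, deriv relu (X ω) - deriv relu (X ω) * deriv relu (Y ω) ≤
      (Set.Ioc 0 t).indicator (1 : ℝ → ℝ) (X ω) + (X ω - Y ω) ^ 2 / t ^ 2 := by
    intro ω
    have h0 : 0 ≤ (Set.Ioc 0 t).indicator (1 : ℝ → ℝ) (X ω) :=
      Set.indicator_nonneg (fun _ _ => zero_le_one) _
    have h0' : 0 ≤ (X ω - Y ω) ^ 2 / t ^ 2 := by positivity
    rw [deriv_relu]
    by_cases hx : 0 < X ω
    · by_cases hy : 0 < Y ω
      · simp only [Set.indicator_of_mem (show X ω ∈ Set.Ioi 0 from hx),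
          Set.indicator_of_mem (show Y ω ∈ Set.Ioi 0 from hy), Pi.one_apply]
        linarith
      · simp only [Set.indicator_of_mem (show X ω ∈ Set.Ioi 0 from hx),
          Set.indicator_of_notMem (show Y ω ∉ Set.Ioi 0 from hy), Pi.one_apply]
        by_cases hxt : X ω ≤ t
        · rw [Set.indicator_of_mem (show X ω ∈ Set.Ioc 0 t from ⟨hx, hxt⟩), Pi.one_apply]
          linarith
        · have : 1 ≤ (X ω - Y ω) ^ 2 / t ^ 2 := by
            rw [le_div_iff₀ (by positivity), one_mul]
            exact pow_le_pow_left₀ ht.le (by linarith) 2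
          linarith
    · simp only [Set.indicator_of_notMem (show X ω ∉ Set.Ioi 0 from hx)]
      linarith
  have hmain := integral_mono (hint1.sub hint2) (hint3.add (h.integrable_sub_sq.div_const (t ^ 2)))
    hpt
  have hnn : 0 ≤ ∫ ω, deriv relu (X ω) - deriv relu (X ω) * deriv relu (Y ω) ∂μ :=
    integral_nonneg fun ω => by
      have := mul_le_of_le_one_right (deriv_relu_nonneg (X ω)) (deriv_relu_le_one (Y ω))
      simpa using this
  rw [integral_sub' hint1 hint2, integral_add' hint3 (h.integrable_sub_sq.div_const (t ^ 2)),
    integral_div, h.integral_sub_sq, hhalf,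
    h.integral_eq_pairing measurable_deriv_relu measurable_deriv_relu] at hmain
  rw [integral_sub hint1 hint2, hhalf,
    h.integral_eq_pairing measurable_deriv_relu measurable_deriv_relu] at hnn
  rw [abs_le]
  constructor <;> linarith

end IsGaussianPair

end ReLU

/-! ### Super-iterates with non-increasing maximum -/

section MonotoneIteration

variable {ι : Type*} [Fintype ι] [DecidableEq ι] [Nonempty ι]

/-- Super-iterates of an ergodic stochastic matrix with non-increasing upper bounds converge
exponentially fast to a constant vector. -/
theorem exists_limit_of_monotone_iteration {M : Matrix ι ι ℝ} (hM : M ∈ rowStochastic ℝ ι)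
    (hpos : ∃ k > 0, ∀ i j, 0 < (M ^ k) i j) {x : ℕ → ι → ℝ}
    (hlow : ∀ l, M *ᵥ x l ≤ x (l + 1))
    (hup : ∀ l b, (∀ i, x l i ≤ b) → ∀ i, x (l + 1) i ≤ b) :
    ∃ q α C : ℝ, 0 < α ∧ α < 1 ∧ 0 < C ∧
      (∀ l m, (∀ i, m ≤ x l i) → m ≤ q) ∧
      ∀ l, ∃ lo hi, (∀ i, lo ≤ x l i) ∧ (∀ i, x l i ≤ hi) ∧ lo ≤ q ∧ q ≤ hi ∧
        hi - lo ≤ C * α ^ l := by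
  obtain ⟨k, hk, c, hc0, hc⟩ := exists_pow_lower_bound hpos
  have hMn : ∀ l, M ^ l ∈ rowStochastic ℝ ι := fun l => pow_mem hM l
  have hpow : ∀ n l, M ^ n *ᵥ x l ≤ x (l + n) := by
    intro n l
    induction n with
    | zero => simp
    | succ n ih =>
      rw [pow_mulVec_succ]
      exact (mulVec_mono (fun _ _ => nonneg_of_mem_rowStochastic hM) ih).trans (hlow (l + n))
  have hmax : ∀ l, ∃ i, ∀ j, x l j ≤ x l i := fun l => by
    obtain ⟨i, -, hi⟩ := Finset.exists_max_image Finset.univ (x l) Finset.univ_nonempty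
    exact ⟨i, fun j => hi j (Finset.mem_univ j)⟩
  have hmin : ∀ l, ∃ i, ∀ j, x l i ≤ x l j := fun l => by
    obtain ⟨i, -, hi⟩ := Finset.exists_min_image Finset.univ (x l) Finset.univ_nonempty
    exact ⟨i, fun j => hi j (Finset.mem_univ j)⟩
  choose imax himax using hmax
  choose imin himin using hmin
  set hi : ℕ → ℝ := fun l => x l (imax l) with hhi
  set lo : ℕ → ℝ := fun l => x l (imin l) with hlo
  have hhi_anti : Antitone hi := antitone_nat_of_succ_le fun l => hup l _ (himax l) _
  have hlo_mono : Monotone lo := monotone_nat_of_le_succ fun l =>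
    (const_le_mulVec hM (himin l) _).trans (hlow l (imin (l + 1)))
  have hle : ∀ l m, lo l ≤ hi m := fun l m => by
    rcases le_total l m with h | h
    · exact (hlo_mono h).trans (himin m _)
    · exact (himin l _).trans (hhi_anti h)
  have hc1 : c ≤ 1 := (hc (imax 0) (imax 0)).trans (le_one_of_mem_rowStochastic (hMn k))
  have hcontr : ∀ l, hi (l + k) - lo (l + k) ≤ (1 - c) * (hi l - lo l) + 0 * 0 ^ l := by
    intro l
    -- Every row of `M ^ k` gives weight at least `c` to the maximizer of `x l`, which lifts the
    -- minimum by this amount.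
    have h1 : lo l + c * (hi l - lo l) ≤ lo (l + k) := by
      refine le_trans ?_ (hpow k l (imin (l + k)))
      set i := imin (l + k)
      have h2 : (M ^ k *ᵥ x l) i = lo l + ∑ j, (M ^ k) i j * (x l j - lo l) := by
        simp only [mulVec, dotProduct, mul_sub, Finset.sum_sub_distrib, ← Finset.sum_mul,
          sum_row_of_mem_rowStochastic (hMn k) i]
        ring
      rw [h2]
      have h3 := Finset.single_le_sum (f := fun j => (M ^ k) i j * (x l j - lo l))
        (fun j _ => mul_nonneg (nonneg_of_mem_rowStochastic (hMn k)) (sub_nonneg.2 (himin l j)))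
        (Finset.mem_univ (imax l))
      have h4 : c * (hi l - lo l) ≤ (M ^ k) i (imax l) * (x l (imax l) - lo l) :=
        mul_le_mul_of_nonneg_right (hc _ _) (sub_nonneg.2 (hle l l))
      linarith
    have h5 := hhi_anti (Nat.le_add_right l k)
    linarith
  obtain ⟨α, C, hα, hα', hC, hb⟩ := exists_geometric_bound_of_window_contraction
    (f := fun l => hi l - lo l) hk (by linarith) (by linarith) le_rfl le_rfl one_pos hcontr
  have hbdd : BddAbove (Set.range lo) := ⟨hi 0, by rintro _ ⟨l, rfl⟩; exact hle l 0⟩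
  refine ⟨⨆ l, lo l, α, C, hα, hα', hC, fun l m hm => (hm (imin l)).trans (le_ciSup hbdd l),
    fun l => ⟨lo l, hi l, himin l, himax l, le_ciSup hbdd l, ciSup_le fun m => hle m l, hb l⟩⟩

end MonotoneIteration

/-! ### Kernels of the ReLU network -/

section ReLUKernel

variable {V : Type*} [Fintype V] [DecidableEq V] {G : SimpleGraph V} [DecidableRel G.Adj] {δ : ℝ}
  {σw σb : ℝ} {R d : ℕ} {h : V → EuclideanSpace ℝ (Fin d)}

theorem isPSDKernel_gpk_relu (hδ0 : 0 < δ) (hδ1 : δ < 1) (l r : ℕ) :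
    IsPSDKernel (gpk (residualAggregation G δ) relu σw σb R h l r) :=
  isPSDKernel_gpk σw σb R h hδ0.le hδ1.le measurable_relu
    (fun x => (abs_relu_le x).trans (by linarith)) l r

variable (hw : σw ^ 2 = 2) (hb : σb ^ 2 = 0) (hδ0 : 0 < δ) (hδ1 : δ < 1)
include hw hb hδ0 hδ1

theorem gpk_relu_succ (l r : ℕ) (u v : V) :
    gpk (residualAggregation G δ) relu σw σb R h l (r + 1) (u, v) =
      2 * pairing relu relu (gpk (residualAggregation G δ) relu σw σb R h l r (u, u))
        (gpk (residualAggregation G δ) relu σw σb R h l r (v, v))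
        (gpk (residualAggregation G δ) relu σw σb R h l r (u, v)) := by
  simp only [gpk_succ]
  rw [hw, hb, add_zero, (isPSDKernel_gpk_relu hδ0 hδ1 l r).gaussianPairing_eq]

theorem gpk_relu_le_succ (l r : ℕ) : gpk (residualAggregation G δ) relu σw σb R h l r ≤
    gpk (residualAggregation G δ) relu σw σb R h l (r + 1) := by
  rintro ⟨u, v⟩
  rw [gpk_relu_succ hw hb hδ0 hδ1]
  exact ((isPSDKernel_gpk_relu (G := G) hδ0 hδ1 l r).isGaussianPair u v).le_two_mul_pairing_relu

theorem gpk_relu_succ_le {l r : ℕ} {B : ℝ}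
    (hB : ∀ p, gpk (residualAggregation G δ) relu σw σb R h l r p ≤ B) (p : V × V) :
    gpk (residualAggregation G δ) relu σw σb R h l (r + 1) p ≤ B := by
  obtain ⟨u, v⟩ := p
  rw [gpk_relu_succ hw hb hδ0 hδ1]
  have := ((isPSDKernel_gpk_relu (G := G) (σw := σw) (σb := σb) (R := R) (h := h)
    hδ0 hδ1 l r).isGaussianPair u v).two_mul_pairing_relu_le
  linarith [hB (u, u), hB (v, v)]

theorem gpk_relu_succ_nonneg (l r : ℕ) (p : V × V) :
    0 ≤ gpk (residualAggregation G δ) relu σw σb R h l (r + 1) p := by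
  obtain ⟨u, v⟩ := p
  rw [gpk_relu_succ hw hb hδ0 hδ1]
  have := ((isPSDKernel_gpk_relu (G := G) (σw := σw) (σb := σb) (R := R) (h := h)
    hδ0 hδ1 l r).isGaussianPair u v).pairing_relu_nonneg
  linarith

theorem gpk_relu_mono (l : ℕ) :
    Monotone fun r => gpk (residualAggregation G δ) relu σw σb R h l r :=
  monotone_nat_of_le_succ (gpk_relu_le_succ hw hb hδ0 hδ1 l)

theorem gpk_relu_le {l : ℕ} {B : ℝ}
    (hB : ∀ p, gpk (residualAggregation G δ) relu σw σb R h l 0 p ≤ B) (r : ℕ) (p : V × V) :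
    gpk (residualAggregation G δ) relu σw σb R h l r p ≤ B := by
  induction r generalizing p with
  | zero => exact hB p
  | succ r ih => exact gpk_relu_succ_le hw hb hδ0 hδ1 ih p

variable [Nonempty V] (hirr : (aggregation G).IsIrreducible)
include hirr

/-- The kernels at `r = 0` are super-iterates of `Ã`, and those at other `r` lie between them and
their maximum. For `q > 0`: after the first layer all entries are nonnegative and a nonzero feature
has a positive diagonal entry, which a power of `Ã` spreads to all pairs. -/
theorem exists_gpk_relu_limit : ∃ q α C : ℝ, 0 < α ∧ α < 1 ∧ 0 < C ∧
    (0 < R → (∃ u, h u ≠ 0) → 0 < q) ∧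
    ∀ l r p, |gpk (residualAggregation G δ) relu σw σb R h l r p - q| ≤ C * α ^ l := by
  have hM := residualAggregation_mem_rowStochastic G hδ0.le hδ1.le
  have hpos := exists_pos_pow_residualAggregation G hirr hδ0 hδ1
  set K := gpk (residualAggregation G δ) relu σw σb R h with hK
  have hMn : ∀ i j, 0 ≤ residualAggregation G δ i j := fun _ _ => nonneg_of_mem_rowStochastic hM
  have hlow : ∀ l, residualAggregation G δ *ᵥ K l 0 ≤ K (l + 1) 0 := fun l => by
    rw [hK, gpk_succ_zero]
    exact mulVec_mono hMn (gpk_relu_mono hw hb hδ0 hδ1 l (Nat.zero_le R))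
  obtain ⟨q, α, C, hα, hα', hC, hq, hlim⟩ := exists_limit_of_monotone_iteration hM hpos
    (x := fun l => K l 0) hlow (fun l b hb' i => by
      rw [hK, gpk_succ_zero]
      exact mulVec_le_const hM (gpk_relu_le hw hb hδ0 hδ1 hb' R) i)
  refine ⟨q, α, C, hα, hα', hC, ?_, fun l r p => ?_⟩
  · rintro hR ⟨u, hu⟩
    obtain ⟨k, hk, c, hc0, hc⟩ := exists_pow_lower_bound hpos
    have hpow : ∀ n l, residualAggregation G δ ^ n *ᵥ K l 0 ≤ K (l + n) 0 := by
      intro n l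
      induction n with
      | zero => simp
      | succ n ih =>
        rw [pow_mulVec_succ]
        exact (mulVec_mono hMn ih).trans (hlow (l + n))
    have hMk := pow_mem hM k
    have hnorm : 0 < ‖h u‖ ^ 2 := by positivity
    have hone : ‖h u‖ ^ 2 ≤ K 0 1 (u, u) := by
      have h1 := gpk_relu_le_succ (G := G) (R := R) (h := h) hw hb hδ0 hδ1 0 0 (u, u)
      rw [gpk_zero_zero] at h1
      simpa using h1
    have hstep : residualAggregation G δ *ᵥ K 0 1 ≤ K 1 0 := by
      rw [hK, gpk_succ_zero]
      exact mulVec_mono hMn (gpk_relu_mono hw hb hδ0 hδ1 0 hR)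
    have h2 : ∀ p, c * ‖h u‖ ^ 2 ≤ (residualAggregation G δ ^ k *ᵥ K 0 1) p := fun p => by
      have h3 := Finset.single_le_sum
        (f := fun j => (residualAggregation G δ ^ k) p j * K 0 1 j)
        (fun j _ => mul_nonneg (nonneg_of_mem_rowStochastic hMk)
          (gpk_relu_succ_nonneg hw hb hδ0 hδ1 0 0 j)) (Finset.mem_univ (u, u))
      exact (mul_le_mul (hc p (u, u)) hone hnorm.le (nonneg_of_mem_rowStochastic hMk)).trans h3
    have h4 : ∀ p, c * ‖h u‖ ^ 2 ≤ K (1 + k) 0 p := fun p => by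
      refine le_trans ?_ (hpow k 1 p)
      refine le_trans ?_ (mulVec_mono (M := residualAggregation G δ ^ k)
        (fun _ _ => nonneg_of_mem_rowStochastic hMk) hstep p)
      rw [mulVec_mulVec, ← pow_succ, pow_mulVec_succ]
      exact const_le_mulVec hM h2 p
    exact (mul_pos hc0 hnorm).trans_le (hq (1 + k) _ h4)
  · obtain ⟨lo, hi, h1, h2, h3, h4, h5⟩ := hlim l
    have h6 := gpk_relu_le hw hb hδ0 hδ1 h2 r p
    have h7 := (h1 p).trans (gpk_relu_mono (G := G) (R := R) (h := h) hw hb hδ0 hδ1 l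
      (Nat.zero_le r) p)
    rw [abs_le]
    constructor <;> linarith

theorem exists_gntk_relu_asymptotics {π : V × V → ℝ}
    (hπ : IsStationaryDistribution (residualAggregation G δ) π) :
    ∃ α C : ℝ, 0 < α ∧ α < 1 ∧ 0 < C ∧
      ∃ v : V × V → ℝ, ∀ r ≤ R, ∃ v' : V × V → ℝ, ∀ (l : ℕ) (u u' : V),
        |gntk (residualAggregation G δ) relu σw σb R h l r (u, u') -
          π ⬝ᵥ (((R : ℝ) * (l : ℝ)) • v + v')| ≤ C * α ^ l := by
  have hM := residualAggregation_mem_rowStochastic G hδ0.le hδ1.le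
  have hpos := exists_pos_pow_residualAggregation G hirr hδ0 hδ1
  rcases Nat.eq_zero_or_pos R with rfl | hR
  · exact exists_gntk_asymptotics hM hpos hπ (q := 0) (C₀ := 0) (α₀ := 0) le_rfl le_rfl one_pos
      (fun l r hr => absurd hr (Nat.not_lt_zero r)) (fun l r hr => absurd hr (Nat.not_lt_zero r))
  by_cases hh : ∃ u, h u ≠ 0
  · obtain ⟨q, α, C, hα, hα', hC, hq, hK⟩ := exists_gpk_relu_limit (R := R) (h := h) hw hb hδ0 hδ1
      hirr
    have hq := hq hR hh
    -- With `t = β ^ l` and `β ^ 3 = α` the two errors `t / √a` and `α ^ l / t ^ 2` are both of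
    -- order `β ^ l`; the jump of `relu'` costs this loss of rate.
    set β := α ^ (1 / 3 : ℝ) with hβ
    have hβ0 : 0 < β := Real.rpow_pos_of_pos hα _
    have hβ1 : β < 1 := Real.rpow_lt_one hα.le hα' (by norm_num)
    have hβ3 : β ^ 3 = α := by
      rw [hβ, ← Real.rpow_natCast, ← Real.rpow_mul hα.le]
      norm_num
    have hαβ : ∀ l : ℕ, α ^ l = β ^ l * (β ^ l) ^ 2 := fun l => by
      rw [← hβ3]
      ring
    obtain ⟨L, hL⟩ : ∃ L : ℕ, ∀ l ≥ L, C * α ^ l ≤ q / 2 := by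
      obtain ⟨L, hL⟩ := exists_pow_lt_of_lt_one (show 0 < q / 2 / C by positivity) hα'
      refine ⟨L, fun l hl => ?_⟩
      have := (pow_le_pow_of_le_one hα.le hα'.le hl).trans hL.le
      rw [le_div_iff₀ hC] at this
      linarith
    set D := 2 * (1 / √(q / 2) + 4 * C) with hD
    have hD0 : 0 ≤ D := by positivity
    have hderiv : ∀ r p l, |gpkDeriv (residualAggregation G δ) relu σw σb R h l r p - 1| ≤
        (D + 1 / β ^ L) * β ^ l := by
      rintro r ⟨u, v⟩
      refine exists_bound_of_eventual_bound hβ0 hβ1.le (fun l => ?_) zero_le_one hD0 fun l hl => ?_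
      · rw [gpkDeriv, (isPSDKernel_gpk_relu hδ0 hδ1 l r).gaussianPairing_eq, hw]
        have := ((isPSDKernel_gpk_relu (G := G) (σw := σw) (σb := σb) (R := R) (h := h)
          hδ0 hδ1 l r).isGaussianPair u v).pairing_deriv_relu_mem_Icc
        rw [abs_le]
        constructor <;> linarith [this.1, this.2]
      · rw [gpkDeriv, (isPSDKernel_gpk_relu hδ0 hδ1 l r).gaussianPairing_eq, hw]
        have huu := abs_le.1 (hK l r (u, u))
        have hvv := abs_le.1 (hK l r (v, v))
        have huv := abs_le.1 (hK l r (u, v))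
        have hqa : q / 2 ≤ gpk (residualAggregation G δ) relu σw σb R h l r (u, u) := by
          linarith [hL l hl]
        have hbound := ((isPSDKernel_gpk_relu (G := G) (σw := σw) (σb := σb) (R := R) (h := h)
          hδ0 hδ1 l r).isGaussianPair u v).abs_two_mul_pairing_deriv_relu_sub_one_le
          (by linarith) (t := β ^ l) (by positivity)
        refine hbound.trans ?_
        have h1 : β ^ l / √(gpk (residualAggregation G δ) relu σw σb R h l r (u, u)) ≤
            1 / √(q / 2) * β ^ l := by
          rw [one_div_mul_eq_div]
          gcongr
        have h2 : (gpk (residualAggregation G δ) relu σw σb R h l r (u, u) +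
            gpk (residualAggregation G δ) relu σw σb R h l r (v, v) -
            2 * gpk (residualAggregation G δ) relu σw σb R h l r (u, v)) / (β ^ l) ^ 2 ≤
            4 * C * β ^ l := by
          rw [div_le_iff₀ (by positivity)]
          have := hαβ l
          nlinarith
        calc _ ≤ 2 * (1 / √(q / 2) * β ^ l + 4 * C * β ^ l) := by linarith
          _ = D * β ^ l := by rw [hD]; ring
    have hαβ' : ∀ l : ℕ, α ^ l ≤ β ^ l := fun l => by
      rw [hαβ]
      exact mul_le_of_le_one_right (by positivity)
        (pow_le_one₀ (by positivity) (pow_le_one₀ hβ0.le hβ1.le))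
    refine exists_gntk_asymptotics hM hpos hπ (q := q) (C₀ := C + (D + 1 / β ^ L)) (α₀ := β)
      (by positivity) hβ0.le hβ1 (fun l r hr p => ?_) (fun l r hr p => ?_)
    · refine (hK l (r + 1) p).trans ?_
      have h1 := mul_le_mul_of_nonneg_left (hαβ' l) hC.le
      have h2 : 0 ≤ (D + 1 / β ^ L) * β ^ l := by positivity
      linarith
    · refine (hderiv r p l).trans ?_
      have h2 : 0 ≤ C * β ^ l := by positivity
      linarith
  -- Without a nonzero feature both kernels vanish identically.
  · push Not at hh
    have hgpk : ∀ l r, gpk (residualAggregation G δ) relu σw σb R h l r = 0 := by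
      have hzero : ∀ l, gpk (residualAggregation G δ) relu σw σb R h l 0 = 0 →
          ∀ r, gpk (residualAggregation G δ) relu σw σb R h l r = 0 := by
        intro l hl r
        refine le_antisymm (gpk_relu_le hw hb hδ0 hδ1 (fun p => by rw [hl]; rfl) r) ?_
        rw [← hl]
        exact gpk_relu_mono hw hb hδ0 hδ1 l (Nat.zero_le r)
      intro l
      induction l with
      | zero =>
        refine hzero 0 ?_
        rw [gpk_zero_zero]
        funext p
        simp [hh]
      | succ l ih =>
        refine hzero (l + 1) ?_
        rw [gpk_succ_zero, ih, mulVec_zero]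
    have hgntk : ∀ l r, gntk (residualAggregation G δ) relu σw σb R h l r = 0 := by
      have hzero : ∀ l, gntk (residualAggregation G δ) relu σw σb R h l 0 = 0 →
          ∀ r, gntk (residualAggregation G δ) relu σw σb R h l r = 0 := by
        intro l hl r
        induction r with
        | zero => exact hl
        | succ r ih =>
          rw [gntk_succ, ih, hgpk]
          funext p
          simp
      intro l
      induction l with
      | zero =>
        refine hzero 0 ?_
        rw [gntk, hgpk]
      | succ l ih =>
        refine hzero (l + 1) ?_
        rw [gntk_succ_zero, ih, mulVec_zero]
    refine ⟨1 / 2, 1, by norm_num, by norm_num, one_pos, 0, fun r _ => ⟨0, fun l u u' => ?_⟩⟩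
    rw [hgntk]
    simp

end ReLUKernel

/-! ### Stein's identity -/

section Stein

theorem integrable_gaussianPDFReal_mul {g : ℝ → ℝ} (hg : Integrable g (gaussianReal 0 1)) :
    Integrable (fun x => gaussianPDFReal 0 1 x * g x) := by
  rw [gaussianReal_of_var_ne_zero 0 one_ne_zero,
    integrable_withDensity_iff_integrable_smul' (measurable_gaussianPDF 0 1)
      (Filter.Eventually.of_forall fun _ => gaussianPDF_lt_top)] at hg
  simpa [toReal_gaussianPDF] using hg

theorem hasDerivAt_gaussianPDFReal (x : ℝ) :
    HasDerivAt (gaussianPDFReal 0 1) (-(x * gaussianPDFReal 0 1 x)) x := by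
  have h1 : HasDerivAt (fun x : ℝ => -(x - 0) ^ 2 / (2 * ((1 : NNReal) : ℝ))) (-x) x := by
    refine ((((hasDerivAt_id' x).sub_const 0).fun_pow 2).fun_neg.div_const
      (2 * ((1 : NNReal) : ℝ))).congr_deriv ?_
    push_cast
    ring
  have h2 := h1.exp.const_mul (√(2 * Real.pi * ((1 : NNReal) : ℝ)))⁻¹
  refine h2.congr_deriv ?_
  unfold gaussianPDFReal
  ring

/-- Stein's identity for the standard Gaussian. -/
theorem integral_mul_gaussianReal {f f' : ℝ → ℝ} {B : ℝ} (hf : ∀ x, HasDerivAt f (f' x) x)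
    (hf' : Measurable f') (hB : ∀ x, |f x| ≤ B) (hB' : ∀ x, |f' x| ≤ B) :
    ∫ x, f x * x ∂(gaussianReal 0 1) = ∫ x, f' x ∂(gaussianReal 0 1) := by
  have hfm : Measurable f :=
    (continuous_iff_continuousAt.2 fun x => (hf x).continuousAt).measurable
  have hid : Integrable (fun x : ℝ => x) (gaussianReal 0 1) :=
    (memLp_id_gaussianReal 1).integrable le_rfl
  have hi1 : Integrable (fun x => f x * x) (gaussianReal 0 1) :=
    hid.bdd_mul hfm.aestronglyMeasurable (Filter.Eventually.of_forall hB)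
  have hi2 : Integrable f (gaussianReal 0 1) := integrable_of_bounded hfm hB
  have hi3 : Integrable f' (gaussianReal 0 1) := integrable_of_bounded hf' hB'
  have hparts := integral_mul_deriv_eq_deriv_mul_of_integrable (u := f) (u' := f')
    (v := gaussianPDFReal 0 1) (v' := fun x => -(x * gaussianPDFReal 0 1 x)) (fun x _ => hf x)
    (fun x _ => hasDerivAt_gaussianPDFReal x)
    (((integrable_gaussianPDFReal_mul hi1).neg).congr (Filter.Eventually.of_forall fun x => by
      simp only [Pi.neg_apply, Pi.mul_apply]; ring))
    ((integrable_gaussianPDFReal_mul hi3).congr (Filter.Eventually.of_forall fun x => by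
      simp only [Pi.mul_apply]; ring))
    ((integrable_gaussianPDFReal_mul hi2).congr (Filter.Eventually.of_forall fun x => by
      simp only [Pi.mul_apply]; ring))
  rw [integral_gaussianReal_eq_integral_smul one_ne_zero,
    integral_gaussianReal_eq_integral_smul one_ne_zero]
  simp only [smul_eq_mul]
  have h1 : ∀ x, gaussianPDFReal 0 1 x * (f x * x) = -(f x * -(x * gaussianPDFReal 0 1 x)) :=
    fun x => by ring
  simp only [h1]
  rw [integral_neg, hparts, neg_neg]
  simp_rw [mul_comm]

/-- The realization of a Gaussian pair by two independent standard Gaussians. -/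
theorem isGaussianPair_prod_gaussianReal {a b c : ℝ}
    (h : ∀ s t : ℝ, 0 ≤ a * s ^ 2 + 2 * c * s * t + b * t ^ 2) :
    IsGaussianPair ((gaussianReal 0 1).prod (gaussianReal 0 1)) (fun p => √a * p.1)
      (fun p => c / √a * p.1 + √(b - c ^ 2 / a) * p.2) a b c := by
  have ha : 0 ≤ a := by simpa using h 1 0
  have hb : 0 ≤ b := by simpa using h 0 1
  have h1 := (isGaussianPair_gaussianReal (√a) (c / √a)).prod
    (isGaussianPair_gaussianReal 0 (√(b - c ^ 2 / a)))
  simp only [zero_mul, add_zero] at h1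
  -- If `a = 0`, semidefiniteness forces `c = 0`, and the quotients by zero take the value `0` that
  -- the formula needs.
  rcases ha.eq_or_lt with rfl | ha'
  · have hc : c = 0 := by
      have h2 := h (-(b + 1)) (c)
      have h3 := h 1 (-c)
      nlinarith [sq_nonneg c]
    subst hc
    simpa [Real.sq_sqrt hb] using h1
  · have hdet : 0 ≤ b - c ^ 2 / a := by
      have h2 := h (-c) a
      rw [sub_nonneg, div_le_iff₀ ha']
      nlinarith
    convert h1 using 1
    · rw [Real.sq_sqrt ha, zero_pow two_ne_zero, add_zero]
    · rw [Real.sq_sqrt hdet, div_pow, Real.sq_sqrt ha]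
      ring
    · rw [mul_div_cancel₀ _ (Real.sqrt_pos.2 ha').ne']

/-- Stein's identity for a Gaussian pair. -/
theorem IsGaussianPair.integral_comp_mul {Ω : Type*} [MeasurableSpace Ω] {μ : Measure Ω}
    [IsProbabilityMeasure μ] {X Y : Ω → ℝ} {a b c : ℝ} (h : IsGaussianPair μ X Y a b c)
    {f f' : ℝ → ℝ} {B : ℝ} (hf : ∀ x, HasDerivAt f (f' x) x)
    (hf' : Measurable f') (hB : ∀ x, |f x| ≤ B) (hB' : ∀ x, |f' x| ≤ B) :
    ∫ ω, f (X ω) * Y ω ∂μ = c * ∫ ω, f' (X ω) ∂μ := by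
  have hfm : Measurable f :=
    (continuous_iff_continuousAt.2 fun x => (hf x).continuousAt).measurable
  have hreal := isGaussianPair_prod_gaussianReal h.quadratic_nonneg
  have h1 := h.integral_eq_pairing hfm measurable_id
  have h2 := hreal.integral_eq_pairing hfm measurable_id
  simp only [id_eq] at h1 h2
  rw [h1, ← h2, integral_comp_of_map_eq h.measurable_left h.map_left hf']
  have hid : Integrable (fun x : ℝ => x) (gaussianReal 0 1) :=
    (memLp_id_gaussianReal 1).integrable le_rfl
  have hB0 : 0 ≤ B := (abs_nonneg _).trans (hB 0)
  set F : ℝ → ℝ := fun x => f (√a * x) with hF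
  have hFm : Measurable F := hfm.comp (measurable_const_mul _)
  have hi1 : Integrable (fun x => F x * x) (gaussianReal 0 1) :=
    hid.bdd_mul hFm.aestronglyMeasurable (Filter.Eventually.of_forall fun x => hB _)
  have hi2 : Integrable F (gaussianReal 0 1) := integrable_of_bounded hFm fun x => hB _
  -- In independent coordinates the second term has mean zero and the first reduces to the
  -- one-dimensional identity.
  have h3 : ∀ p : ℝ × ℝ, f (√a * p.1) * (c / √a * p.1 + √(b - c ^ 2 / a) * p.2) =
      c / √a * (F p.1 * p.1 * 1) + √(b - c ^ 2 / a) * (F p.1 * p.2) := fun p => by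
    simp only [hF]
    ring
  simp only [h3]
  rw [integral_add ((hi1.mul_prod (integrable_const 1)).const_mul _)
    ((hi2.mul_prod hid).const_mul _), integral_const_mul, integral_const_mul,
    integral_prod_mul (fun x => F x * x) (fun _ => (1 : ℝ)),
    integral_prod_mul F (fun x : ℝ => x)]
  have h4 : ∫ x, F x * x ∂(gaussianReal 0 1) = √a * ∫ x, f' (√a * x) ∂(gaussianReal 0 1) := by
    have hd : ∀ x, HasDerivAt F (√a * f' (√a * x)) x := fun x => by
      have := (hf (√a * x)).comp x ((hasDerivAt_id' x).const_mul (√a))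
      exact this.congr_deriv (by ring)
    rw [integral_mul_gaussianReal hd ((hf'.comp (measurable_const_mul _)).const_mul _)
      (B := B + √a * B) (fun x => (hB _).trans (by have := Real.sqrt_nonneg a; nlinarith))
      (fun x => by
        rw [abs_mul, abs_of_nonneg (Real.sqrt_nonneg a)]
        have := mul_le_mul_of_nonneg_left (hB' (√a * x)) (Real.sqrt_nonneg a)
        linarith), integral_const_mul]
  rw [h4]
  have ha : 0 ≤ a := by simpa using h.quadratic_nonneg 1 0
  rcases ha.eq_or_lt with rfl | ha'
  · have hc : c = 0 := by
      have h5 := h.quadratic_nonneg (-(b + 1)) c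
      have h6 := h.quadratic_nonneg 1 (-c)
      nlinarith [sq_nonneg c]
    simp [hc]
  · have := (Real.sqrt_pos.2 ha').ne'
    simp
    field_simp

end Stein

/-! ### Price's identity by rotating two independent copies -/

section Price

variable {f f' : ℝ → ℝ} {B a b c : ℝ}

/-- Two copies of a Gaussian pair, the second one rotated by the angle `s`. -/
theorem isGaussianPair_rotation (h : ∀ s t : ℝ, 0 ≤ a * s ^ 2 + 2 * c * s * t + b * t ^ 2) (s : ℝ) :
    IsGaussianPair ((multivariateGaussian 0 !![a, c; c, b]).prod
        (multivariateGaussian 0 !![a, c; c, b]))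
      (fun p : EuclideanSpace ℝ (Fin 2) × EuclideanSpace ℝ (Fin 2) => p.1 0)
      (fun p => Real.cos s * p.1 1 + Real.sin s * p.2 1) a b (Real.cos s * c) := by
  have h0 := isGaussianPair_eval h
  have h1 := (h0.linear 1 0 0 (Real.cos s)).prod (h0.linear 0 0 0 (Real.sin s))
  have hs := Real.cos_sq_add_sin_sq s
  convert h1 using 1
  · simp
  · simp
  · ring
  · linear_combination (-b) * hs
  · ring

theorem continuous_pairing_cos (h : ∀ s t : ℝ, 0 ≤ a * s ^ 2 + 2 * c * s * t + b * t ^ 2)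
    (hf : Continuous f) (hB : ∀ x, |f x| ≤ B) :
    Continuous fun s => pairing f f a b (Real.cos s * c) := by
  have h1 : ∀ s, pairing f f a b (Real.cos s * c) = _ := fun s =>
    ((isGaussianPair_rotation h s).integral_eq_pairing hf.measurable hf.measurable).symm
  simp only [h1]
  have hB0 : 0 ≤ B := (abs_nonneg _).trans (hB 0)
  refine continuous_of_dominated (bound := fun _ => B * B) (fun s => ?_) (fun s => ?_)
    (integrable_const _) (Filter.Eventually.of_forall fun p => ?_)
  · exact Continuous.aestronglyMeasurable (by fun_prop)
  · refine Filter.Eventually.of_forall fun p => ?_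
    rw [Real.norm_eq_abs, abs_mul]
    exact mul_le_mul (hB _) (hB _) (abs_nonneg _) hB0
  · fun_prop

/-- Price's identity along a rotation. -/
theorem hasDerivAt_pairing_cos (h : ∀ s t : ℝ, 0 ≤ a * s ^ 2 + 2 * c * s * t + b * t ^ 2)
    (hf : ∀ x, HasDerivAt f (f' x) x) (hf' : Continuous f') (hB : ∀ x, |f x| ≤ B)
    (hB' : ∀ x, |f' x| ≤ B) (s : ℝ) :
    HasDerivAt (fun s => pairing f f a b (Real.cos s * c))
      (-Real.sin s * c * pairing f' f' a b (Real.cos s * c)) s := by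
  have hfc : Continuous f := continuous_iff_continuousAt.2 fun x => (hf x).continuousAt
  have hB0 : 0 ≤ B := (abs_nonneg _).trans (hB 0)
  set μ := multivariateGaussian (0 : EuclideanSpace ℝ (Fin 2)) !![a, c; c, b] with hμ
  have h1 : ∀ s, pairing f f a b (Real.cos s * c) =
      ∫ p, f (p.1 0) * f (Real.cos s * p.1 1 + Real.sin s * p.2 1) ∂(μ.prod μ) := fun s =>
    ((isGaussianPair_rotation h s).integral_eq_pairing hfc.measurable hfc.measurable).symm
  simp only [h1]
  have hcoord : Integrable (fun z : EuclideanSpace ℝ (Fin 2) => z 1) μ := by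
    have hsq := (isGaussianPair_eval h).symm.integrable_left_sq
    refine (hsq.add (integrable_const 1)).mono' (by fun_prop)
      (Filter.Eventually.of_forall fun z => ?_)
    simp only [Pi.add_apply]
    rw [Real.norm_eq_abs, abs_le]
    constructor <;> nlinarith [sq_nonneg (z 1 - 1), sq_nonneg (z 1 + 1)]
  have hbound : Integrable (fun p : EuclideanSpace ℝ (Fin 2) × EuclideanSpace ℝ (Fin 2) =>
      B * B * (|p.1 1| + |p.2 1|)) (μ.prod μ) :=
    ((hcoord.abs.comp_fst μ).add (hcoord.abs.comp_snd μ)).const_mul _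
  have hder := hasDerivAt_integral_of_dominated_loc_of_deriv_le (μ := μ.prod μ) (x₀ := s)
    (s := Set.univ) (bound := fun p => B * B * (|p.1 1| + |p.2 1|))
    (F := fun s p => f (p.1 0) * f (Real.cos s * p.1 1 + Real.sin s * p.2 1))
    (F' := fun s p => f (p.1 0) * (f' (Real.cos s * p.1 1 + Real.sin s * p.2 1) *
      (-Real.sin s * p.1 1 + Real.cos s * p.2 1))) Filter.univ_mem
    (Filter.Eventually.of_forall fun s => Continuous.aestronglyMeasurable (by fun_prop))
    (integrable_of_bounded (Continuous.measurable (by fun_prop)) (B := B * B) fun p => by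
      rw [abs_mul]
      exact mul_le_mul (hB _) (hB _) (abs_nonneg _) hB0)
    (Continuous.aestronglyMeasurable (by fun_prop))
    (Filter.Eventually.of_forall fun p s _ => by
      rw [Real.norm_eq_abs, abs_mul, abs_mul, mul_assoc]
      refine mul_le_mul (hB _) (mul_le_mul (hB' _) ?_ (abs_nonneg _) hB0) (by positivity) hB0
      refine (abs_add_le _ _).trans ?_
      rw [abs_mul, abs_mul, abs_neg]
      exact add_le_add (mul_le_of_le_one_left (abs_nonneg _) (Real.abs_sin_le_one s))
        (mul_le_of_le_one_left (abs_nonneg _) (Real.abs_cos_le_one s)))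
    hbound
    (Filter.Eventually.of_forall fun p s _ => by
      have h2 : HasDerivAt (fun s => Real.cos s * p.1 1 + Real.sin s * p.2 1)
          (-Real.sin s * p.1 1 + Real.cos s * p.2 1) s :=
        ((Real.hasDerivAt_cos s).mul_const _).add ((Real.hasDerivAt_sin s).mul_const _)
      exact ((hf _).comp s h2).const_mul _)
  refine hder.2.congr_deriv ?_
  -- The integrand in rotated coordinates. The rotation preserves `μ.prod μ` and turns the
  -- differentiated argument into a coordinate of the second copy, independent of the first, so
  -- Stein's identity applies there with `q.1` frozen.
  set Φ : EuclideanSpace ℝ (Fin 2) × EuclideanSpace ℝ (Fin 2) → ℝ := fun q =>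
    f (Real.cos s * q.1 0 - Real.sin s * q.2 0) * (f' (q.1 1) * q.2 1) with hΦ
  have hΦc : Continuous Φ := by fun_prop
  have hrot : ∀ p, f (p.1 0) * (f' (Real.cos s * p.1 1 + Real.sin s * p.2 1) *
      (-Real.sin s * p.1 1 + Real.cos s * p.2 1)) = Φ (ContinuousLinearMap.rotation s p) := by
    intro p
    have hs := Real.cos_sq_add_sin_sq s
    simp only [hΦ, ContinuousLinearMap.rotation_apply, PiLp.add_apply, PiLp.smul_apply, smul_eq_mul]
    congr 2
    linear_combination (-(p.1 0)) * hs
  rw [integral_congr_ae (Filter.Eventually.of_forall hrot)]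
  have hinv : (μ.prod μ).map (ContinuousLinearMap.rotation s) = μ.prod μ :=
    IsGaussian.map_rotation_eq_self (by simp [hμ]) s
  rw [← integral_map (φ := ContinuousLinearMap.rotation s) (by fun_prop)
    hΦc.aestronglyMeasurable, hinv]
  have hΦint : Integrable Φ (μ.prod μ) := by
    refine ((hcoord.abs.comp_snd μ).const_mul (B * B)).mono' hΦc.aestronglyMeasurable
      (Filter.Eventually.of_forall fun q => ?_)
    rw [Real.norm_eq_abs, abs_mul, abs_mul, mul_assoc]
    exact mul_le_mul (hB _) (mul_le_mul_of_nonneg_right (hB' _) (abs_nonneg _)) (by positivity) hB0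
  have hstein : ∀ w : EuclideanSpace ℝ (Fin 2), ∫ w' : EuclideanSpace ℝ (Fin 2),
      f (Real.cos s * w 0 - Real.sin s * w' 0) * w' 1 ∂μ =
      c * ∫ w' : EuclideanSpace ℝ (Fin 2),
        -Real.sin s * f' (Real.cos s * w 0 - Real.sin s * w' 0) ∂μ := fun w => by
    refine (isGaussianPair_eval h).integral_comp_mul (B := B)
      (f := fun x => f (Real.cos s * w 0 - Real.sin s * x))
      (f' := fun x => -Real.sin s * f' (Real.cos s * w 0 - Real.sin s * x)) (fun x => ?_)
      (by fun_prop) (fun x => hB _) (fun x => ?_)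
    · have h2 : HasDerivAt (fun x => Real.cos s * w 0 - Real.sin s * x) (-Real.sin s) x := by
        simpa using ((hasDerivAt_id x).const_mul (Real.sin s)).const_sub (Real.cos s * w 0)
      exact ((hf _).comp x h2).congr_deriv (by ring)
    · rw [abs_mul, abs_neg]
      exact (mul_le_of_le_one_left (abs_nonneg _) (Real.abs_sin_le_one s)).trans (hB' _)
  have hpair : IsGaussianPair (μ.prod μ)
      (fun q : EuclideanSpace ℝ (Fin 2) × EuclideanSpace ℝ (Fin 2) =>
        Real.cos s * q.1 0 - Real.sin s * q.2 0) (fun q => q.1 1) a b (Real.cos s * c) := by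
    have h0 := isGaussianPair_eval h
    have h1 := (h0.linear (Real.cos s) 0 0 1).prod (h0.linear (-Real.sin s) 0 0 0)
    have hs := Real.cos_sq_add_sin_sq s
    convert h1 using 1
    · funext q
      ring
    · simp
    · linear_combination (-a) * hs
    · ring
    · ring
  rw [← hpair.integral_eq_pairing hf'.measurable hf'.measurable, integral_prod _ hΦint,
    integral_prod _ (integrable_of_bounded (Continuous.measurable (by fun_prop)) (B := B * B)
      fun p => by
        rw [abs_mul]
        exact mul_le_mul (hB' _) (hB' _) (abs_nonneg _) hB0), ← integral_const_mul]
  congr 1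
  funext w
  have h5 : ∀ w' : EuclideanSpace ℝ (Fin 2), Φ (w, w') =
      f' (w 1) * (f (Real.cos s * w 0 - Real.sin s * w' 0) * w' 1) := fun w' => by
    simp only [hΦ]
    ring
  simp only [h5]
  rw [integral_const_mul, hstein w, integral_const_mul, integral_mul_const]
  ring

/-- Price's identity in integrated form. -/
theorem pairing_eq_mul_integral (h : ∀ s t : ℝ, 0 ≤ a * s ^ 2 + 2 * c * s * t + b * t ^ 2)
    (hf : ∀ x, HasDerivAt f (f' x) x) (hf' : Continuous f') (hB : ∀ x, |f x| ≤ B)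
    (hB' : ∀ x, |f' x| ≤ B) :
    pairing f f a b c = pairing f f a b 0 +
      c * ∫ s in (0 : ℝ)..(Real.pi / 2), Real.sin s * pairing f' f' a b (Real.cos s * c) := by
  have hcont := continuous_pairing_cos h hf' hB'
  -- The angle carries the covariance from `c` at `0` to `0` at `π / 2`.
  have h1 := intervalIntegral.integral_eq_sub_of_hasDerivAt (a := 0) (b := Real.pi / 2)
    (fun s _ => hasDerivAt_pairing_cos h hf hf' hB hB' s)
    (Continuous.intervalIntegrable (by fun_prop) _ _)
  have h2 : ∀ s, -Real.sin s * c * pairing f' f' a b (Real.cos s * c) =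
      -c * (Real.sin s * pairing f' f' a b (Real.cos s * c)) := fun s => by ring
  simp only [h2] at h1
  rw [intervalIntegral.integral_const_mul, Real.cos_pi_div_two, Real.cos_zero, zero_mul,
    one_mul] at h1
  linarith

end Price

/-! ### Pointwise properties of `tanh` -/

section Tanh

theorem hasDerivAt_tanh (x : ℝ) : HasDerivAt Real.tanh (1 - Real.tanh x ^ 2) x := by
  have hc := (Real.cosh_pos x).ne'
  have h := (Real.hasDerivAt_sinh x).div (Real.hasDerivAt_cosh x) hc
  have h1 : Real.tanh = Real.sinh / Real.cosh := funext fun x => by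
    rw [Pi.div_apply, Real.tanh_eq_sinh_div_cosh]
  rw [h1]
  refine h.congr_deriv ?_
  rw [Pi.div_apply]
  field_simp

theorem deriv_tanh (x : ℝ) : deriv Real.tanh x = 1 - Real.tanh x ^ 2 := (hasDerivAt_tanh x).deriv

theorem hasDerivAt_tanh_deriv (x : ℝ) : HasDerivAt Real.tanh (deriv Real.tanh x) x := by
  rw [deriv_tanh]
  exact hasDerivAt_tanh x

theorem continuous_tanh : Continuous Real.tanh :=
  continuous_iff_continuousAt.2 fun x => (hasDerivAt_tanh x).continuousAt

theorem continuous_deriv_tanh : Continuous (deriv Real.tanh) := by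
  have h : deriv Real.tanh = fun x => 1 - Real.tanh x ^ 2 := funext deriv_tanh
  have := continuous_tanh
  rw [h]
  fun_prop

theorem abs_tanh_le_one (x : ℝ) : |Real.tanh x| ≤ 1 :=
  abs_le.2 ⟨(Real.neg_one_lt_tanh x).le, (Real.tanh_lt_one x).le⟩

theorem deriv_tanh_pos (x : ℝ) : 0 < deriv Real.tanh x := by
  rw [deriv_tanh]
  nlinarith [Real.neg_one_lt_tanh x, Real.tanh_lt_one x]

theorem deriv_tanh_le_one (x : ℝ) : deriv Real.tanh x ≤ 1 := by
  rw [deriv_tanh]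
  nlinarith [sq_nonneg (Real.tanh x)]

theorem abs_deriv_tanh_le_one (x : ℝ) : |deriv Real.tanh x| ≤ 1 := by
  rw [abs_of_pos (deriv_tanh_pos x)]
  exact deriv_tanh_le_one x

theorem strictMono_tanh : StrictMono Real.tanh := strictMono_of_deriv_pos deriv_tanh_pos

theorem tanh_nonneg {x : ℝ} (hx : 0 ≤ x) : 0 ≤ Real.tanh x := by
  simpa using strictMono_tanh.monotone hx

theorem tanh_abs (x : ℝ) : Real.tanh |x| = |Real.tanh x| := by
  rcases le_total 0 x with h | h
  · rw [abs_of_nonneg h, abs_of_nonneg (tanh_nonneg h)]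
  · have := tanh_nonneg (neg_nonneg.2 h)
    rw [Real.tanh_neg] at this
    rw [abs_of_nonpos h, Real.tanh_neg, abs_of_nonpos (by linarith)]

theorem tanh_sq_le_tanh_sq {x y : ℝ} (h : |x| ≤ |y|) : Real.tanh x ^ 2 ≤ Real.tanh y ^ 2 := by
  rw [sq_le_sq, ← tanh_abs, ← tanh_abs]
  exact strictMono_tanh.monotone h

/-- Concavity of `tanh` on the half-line, obtained from the sign of the derivative of the
difference. -/
theorem mul_tanh_le {s x : ℝ} (hs0 : 0 ≤ s) (hs1 : s ≤ 1) (hx : 0 ≤ x) :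
    s * Real.tanh x ≤ Real.tanh (s * x) := by
  have hd : ∀ x, HasDerivAt (fun x => Real.tanh (s * x) - s * Real.tanh x)
      (s * (Real.tanh x ^ 2 - Real.tanh (s * x) ^ 2)) x := fun x =>
    (((hasDerivAt_tanh (s * x)).comp x ((hasDerivAt_id' x).const_mul s)).sub
      ((hasDerivAt_tanh x).const_mul s)).congr_deriv (by ring)
  have hm : MonotoneOn (fun x => Real.tanh (s * x) - s * Real.tanh x) (Set.Ici 0) := by
    refine monotoneOn_of_deriv_nonneg (convex_Ici 0)
      (fun x _ => (hd x).continuousAt.continuousWithinAt)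
      (fun x _ => (hd x).differentiableAt.differentiableWithinAt) fun x _ => ?_
    rw [(hd x).deriv]
    refine mul_nonneg hs0 (sub_nonneg.2 (tanh_sq_le_tanh_sq ?_))
    rw [abs_mul, abs_of_nonneg hs0]
    exact mul_le_of_le_one_left (abs_nonneg x) hs1
  have := hm (Set.mem_Ici.2 le_rfl) (Set.mem_Ici.2 hx) hx
  simp at this
  exact this

theorem sq_mul_tanh_sq_le {s : ℝ} (hs0 : 0 ≤ s) (hs1 : s ≤ 1) (x : ℝ) :
    s ^ 2 * Real.tanh x ^ 2 ≤ Real.tanh (s * x) ^ 2 := by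
  have h := mul_tanh_le hs0 hs1 (abs_nonneg x)
  rw [← mul_pow, sq_le_sq, abs_mul, ← tanh_abs, ← tanh_abs, abs_mul, abs_of_nonneg hs0]
  exact h

/-- In the closed form of the sum, `y` enters only the denominator. Symmetric noise thus lowers
`tanh` on the positive half-line without changing its sign. -/
theorem tanh_add_add_tanh_sub_mem {x : ℝ} (hx : 0 ≤ x) (y : ℝ) :
    0 ≤ Real.tanh (x + y) + Real.tanh (x - y) ∧
      Real.tanh (x + y) + Real.tanh (x - y) ≤ 2 * Real.tanh x := by
  have hp : 0 < Real.cosh x ^ 2 + Real.sinh y ^ 2 := by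
    have := Real.cosh_pos x
    positivity
  have h1 : Real.tanh (x + y) + Real.tanh (x - y) =
      2 * Real.sinh x * Real.cosh x / (Real.cosh x ^ 2 + Real.sinh y ^ 2) := by
    have h2 := (Real.cosh_pos (x + y)).ne'
    have h3 := (Real.cosh_pos (x - y)).ne'
    rw [Real.tanh_eq_sinh_div_cosh, Real.tanh_eq_sinh_div_cosh, div_add_div _ _ h2 h3,
      div_eq_div_iff (mul_ne_zero h2 h3) hp.ne', Real.cosh_add, Real.cosh_sub, Real.sinh_add,
      Real.sinh_sub]
    have h4 := Real.cosh_sq x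
    have h5 := Real.cosh_sq y
    generalize Real.cosh x = C at *
    generalize Real.cosh y = D at *
    generalize Real.sinh x = S at *
    generalize Real.sinh y = T at *
    linear_combination (2 * S * C * T ^ 2) * (h5 - h4)
  have hs : 0 ≤ Real.sinh x := Real.sinh_nonneg_iff.2 hx
  have hc := Real.cosh_pos x
  rw [h1]
  refine ⟨by positivity, ?_⟩
  rw [Real.tanh_eq_sinh_div_cosh, mul_div_assoc', div_le_div_iff₀ hp hc]
  nlinarith [mul_nonneg hs (sq_nonneg (Real.sinh y))]

theorem abs_tanh_sub_le (x y : ℝ) : |Real.tanh x - Real.tanh y| ≤ |x - y| := by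
  have h := Convex.norm_image_sub_le_of_norm_deriv_le (f := Real.tanh) (C := 1) (s := Set.univ)
    (x := y) (y := x) (fun z _ => (hasDerivAt_tanh z).differentiableAt)
    (fun z _ => abs_deriv_tanh_le_one z) convex_univ trivial trivial
  simpa using h

theorem abs_deriv_tanh_sub_le (x y : ℝ) :
    |deriv Real.tanh x - deriv Real.tanh y| ≤ 2 * |x - y| := by
  rw [deriv_tanh, deriv_tanh,
    show 1 - Real.tanh x ^ 2 - (1 - Real.tanh y ^ 2) =
      -((Real.tanh x + Real.tanh y) * (Real.tanh x - Real.tanh y)) by ring, abs_neg, abs_mul]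
  refine mul_le_mul ((abs_add_le _ _).trans ?_) (abs_tanh_sub_le x y) (abs_nonneg _) zero_le_two
  linarith [abs_tanh_le_one x, abs_tanh_le_one y]

end Tanh

/-! ### The variance and slope functions of one `tanh` layer -/

section SingleLayer

/-- `𝔼[tanh(√q z)²]`. -/
noncomputable def tanhVariance (q : ℝ) : ℝ := ∫ x, Real.tanh (√q * x) ^ 2 ∂(gaussianReal 0 1)

/-- `𝔼[tanh'(√q z)²]`. -/
noncomputable def tanhSlope (q : ℝ) : ℝ := ∫ x, deriv Real.tanh (√q * x) ^ 2 ∂(gaussianReal 0 1)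

theorem integrable_comp_gaussianReal {f : ℝ → ℝ} (hf : Continuous f) (hB : ∀ x, |f x| ≤ 1)
    (q : ℝ) : Integrable (fun x => f (q * x) ^ 2) (gaussianReal 0 1) :=
  integrable_of_bounded (Continuous.measurable (by fun_prop)) (B := 1) fun x => by
    rw [abs_pow]
    exact pow_le_one₀ (abs_nonneg _) (hB _)

theorem tanhVariance_mono {q q' : ℝ} (h : q ≤ q') : tanhVariance q ≤ tanhVariance q' := by
  refine integral_mono (integrable_comp_gaussianReal continuous_tanh abs_tanh_le_one _)
    (integrable_comp_gaussianReal continuous_tanh abs_tanh_le_one _) fun x =>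
    tanh_sq_le_tanh_sq ?_
  rw [abs_mul, abs_mul, abs_of_nonneg (Real.sqrt_nonneg _), abs_of_nonneg (Real.sqrt_nonneg _)]
  exact mul_le_mul_of_nonneg_right (Real.sqrt_le_sqrt h) (abs_nonneg x)

theorem tanhSlope_anti {q q' : ℝ} (h : q ≤ q') : tanhSlope q' ≤ tanhSlope q := by
  refine integral_mono (integrable_comp_gaussianReal continuous_deriv_tanh abs_deriv_tanh_le_one _)
    (integrable_comp_gaussianReal continuous_deriv_tanh abs_deriv_tanh_le_one _) fun x =>
    pow_le_pow_left₀ (deriv_tanh_pos _).le ?_ 2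
  rw [deriv_tanh, deriv_tanh]
  refine sub_le_sub_left (tanh_sq_le_tanh_sq ?_) 1
  rw [abs_mul, abs_mul, abs_of_nonneg (Real.sqrt_nonneg _), abs_of_nonneg (Real.sqrt_nonneg _)]
  exact mul_le_mul_of_nonneg_right (Real.sqrt_le_sqrt h) (abs_nonneg x)

theorem tanhVariance_nonneg (q : ℝ) : 0 ≤ tanhVariance q := integral_nonneg fun _ => sq_nonneg _

/-- Shrinking the argument by `s = √q / √q'` shrinks `tanh` by no more than the factor `s`. This is
the source of the contraction of the variance map towards its fixed point. -/
theorem mul_tanhVariance_le {q q' : ℝ} (hq : 0 ≤ q) (h : q ≤ q') :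
    q * tanhVariance q' ≤ q' * tanhVariance q := by
  rcases (hq.trans h).eq_or_lt with hq' | hq'
  · rw [← hq', le_antisymm (h.trans hq'.ge) hq]
  set s := √q / √q' with hs
  have hs0 : 0 ≤ s := by positivity
  have hs1 : s ≤ 1 := (div_le_one (Real.sqrt_pos.2 hq')).2 (Real.sqrt_le_sqrt h)
  have hs2 : s ^ 2 = q / q' := by rw [hs, div_pow, Real.sq_sqrt hq, Real.sq_sqrt hq'.le]
  have hs3 : s * √q' = √q := div_mul_cancel₀ _ (Real.sqrt_pos.2 hq').ne'
  have h1 : s ^ 2 * tanhVariance q' ≤ tanhVariance q := by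
    rw [tanhVariance, tanhVariance, ← integral_const_mul]
    refine integral_mono ((integrable_comp_gaussianReal continuous_tanh abs_tanh_le_one _).const_mul _)
      (integrable_comp_gaussianReal continuous_tanh abs_tanh_le_one _) fun x => ?_
    rw [← hs3, mul_assoc]
    exact sq_mul_tanh_sq_le hs0 hs1 _
  rw [hs2, div_mul_eq_mul_div, div_le_iff₀ hq'] at h1
  linarith

theorem integral_abs_gaussianReal_le : ∫ x, |x| ∂(gaussianReal 0 1) ≤ 1 := by
  have hid : Integrable (fun x : ℝ => x) (gaussianReal 0 1) :=
    (memLp_id_gaussianReal 1).integrable le_rfl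
  have h2 := integrable_sq_gaussianReal 1
  have h := integral_mono hid.abs (((integrable_const (1 : ℝ)).add h2).div_const 2) fun x => by
    simp only [Pi.add_apply, one_mul]
    nlinarith [sq_nonneg (|x| - 1), sq_abs x]
  rw [integral_div] at h
  simp only [Pi.add_apply] at h
  rw [integral_add (integrable_const 1) h2, integral_sq_gaussianReal] at h
  simpa using h

theorem abs_tanhSlope_sub_le {a q : ℝ} (ha : 0 ≤ a) (hq : 0 < q) :
    |tanhSlope a - tanhSlope q| ≤ 4 * (|a - q| / √q) := by
  have hid : Integrable (fun x : ℝ => x) (gaussianReal 0 1) :=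
    (memLp_id_gaussianReal 1).integrable le_rfl
  have hsq : |√a - √q| ≤ |a - q| / √q := by
    have hpos := Real.sqrt_pos.2 hq
    rw [le_div_iff₀ hpos]
    have h1 : a - q = (√a - √q) * (√a + √q) := by
      have h2 := Real.sq_sqrt ha
      have h3 := Real.sq_sqrt hq.le
      linear_combination h3 - h2
    rw [h1, abs_mul, abs_of_nonneg (by positivity : 0 ≤ √a + √q)]
    exact mul_le_mul_of_nonneg_left (by linarith [Real.sqrt_nonneg a]) (abs_nonneg _)
  rw [tanhSlope, tanhSlope, ← integral_sub
    (integrable_comp_gaussianReal continuous_deriv_tanh abs_deriv_tanh_le_one _)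
    (integrable_comp_gaussianReal continuous_deriv_tanh abs_deriv_tanh_le_one _)]
  have h1 : |∫ x, deriv Real.tanh (√a * x) ^ 2 - deriv Real.tanh (√q * x) ^ 2 ∂(gaussianReal 0 1)| ≤
      ∫ x, 4 * |√a - √q| * |x| ∂(gaussianReal 0 1) := by
    rw [← Real.norm_eq_abs]
    refine norm_integral_le_of_norm_le (hid.abs.const_mul _) (Filter.Eventually.of_forall fun x => ?_)
    rw [Real.norm_eq_abs, sq_sub_sq, abs_mul]
    have h2 := abs_deriv_tanh_sub_le (√a * x) (√q * x)
    rw [← sub_mul, abs_mul] at h2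
    have h3 : |deriv Real.tanh (√a * x) + deriv Real.tanh (√q * x)| ≤ 2 :=
      (abs_add_le _ _).trans (by linarith [abs_deriv_tanh_le_one (√a * x), abs_deriv_tanh_le_one (√q * x)])
    calc _ ≤ 2 * (2 * (|√a - √q| * |x|)) := mul_le_mul h3 h2 (abs_nonneg _) zero_le_two
      _ = _ := by ring
  refine h1.trans ?_
  rw [integral_const_mul]
  nlinarith [integral_abs_gaussianReal_le, abs_nonneg (√a - √q)]

end SingleLayer

/-! ### Comparison inequalities for `𝔼[tanh(X) tanh(Y)]` -/

section TanhPairing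

variable {a b c : ℝ}

theorem pairing_symm (h : ∀ s t : ℝ, 0 ≤ a * s ^ 2 + 2 * c * s * t + b * t ^ 2) {f : ℝ → ℝ}
    (hf : Measurable f) : pairing f f a b c = pairing f f b a c := by
  rw [← (isGaussianPair_eval h).integral_eq_pairing hf hf,
    ← (isGaussianPair_eval h).symm.integral_eq_pairing hf hf]
  simp_rw [mul_comm]

/-- Polarization isolates the defect `𝔼[(f(X) - f(Y))²]`, whose sign gives strict inequalities and
whose size gives rates. -/
theorem IsGaussianPair.pairing_eq_sub {Ω : Type*} [MeasurableSpace Ω] {μ : Measure Ω}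
    [IsProbabilityMeasure μ] {X Y : Ω → ℝ} (h : IsGaussianPair μ X Y a b c) {f : ℝ → ℝ}
    (hf : Continuous f) (hB : ∀ x, |f x| ≤ 1) :
    pairing f f a b c = (∫ x, f (√a * x) ^ 2 ∂(gaussianReal 0 1) +
      ∫ x, f (√b * x) ^ 2 ∂(gaussianReal 0 1)) / 2 - (∫ ω, (f (X ω) - f (Y ω)) ^ 2 ∂μ) / 2 := by
  have hX := h.measurable_left
  have hY := h.measurable_right
  have hfm := hf.measurable
  have hi : ∀ {Z : Ω → ℝ}, Measurable Z → Integrable (fun ω => f (Z ω) ^ 2) μ := fun {Z} hZ =>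
    integrable_of_bounded (by fun_prop) (B := 1) fun ω => by
      rw [abs_pow]
      exact pow_le_one₀ (abs_nonneg _) (hB _)
  have hi2 : Integrable (fun ω => f (X ω) * f (Y ω)) μ :=
    integrable_of_bounded (by fun_prop) (B := 1) fun ω => by
      rw [abs_mul]
      exact mul_le_one₀ (hB _) (abs_nonneg _) (hB _)
  have h1 : ∀ ω, (f (X ω) - f (Y ω)) ^ 2 = f (X ω) ^ 2 + f (Y ω) ^ 2 - 2 * (f (X ω) * f (Y ω)) :=
    fun ω => by ring
  simp only [h1]
  have hadd : Integrable (fun ω => f (X ω) ^ 2 + f (Y ω) ^ 2) μ := (hi hX).add (hi hY)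
  rw [integral_sub hadd (hi2.const_mul 2), integral_add (hi hX) (hi hY),
    integral_const_mul, h.integral_eq_pairing hfm hfm,
    integral_comp_of_map_eq hX h.map_left (f := fun x => f x ^ 2) (by fun_prop),
    integral_comp_of_map_eq hY h.map_right (f := fun x => f x ^ 2) (by fun_prop)]
  ring

/-- `tanh` averaged over a centred Gaussian perturbation of standard deviation `κ`. -/
noncomputable def smoothTanh (κ x : ℝ) : ℝ := ∫ g, Real.tanh (x + κ * g) ∂(gaussianReal 0 1)

theorem integrable_tanh_comp {Ω : Type*} [MeasurableSpace Ω] {μ : Measure Ω} [IsFiniteMeasure μ]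
    {X : Ω → ℝ} (hX : Measurable X) : Integrable (fun ω => Real.tanh (X ω)) μ :=
  integrable_of_bounded (continuous_tanh.measurable.comp hX) fun _ => abs_tanh_le_one _

theorem smoothTanh_zero_left (x : ℝ) : smoothTanh 0 x = Real.tanh x := by simp [smoothTanh]

theorem smoothTanh_eq (κ x : ℝ) : smoothTanh κ x =
    ∫ g, (Real.tanh (x + κ * g) + Real.tanh (x - κ * g)) / 2 ∂(gaussianReal 0 1) := by
  have h1 := integral_comp_neg_gaussianReal fun g => Real.tanh (x + κ * g)
  rw [integral_div, integral_add (integrable_tanh_comp (by fun_prop))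
    (integrable_tanh_comp (by fun_prop))]
  simp only [mul_neg, ← sub_eq_add_neg] at h1
  rw [h1, smoothTanh]
  ring

theorem smoothTanh_neg (κ x : ℝ) : smoothTanh κ (-x) = -smoothTanh κ x := by
  rw [smoothTanh_eq, smoothTanh_eq, ← integral_neg]
  congr 1
  funext g
  rw [show -x + κ * g = -(x - κ * g) by ring, show -x - κ * g = -(x + κ * g) by ring,
    Real.tanh_neg, Real.tanh_neg]
  ring

theorem smoothTanh_zero (κ : ℝ) : smoothTanh κ 0 = 0 := by
  have := smoothTanh_neg κ 0
  rw [neg_zero] at this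
  linarith

theorem smoothTanh_nonneg (κ : ℝ) {x : ℝ} (hx : 0 ≤ x) : 0 ≤ smoothTanh κ x := by
  rw [smoothTanh_eq]
  exact integral_nonneg fun g => div_nonneg (tanh_add_add_tanh_sub_mem hx _).1 zero_le_two

theorem smoothTanh_le (κ : ℝ) {x : ℝ} (hx : 0 ≤ x) : smoothTanh κ x ≤ Real.tanh x := by
  rw [smoothTanh_eq]
  have h := integral_mono (μ := gaussianReal 0 1)
    (f := fun g => (Real.tanh (x + κ * g) + Real.tanh (x - κ * g)) / 2)
    (((integrable_tanh_comp (by fun_prop)).add (integrable_tanh_comp (by fun_prop))).div_const 2)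
    (integrable_const (Real.tanh x)) fun g => by
      have := (tanh_add_add_tanh_sub_mem hx (κ * g)).2
      change (_ + _) / 2 ≤ _
      linarith
  simpa using h

theorem abs_smoothTanh_le_one (κ x : ℝ) : |smoothTanh κ x| ≤ 1 := by
  have h := norm_integral_le_of_norm_le_const (μ := gaussianReal 0 1) (C := 1)
    (f := fun g => Real.tanh (x + κ * g)) (Filter.Eventually.of_forall fun g => abs_tanh_le_one _)
  simpa [smoothTanh] using h

theorem continuous_smoothTanh (κ : ℝ) : Continuous (smoothTanh κ) := by
  have hc := continuous_tanh
  refine continuous_of_dominated (bound := fun _ => 1) (fun x => ?_) (fun x => ?_)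
    (integrable_const _) (Filter.Eventually.of_forall fun g => by fun_prop)
  · exact Continuous.aestronglyMeasurable (by fun_prop)
  · exact Filter.Eventually.of_forall fun g => abs_tanh_le_one _

/-- Given the common Gaussian factor `x`, the two coordinates carry independent noises, and
averaging over each turns its `tanh` into a `smoothTanh`. -/
theorem pairing_tanh_eq_integral
    (h : ∀ s t : ℝ, 0 ≤ a * s ^ 2 + 2 * c * s * t + b * t ^ 2) (κ : ℝ) :
    pairing Real.tanh Real.tanh (a + κ ^ 2) b c =
      ∫ x, smoothTanh κ (√a * x) * smoothTanh √(b - c ^ 2 / a) (c / √a * x)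
        ∂(gaussianReal 0 1) := by
  have hc := continuous_tanh
  have hm := continuous_tanh.measurable
  have hs := continuous_smoothTanh κ
  have h1 := (isGaussianPair_prod_gaussianReal h).prod (isGaussianPair_gaussianReal κ 0)
  simp only [ne_eq, OfNat.ofNat_ne_zero, not_false_eq_true, zero_pow, add_zero, mul_zero,
    zero_mul] at h1
  rw [← h1.integral_eq_pairing hm hm, integral_prod _ (integrable_of_bounded (B := 1)
    (Continuous.measurable (by fun_prop)) fun p => by
      rw [abs_mul]
      exact mul_le_one₀ (abs_tanh_le_one _) (abs_nonneg _) (abs_tanh_le_one _))]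
  simp only [integral_mul_const]
  change ∫ p : ℝ × ℝ, smoothTanh κ (√a * p.1) *
    Real.tanh (c / √a * p.1 + √(b - c ^ 2 / a) * p.2)
    ∂((gaussianReal 0 1).prod (gaussianReal 0 1)) = _
  rw [integral_prod _ (integrable_of_bounded (B := 1)
    (Continuous.measurable (by fun_prop)) fun p => by
      rw [abs_mul]
      exact mul_le_one₀ (abs_smoothTanh_le_one _ _) (abs_nonneg _) (abs_tanh_le_one _))]
  simp only [integral_const_mul]
  rfl

theorem integrable_smoothTanh_mul (κ κ' p p' : ℝ) :
    Integrable (fun x => smoothTanh κ (p * x) * smoothTanh κ' (p' * x)) (gaussianReal 0 1) := by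
  have h1 := continuous_smoothTanh κ
  have h2 := continuous_smoothTanh κ'
  refine integrable_of_bounded (B := 1) (Continuous.measurable (by fun_prop)) fun x => ?_
  rw [abs_mul]
  exact mul_le_one₀ (abs_smoothTanh_le_one _ _) (abs_nonneg _) (abs_smoothTanh_le_one _ _)

theorem pairing_tanh_zero (ha : 0 ≤ a) (hb : 0 ≤ b) :
    pairing Real.tanh Real.tanh a b 0 = 0 := by
  have h := pairing_tanh_eq_integral (a := a) (b := b) (c := 0)
    (fun s t => by simp only [mul_zero, zero_mul, add_zero]; positivity) 0
  simpa [smoothTanh_zero] using h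

/-- The smoothed factors are odd and, as `c ≥ 0`, of equal sign; more noise shrinks the first. For
`c ≤ 0` the inequality reverses, which is why nonnegative kernel entries are needed later. -/
theorem pairing_tanh_add_sq_le (h : ∀ s t : ℝ, 0 ≤ a * s ^ 2 + 2 * c * s * t + b * t ^ 2)
    (hc : 0 ≤ c) (κ : ℝ) :
    pairing Real.tanh Real.tanh (a + κ ^ 2) b c ≤ pairing Real.tanh Real.tanh a b c := by
  have h0 := pairing_tanh_eq_integral h 0
  rw [zero_pow two_ne_zero, add_zero] at h0
  rw [h0, pairing_tanh_eq_integral h κ]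
  refine integral_mono (integrable_smoothTanh_mul _ _ _ _) (integrable_smoothTanh_mul _ _ _ _)
    fun x => ?_
  set τ := √(b - c ^ 2 / a)
  have hpos : ∀ x : ℝ, 0 ≤ x → smoothTanh κ (√a * x) * smoothTanh τ (c / √a * x) ≤
      smoothTanh 0 (√a * x) * smoothTanh τ (c / √a * x) := fun x hx => by
    rw [smoothTanh_zero_left]
    exact mul_le_mul_of_nonneg_right (smoothTanh_le κ (by positivity))
      (smoothTanh_nonneg τ (by positivity))
  rcases le_total 0 x with hx | hx
  · exact hpos x hx
  · have := hpos (-x) (neg_nonneg.2 hx)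
    simpa only [mul_neg, smoothTanh_neg, neg_mul, neg_neg] using this

theorem pairing_tanh_anti (h : ∀ s t : ℝ, 0 ≤ a * s ^ 2 + 2 * c * s * t + b * t ^ 2)
    (hc : 0 ≤ c) {a' b' : ℝ} (ha : a ≤ a') (hb : b ≤ b') :
    pairing Real.tanh Real.tanh a' b' c ≤ pairing Real.tanh Real.tanh a b c := by
  have hm := continuous_tanh.measurable
  have h1 : ∀ s t : ℝ, 0 ≤ a' * s ^ 2 + 2 * c * s * t + b * t ^ 2 := fun s t =>
    (h s t).trans (by nlinarith [sq_nonneg s])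
  have h2 : ∀ s t : ℝ, 0 ≤ b * s ^ 2 + 2 * c * s * t + a' * t ^ 2 := fun s t =>
    (h1 t s).trans_eq (by ring)
  have h3 : ∀ s t : ℝ, 0 ≤ b' * s ^ 2 + 2 * c * s * t + a' * t ^ 2 := fun s t =>
    (h2 s t).trans (by nlinarith [sq_nonneg s])
  have h4 := pairing_tanh_add_sq_le h hc (√(a' - a))
  have h5 := pairing_tanh_add_sq_le h2 hc (√(b' - b))
  rw [Real.sq_sqrt (sub_nonneg.2 ha), add_sub_cancel] at h4
  rw [Real.sq_sqrt (sub_nonneg.2 hb), add_sub_cancel] at h5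
  rw [pairing_symm h3 hm, pairing_symm h2 hm] at h5
  exact h5.trans h4

theorem quadratic_self_nonneg {q : ℝ} (hq : 0 ≤ q) (s t : ℝ) :
    0 ≤ q * s ^ 2 + 2 * q * s * t + q * t ^ 2 :=
  (mul_nonneg hq (sq_nonneg (s + t))).trans_eq (by ring)

theorem pairing_tanh_self {q : ℝ} (hq : 0 ≤ q) :
    pairing Real.tanh Real.tanh q q q = tanhVariance q := by
  have h := isGaussianPair_gaussianReal (√q) (√q)
  rw [Real.sq_sqrt hq, Real.mul_self_sqrt hq] at h
  rw [h.pairing_eq_sub continuous_tanh abs_tanh_le_one, tanhVariance]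
  simp

/-- By `pairing_eq_sub` the gap is half the integral of a continuous nonnegative function; it does
not vanish at `(0, 1)`, and the Gaussian product charges every nonempty open set. -/
theorem pairing_deriv_tanh_lt {q θ : ℝ} (hq : 0 < q) (hθ : θ ∈ Set.Ioo 0 (Real.pi / 2)) :
    pairing (deriv Real.tanh) (deriv Real.tanh) q q (Real.cos θ * q) < tanhSlope q := by
  have hd := continuous_deriv_tanh
  have hcos := Real.cos_le_one θ
  have hcos' := Real.neg_one_le_cos θ
  have hsin : 0 < Real.sin θ := Real.sin_pos_of_pos_of_lt_pi hθ.1 (by linarith [hθ.2, Real.pi_pos])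
  have hquad : ∀ s t : ℝ, 0 ≤ q * s ^ 2 + 2 * (Real.cos θ * q) * s * t + q * t ^ 2 := fun s t => by
    have h1 := Real.sin_sq_add_cos_sq θ
    have h2 : q * s ^ 2 + 2 * (Real.cos θ * q) * s * t + q * t ^ 2 =
        q * ((s + Real.cos θ * t) ^ 2 + (Real.sin θ * t) ^ 2) := by
      linear_combination (-q * t ^ 2) * h1
    rw [h2]
    positivity
  have hpair := isGaussianPair_prod_gaussianReal hquad
  rw [hpair.pairing_eq_sub hd abs_deriv_tanh_le_one, tanhSlope, add_self_div_two]
  set μ := (gaussianReal 0 1).prod (gaussianReal 0 1) with hμ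
  set D : ℝ × ℝ → ℝ := fun p => (deriv Real.tanh (√q * p.1) - deriv Real.tanh
    (Real.cos θ * q / √q * p.1 + √(q - (Real.cos θ * q) ^ 2 / q) * p.2)) ^ 2 with hD
  have hDc : Continuous D := by fun_prop
  have hpos : 0 < ∫ p, D p ∂μ := by
    refine (integral_nonneg fun p => sq_nonneg _).lt_of_ne' fun h0 => ?_
    have hint : Integrable D μ := integrable_of_bounded hDc.measurable (B := 4) fun p => by
      rw [abs_pow, abs_sub_comm]
      have := abs_le.1 (abs_deriv_tanh_le_one (√q * p.1))
      have := abs_le.1 (abs_deriv_tanh_le_one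
        (Real.cos θ * q / √q * p.1 + √(q - (Real.cos θ * q) ^ 2 / q) * p.2))
      rw [sq_abs]
      nlinarith
    rw [integral_eq_zero_iff_of_nonneg (fun p => sq_nonneg _) hint] at h0
    have : (gaussianReal 0 1).IsOpenPosMeasure :=
      (gaussianReal_absolutelyContinuous' 0 one_ne_zero).isOpenPosMeasure
    have h1 := congrFun ((hDc.ae_eq_iff_eq μ continuous_const).1 h0) (0, 1)
    simp only [hD, mul_zero, zero_add, mul_one, deriv_tanh, Real.tanh_zero] at h1
    have h2 : Real.tanh √(q - (Real.cos θ * q) ^ 2 / q) = 0 := by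
      have h3 := pow_eq_zero_iff (two_ne_zero) |>.1 h1
      have h4 : Real.tanh √(q - (Real.cos θ * q) ^ 2 / q) ^ 2 = 0 := by linarith
      exact pow_eq_zero_iff two_ne_zero |>.1 h4
    rw [← Real.tanh_zero] at h2
    have h5 := Real.tanh_injective h2
    have h6 : q - (Real.cos θ * q) ^ 2 / q = q * Real.sin θ ^ 2 := by
      rw [Real.sin_sq]
      field_simp
    rw [h6] at h5
    exact (Real.sqrt_pos.2 (by positivity)).ne' h5
  linarith

/-- Price's identity gives the derivative. With `c = q cos θ` this compares the pairing with its
tangent at `c = q`: the endpoints yield `tanhVariance_lt`, and `θ = arccos (c / q)` yields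
`tanhVariance_sub_le_pairing`. -/
theorem strictMonoOn_pairing_tanh_cos {q : ℝ} (hq : 0 < q) :
    StrictMonoOn (fun θ => pairing Real.tanh Real.tanh q q (Real.cos θ * q) -
      q * tanhSlope q * Real.cos θ) (Set.Icc 0 (Real.pi / 2)) := by
  have hd : ∀ θ, HasDerivAt (fun θ => pairing Real.tanh Real.tanh q q (Real.cos θ * q) -
      q * tanhSlope q * Real.cos θ) (q * Real.sin θ * (tanhSlope q -
        pairing (deriv Real.tanh) (deriv Real.tanh) q q (Real.cos θ * q))) θ := fun θ =>
    ((hasDerivAt_pairing_cos (quadratic_self_nonneg hq.le) hasDerivAt_tanh_deriv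
      continuous_deriv_tanh abs_tanh_le_one abs_deriv_tanh_le_one θ).sub
      ((Real.hasDerivAt_cos θ).const_mul (q * tanhSlope q))).congr_deriv (by ring)
  refine strictMonoOn_of_deriv_pos (convex_Icc _ _)
    (fun θ _ => (hd θ).continuousAt.continuousWithinAt) fun θ hθ => ?_
  rw [interior_Icc] at hθ
  rw [(hd θ).deriv]
  have hsin : 0 < Real.sin θ := Real.sin_pos_of_pos_of_lt_pi hθ.1 (by linarith [hθ.2, Real.pi_pos])
  have := sub_pos.2 (pairing_deriv_tanh_lt hq hθ)
  positivity

theorem tanhVariance_lt {q : ℝ} (hq : 0 < q) : tanhVariance q < q * tanhSlope q := by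
  have h := strictMonoOn_pairing_tanh_cos hq (Set.left_mem_Icc.2 Real.pi_div_two_pos.le)
    (Set.right_mem_Icc.2 Real.pi_div_two_pos.le) Real.pi_div_two_pos
  simp only [Real.cos_zero, Real.cos_pi_div_two, one_mul, zero_mul, mul_one, mul_zero,
    pairing_tanh_self hq.le, pairing_tanh_zero hq.le hq.le] at h
  linarith

theorem tanhVariance_sub_le_pairing {q c : ℝ} (hq : 0 < q) (hc0 : 0 ≤ c) (hcq : c ≤ q) :
    tanhVariance q - tanhSlope q * (q - c) ≤ pairing Real.tanh Real.tanh q q c := by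
  have hcos : Real.cos (Real.arccos (c / q)) = c / q :=
    Real.cos_arccos (by linarith [div_nonneg hc0 hq.le]) ((div_le_one hq).2 hcq)
  have h := (strictMonoOn_pairing_tanh_cos hq).monotoneOn
    (Set.left_mem_Icc.2 Real.pi_div_two_pos.le)
    ⟨Real.arccos_nonneg (c / q), Real.arccos_le_pi_div_two.2 (div_nonneg hc0 hq.le)⟩
    (Real.arccos_nonneg (c / q))
  simp only [Real.cos_zero, hcos, one_mul, mul_one, pairing_tanh_self hq.le,
    div_mul_cancel₀ c hq.ne'] at h
  have h2 : q * tanhSlope q * (c / q) = tanhSlope q * c := by field_simp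
  rw [h2] at h
  linarith

end TanhPairing

/-! ### Decay from damping at a single state -/

section DampedIteration

variable {ι : Type*} [Fintype ι] [DecidableEq ι] [Nonempty ι]

/-- Nonnegative sub-iterates of an ergodic stochastic matrix that is damped at one state decay
exponentially. -/
theorem exists_decay_of_damped_iteration {M : Matrix ι ι ℝ} (hM : M ∈ rowStochastic ℝ ι)
    (hpos : ∃ k > 0, ∀ i j, 0 < (M ^ k) i j) {x : ℕ → ι → ℝ} (hx : ∀ l i, 0 ≤ x l i) {w : ι → ℝ}
    (hw : ∀ i, w i ≤ 1) {i₀ : ι} (hi₀ : 0 ≤ w i₀) (hi₁ : w i₀ < 1) {C₀ α₀ : ℝ} (hC₀ : 0 ≤ C₀)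
    (hα0 : 0 ≤ α₀) (hα1 : α₀ < 1)
    (hstep : ∀ l i, x (l + 1) i ≤ (M *ᵥ (w * x l)) i + C₀ * α₀ ^ l) :
    ∃ α C : ℝ, 0 < α ∧ α < 1 ∧ 0 < C ∧ ∀ l i, x l i ≤ C * α ^ l := by
  obtain ⟨k, hk, c, hc0, hc⟩ := exists_pow_lower_bound hpos
  have hMn : ∀ i j, 0 ≤ M i j := fun _ _ => nonneg_of_mem_rowStochastic hM
  have hMk := pow_mem hM k
  have hc1 : c ≤ 1 := (hc i₀ i₀).trans (le_one_of_mem_rowStochastic hMk)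
  have hwin : ∀ l, ‖x (l + k)‖ ≤ (1 - (1 - w i₀) * c) * ‖x l‖ + (k * C₀) * α₀ ^ l := by
    intro l
    set m := ‖x l‖ with hm
    have hm0 : 0 ≤ m := norm_nonneg _
    have hxm : ∀ i, x l i ≤ m := fun i => (le_abs_self _).trans (abs_apply_le_norm (x l) i)
    -- Damping is used in the first step of the window only: it lowers the bound `m` at `i₀` by `(1
    -- - w i₀) m`, and `M ^ k` passes this loss to every state with weight at least `c`.
    set z : ι → ℝ := (fun _ => m) - (m * (1 - w i₀)) • Pi.single i₀ 1 with hz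
    have hwz : w * x l ≤ z := fun i => by
      simp only [hz, Pi.mul_apply, Pi.sub_apply, Pi.smul_apply, smul_eq_mul]
      by_cases hi : i = i₀
      · subst hi
        rw [Pi.single_eq_same]
        nlinarith [mul_le_mul_of_nonneg_left (hxm i) hi₀]
      · rw [Pi.single_eq_of_ne hi]
        nlinarith [mul_le_mul_of_nonneg_right (hw i) (hx l i), hxm i]
    have he : ∀ j, C₀ * α₀ ^ (l + j) ≤ C₀ * α₀ ^ l := fun j =>
      mul_le_mul_of_nonneg_left (pow_le_pow_of_le_one hα0 hα1.le (Nat.le_add_right l j)) hC₀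
    have hiter : ∀ j i, x (l + (j + 1)) i ≤ (M ^ (j + 1) *ᵥ z) i + (j + 1) * (C₀ * α₀ ^ l) := by
      intro j
      induction j with
      | zero =>
        intro i
        have h1 := hstep l i
        have h2 := mulVec_mono hMn hwz i
        simp only [zero_add, pow_one, Nat.cast_zero, one_mul]
        linarith
      | succ j ih =>
        intro i
        have h1 := hstep (l + (j + 1)) i
        have h2 := mulVec_mono hMn (x := w * x (l + (j + 1)))
          (y := M ^ (j + 1) *ᵥ z + fun _ => (j + 1) * (C₀ * α₀ ^ l))
          (fun i => (mul_le_of_le_one_left (hx _ i) (hw i)).trans (ih i)) i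
        rw [mulVec_add, mulVec_const hM, ← pow_mulVec_succ, Pi.add_apply] at h2
        have h3 := he (j + 1)
        rw [show l + (j + 1 + 1) = l + (j + 1) + 1 by ring]
        push_cast
        linarith
    obtain ⟨j, rfl⟩ := Nat.exists_eq_succ_of_ne_zero hk.ne'
    have hb0 : 0 ≤ (1 - (1 - w i₀) * c) * m + (((j + 1 : ℕ) : ℝ) * C₀) * α₀ ^ l := by
      have : (1 - w i₀) * c ≤ 1 := mul_le_one₀ (by linarith) hc0.le hc1
      have h1 : 0 ≤ (1 - (1 - w i₀) * c) * m := mul_nonneg (by linarith) hm0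
      have h2 : 0 ≤ (((j + 1 : ℕ) : ℝ) * C₀) * α₀ ^ l := by positivity
      linarith
    refine (pi_norm_le_iff_of_nonneg hb0).2 fun i => ?_
    rw [Real.norm_eq_abs, abs_of_nonneg (hx _ i)]
    refine (hiter j i).trans ?_
    rw [hz, mulVec_sub, mulVec_const hMk, mulVec_smul, mulVec_single_one]
    simp only [Pi.sub_apply, Pi.smul_apply, smul_eq_mul, col_apply]
    have h1 := mul_le_mul_of_nonneg_left (hc i i₀) (mul_nonneg hm0 (sub_nonneg.2 hi₁.le))
    push_cast at h1 ⊢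
    linarith
  obtain ⟨α, C, hα, hα', hC, hf⟩ := exists_geometric_bound_of_window_contraction
    (f := fun l => ‖x l‖) hk (by nlinarith) (by nlinarith) (by positivity) hα0 hα1 hwin
  exact ⟨α, C, hα, hα', hC, fun l i =>
    (le_abs_self _).trans ((abs_apply_le_norm (x l) i).trans (hf l))⟩

end DampedIteration

/-! ### The layer map on kernels and eventual nonnegativity -/

section TanhKernelMap

variable {V : Type*} [Fintype V]

/-- One MLP layer with activation `tanh`, acting on Gaussian process kernels. -/
noncomputable def tanhStep (σw σb : ℝ) (K : V × V → ℝ) (p : V × V) : ℝ :=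
  σw ^ 2 * pairing Real.tanh Real.tanh (K (p.1, p.1)) (K (p.2, p.2)) (K p) + σb ^ 2

/-- The kernel by which an MLP layer with activation `tanh` multiplies its input kernel. -/
noncomputable def slopeKernel (K : V × V → ℝ) (p : V × V) : ℝ :=
  ∫ s in (0 : ℝ)..(Real.pi / 2), Real.sin s * pairing (deriv Real.tanh) (deriv Real.tanh)
    (K (p.1, p.1)) (K (p.2, p.2)) (Real.cos s * K p)

variable {K : V × V → ℝ} {σw σb : ℝ}

namespace IsPSDKernel

/-- Scale the common Gaussian vector by `√ρ` and restore the variances by noise, independent for the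
two arguments even when `u = v`. Averaging out the noise leaves the Gram kernel of the functions `m
u`. -/
theorem pairing_mul [DecidableEq V] (hK : IsPSDKernel K) {f : ℝ → ℝ} (hf : Continuous f)
    (hB : ∀ x, |f x| ≤ 1) {ρ : ℝ} (hρ0 : 0 ≤ ρ) (hρ1 : ρ ≤ 1) :
    IsPSDKernel fun p : V × V => GNTK.pairing f f (K (p.1, p.1)) (K (p.2, p.2)) (ρ * K p) := by
  set μ := multivariateGaussian (0 : EuclideanSpace ℝ V) (of fun u v => K (u, v)) with hμ
  set m : V → EuclideanSpace ℝ V → ℝ := fun u z =>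
    ∫ g, f (√ρ * z u + √(1 - ρ) * √(K (u, u)) * g) ∂(gaussianReal 0 1) with hm
  have hmc : ∀ u, Continuous (m u) := fun u => by
    refine continuous_of_dominated (bound := fun _ => 1) (fun x => ?_) (fun x => ?_)
      (integrable_const _) (Filter.Eventually.of_forall fun g => by fun_prop)
    · exact Continuous.aestronglyMeasurable (by fun_prop)
    · exact Filter.Eventually.of_forall fun g => hB _
  have hm1 : ∀ u z, |m u z| ≤ 1 := fun u z => by
    have h := norm_integral_le_of_norm_le_const (μ := gaussianReal 0 1) (C := 1)
      (f := fun g => f (√ρ * z u + √(1 - ρ) * √(K (u, u)) * g))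
      (Filter.Eventually.of_forall fun g => hB _)
    simpa using h
  have hint : ∀ p : V × V, GNTK.pairing f f (K (p.1, p.1)) (K (p.2, p.2)) (ρ * K p) =
      ∫ z, m p.1 z * m p.2 z ∂μ := by
    rintro ⟨u, v⟩
    have h1 := ((hK.isGaussianPair u v).linear √ρ 0 0 √ρ).prod
      ((isGaussianPair_gaussianReal (√(1 - ρ) * √(K (u, u))) 0).prod
        (isGaussianPair_gaussianReal 0 (√(1 - ρ) * √(K (v, v)))))
    simp only [ne_eq, OfNat.ofNat_ne_zero, not_false_eq_true, zero_pow, add_zero, mul_zero,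
      zero_mul, zero_add, mul_pow, Real.sq_sqrt hρ0, Real.sq_sqrt (sub_nonneg.2 hρ1),
      Real.sq_sqrt (hK.diag_nonneg _), Real.mul_self_sqrt hρ0] at h1
    rw [← add_mul, ← add_mul, add_sub_cancel, one_mul, one_mul] at h1
    rw [← h1.integral_eq_pairing hf.measurable hf.measurable, integral_prod _
      (integrable_of_bounded (B := 1) (Continuous.measurable (by fun_prop)) fun p => by
        rw [abs_mul]
        exact mul_le_one₀ (hB _) (abs_nonneg _) (hB _))]
    congr 1
    funext z
    exact integral_prod_mul (fun g => f (√ρ * z u + √(1 - ρ) * √(K (u, u)) * g))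
      (fun g => f (√ρ * z v + √(1 - ρ) * √(K (v, v)) * g))
  simp only [hint]
  refine integral_mul fun u v => integrable_of_bounded (B := 1)
    ((hmc u).mul (hmc v)).measurable fun z => ?_
  rw [abs_mul]
  exact mul_le_one₀ (hm1 _ _) (abs_nonneg _) (hm1 _ _)

theorem continuous_slope_integrand (hK : IsPSDKernel K) (p : V × V) :
    Continuous fun s => Real.sin s * GNTK.pairing (deriv Real.tanh) (deriv Real.tanh)
      (K (p.1, p.1)) (K (p.2, p.2)) (Real.cos s * K p) :=
  Real.continuous_sin.mul (continuous_pairing_cos (hK.quadratic_nonneg p.1 p.2)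
    continuous_deriv_tanh abs_deriv_tanh_le_one)

/-- A mixture with weights `sin s ≥ 0` of kernels from `pairing_mul` with `ρ = cos s`. -/
theorem slopeKernel [DecidableEq V] (hK : IsPSDKernel K) : IsPSDKernel (slopeKernel K) := by
  have hpi := Real.pi_div_two_pos.le
  have hcos : ∀ s ∈ Set.Icc (0 : ℝ) (Real.pi / 2), 0 ≤ Real.cos s := fun s hs =>
    Real.cos_nonneg_of_neg_pi_div_two_le_of_le (by linarith [hs.1]) hs.2
  have hs : ∀ s ∈ Set.Icc (0 : ℝ) (Real.pi / 2), IsPSDKernel fun p : V × V =>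
      GNTK.pairing (deriv Real.tanh) (deriv Real.tanh) (K (p.1, p.1)) (K (p.2, p.2))
        (Real.cos s * K p) := fun s hs =>
    hK.pairing_mul continuous_deriv_tanh abs_deriv_tanh_le_one (hcos s hs) (Real.cos_le_one s)
  refine ⟨fun u v => intervalIntegral.integral_congr fun s h => ?_, fun x => ?_⟩
  · rw [Set.uIcc_of_le hpi] at h
    exact congrArg (Real.sin s * ·) ((hs s h).symm u v)
  · have h1 : ∀ u v, x u * x v * GNTK.slopeKernel K (u, v) = ∫ s in (0 : ℝ)..(Real.pi / 2),
        x u * x v * (Real.sin s * GNTK.pairing (deriv Real.tanh) (deriv Real.tanh)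
          (K (u, u)) (K (v, v)) (Real.cos s * K (u, v))) := fun u v => by
      rw [GNTK.slopeKernel, intervalIntegral.integral_const_mul]
    have hcont : ∀ u v, Continuous fun s => x u * x v * (Real.sin s *
        GNTK.pairing (deriv Real.tanh) (deriv Real.tanh) (K (u, u)) (K (v, v))
          (Real.cos s * K (u, v))) := fun u v =>
      continuous_const.mul (hK.continuous_slope_integrand (u, v))
    simp only [h1]
    have h2 : ∀ u, ∑ v, ∫ s in (0 : ℝ)..(Real.pi / 2),
        x u * x v * (Real.sin s * GNTK.pairing (deriv Real.tanh) (deriv Real.tanh)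
          (K (u, u)) (K (v, v)) (Real.cos s * K (u, v))) = ∫ s in (0 : ℝ)..(Real.pi / 2), ∑ v,
        x u * x v * (Real.sin s * GNTK.pairing (deriv Real.tanh) (deriv Real.tanh)
          (K (u, u)) (K (v, v)) (Real.cos s * K (u, v))) := fun u =>
      (intervalIntegral.integral_finsetSum fun v _ => (hcont u v).intervalIntegrable _ _).symm
    simp only [h2]
    rw [← intervalIntegral.integral_finsetSum fun u _ =>
      (continuous_finsetSum _ fun v _ => hcont u v).intervalIntegrable _ _]
    refine intervalIntegral.integral_nonneg hpi fun s h => ?_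
    have h3 := mul_nonneg (Real.sin_nonneg_of_nonneg_of_le_pi h.1 (by linarith [h.2, hpi]))
      ((hs s h).sum_nonneg x)
    refine h3.trans_eq ?_
    simp only [Finset.mul_sum]
    exact Finset.sum_congr rfl fun u _ => Finset.sum_congr rfl fun v _ => by ring

theorem tanhStep [DecidableEq V] (hK : IsPSDKernel K) : IsPSDKernel (tanhStep σw σb K) :=
  ((hK.pairing continuous_tanh.measurable fun x =>
    (abs_tanh_le_one x).trans (by linarith [abs_nonneg x])).smul (sq_nonneg σw)).add
    (.const (sq_nonneg σb))

/-- Price's identity, where `pairing_tanh_zero` removes the term at covariance zero. -/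
theorem tanhStep_eq (hK : IsPSDKernel K) :
    GNTK.tanhStep σw σb K = σw ^ 2 • (GNTK.slopeKernel K * K) + fun _ => σb ^ 2 := by
  funext p
  have h := pairing_eq_mul_integral (hK.quadratic_nonneg p.1 p.2) hasDerivAt_tanh_deriv
    continuous_deriv_tanh abs_tanh_le_one abs_deriv_tanh_le_one
  rw [pairing_tanh_zero (hK.diag_nonneg _) (hK.diag_nonneg _), zero_add] at h
  simp only [GNTK.tanhStep, Pi.add_apply, Pi.smul_apply, Pi.mul_apply, smul_eq_mul,
    GNTK.slopeKernel]
  rw [h]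
  ring

theorem tanhStep_diag (hK : IsPSDKernel K) (u : V) :
    GNTK.tanhStep σw σb K (u, u) = σw ^ 2 * tanhVariance (K (u, u)) + σb ^ 2 := by
  rw [GNTK.tanhStep, pairing_tanh_self (hK.diag_nonneg u)]

end IsPSDKernel

theorem slopeKernel_nonneg {V : Type*} {K : V × V → ℝ} (p : V × V) : 0 ≤ slopeKernel K p := by
  have hpi := Real.pi_div_two_pos.le
  refine intervalIntegral.integral_nonneg hpi fun s hs => mul_nonneg
    (Real.sin_nonneg_of_nonneg_of_le_pi hs.1 (by linarith [hs.2, hpi])) ?_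
  exact integral_nonneg fun z => mul_nonneg (deriv_tanh_pos _).le (deriv_tanh_pos _).le

/-- `K` lies entrywise above `c Y` for an entrywise nonnegative positive semidefinite kernel `Y`
with `σ_b² Y ≤ K` in the Loewner order. -/
def DominatesNonneg (σb c : ℝ) (K : V × V → ℝ) : Prop :=
  ∃ Y : V × V → ℝ, IsPSDKernel Y ∧ (∀ p, 0 ≤ Y p) ∧ IsPSDKernel (K - σb ^ 2 • Y) ∧
    ∀ p, c * Y p ≤ K p

namespace DominatesNonneg

variable {c : ℝ}

theorem mono (hK : DominatesNonneg σb c K) {c' : ℝ} (h : c' ≤ c) : DominatesNonneg σb c' K := by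
  obtain ⟨Y, hY, hY0, hKY, hc⟩ := hK
  exact ⟨Y, hY, hY0, hKY, fun p => (mul_le_mul_of_nonneg_right h (hY0 p)).trans (hc p)⟩

theorem nonneg (hK : DominatesNonneg σb c K) (hc : 0 ≤ c) (p : V × V) : 0 ≤ K p := by
  obtain ⟨Y, -, hY0, -, h⟩ := hK
  exact (mul_nonneg hc (hY0 p)).trans (h p)

theorem residualAggregation [DecidableEq V] {G : SimpleGraph V} [DecidableRel G.Adj] {δ : ℝ}
    (hδ0 : 0 ≤ δ) (hδ1 : δ ≤ 1) (hK : DominatesNonneg σb c K) :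
    DominatesNonneg σb c (residualAggregation G δ *ᵥ K) := by
  obtain ⟨Y, hY, hY0, hKY, h⟩ := hK
  have hM := residualAggregation_mem_rowStochastic G hδ0 hδ1
  refine ⟨GNTK.residualAggregation G δ *ᵥ Y, hY.residualAggregation hδ0 hδ1,
    const_le_mulVec hM hY0, ?_, fun p => ?_⟩
  · rw [← mulVec_smul, ← mulVec_sub]
    exact hKY.residualAggregation hδ0 hδ1
  · have h1 := mulVec_mono (M := GNTK.residualAggregation G δ)
      (fun _ _ => nonneg_of_mem_rowStochastic hM) (x := c • Y) (y := K) h p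
    rwa [mulVec_smul] at h1

/-- The starting point `Y = 1`: without its bias the layer output is a Schur product. -/
theorem tanhStep_of_isPSDKernel [DecidableEq V] (hK : IsPSDKernel K) {B : ℝ}
    (hB : ∀ u, tanhStep σw σb K (u, u) ≤ B) : DominatesNonneg σb (-B) (tanhStep σw σb K) := by
  refine ⟨fun _ => 1, .const zero_le_one, fun _ => zero_le_one, ?_, fun p => ?_⟩
  · have h1 : tanhStep σw σb K - σb ^ 2 • (fun _ => (1 : ℝ)) = σw ^ 2 • (slopeKernel K * K) := by
      rw [hK.tanhStep_eq]
      funext p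
      simp
    rw [h1]
    exact (hK.slopeKernel.mul hK).smul (sq_nonneg σw)
  · rw [mul_one]
    exact hK.tanhStep.neg_le_apply hB p

/-- `Y` follows the multiplicative part of the layer, so `K - σ_b² Y` stays semidefinite. On the
diagonal this bounds the new `Y` by `B / σ_b²`, hence everywhere; the added bias `σ_b²` is then
worth at least `(σ_b²)² / B` further multiples of `Y`. -/
theorem tanhStep [DecidableEq V] (hPSD : IsPSDKernel K) (hK : DominatesNonneg σb c K) {B : ℝ}
    (hB0 : 0 < B) (hb : 0 < σb ^ 2) (hB : ∀ u, tanhStep σw σb K (u, u) ≤ B) :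
    DominatesNonneg σb (c + (σb ^ 2) ^ 2 / B) (tanhStep σw σb K) := by
  obtain ⟨Y, hY, hY0, hKY, h⟩ := hK
  have hS := hPSD.slopeKernel
  have hS0 : ∀ p, 0 ≤ slopeKernel K p := slopeKernel_nonneg
  have hY' : IsPSDKernel (σw ^ 2 • (slopeKernel K * Y)) := (hS.mul hY).smul (sq_nonneg σw)
  have hKY' : IsPSDKernel (GNTK.tanhStep σw σb K - σb ^ 2 • σw ^ 2 • (slopeKernel K * Y)) := by
    have h1 : GNTK.tanhStep σw σb K - σb ^ 2 • σw ^ 2 • (slopeKernel K * Y) =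
        σw ^ 2 • (slopeKernel K * (K - σb ^ 2 • Y)) + fun _ => σb ^ 2 := by
      rw [hPSD.tanhStep_eq]
      funext p
      simp
      ring
    rw [h1]
    exact ((hS.mul hKY).smul (sq_nonneg σw)).add (.const (sq_nonneg σb))
  refine ⟨σw ^ 2 • (slopeKernel K * Y), hY', fun p => ?_, hKY', fun p => ?_⟩
  · exact mul_nonneg (sq_nonneg σw) (mul_nonneg (hS0 p) (hY0 p))
  · have hdiag : ∀ u, (σw ^ 2 • (slopeKernel K * Y)) (u, u) ≤ B / σb ^ 2 := fun u => by
      have h1 := hKY'.diag_nonneg u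
      rw [Pi.sub_apply, Pi.smul_apply, smul_eq_mul] at h1
      rw [le_div_iff₀ hb]
      linarith [hB u]
    have h1 := hY'.apply_le hdiag p
    have h2 : (σb ^ 2) ^ 2 / B * (σw ^ 2 • (slopeKernel K * Y)) p ≤ σb ^ 2 := by
      refine (mul_le_mul_of_nonneg_left h1 (by positivity)).trans_eq ?_
      field_simp
    have h3 := mul_le_mul_of_nonneg_left (h p) (mul_nonneg (sq_nonneg σw) (hS0 p))
    rw [add_mul]
    rw [hPSD.tanhStep_eq]
    simp only [Pi.add_apply, Pi.smul_apply, Pi.mul_apply, smul_eq_mul] at h2 ⊢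
    linarith

end DominatesNonneg

end TanhKernelMap

/-! ### One `tanh` layer on the edge of chaos -/

section EdgeOfChaos

variable {σw σb q : ℝ} (hq : 0 < q) (hfix : σw ^ 2 * tanhVariance q + σb ^ 2 = q)
  (hslope : σw ^ 2 * tanhSlope q = 1)

include hq hfix hslope in
-- With zero bias the two conditions would give `tanhVariance q = q * tanhSlope q`, against the
-- strict inequality `tanhVariance_lt`.
theorem sq_bias_pos : 0 < σb ^ 2 := by
  have hw : 0 < σw ^ 2 := (sq_nonneg σw).lt_of_ne' fun h => by
    rw [h, zero_mul] at hslope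
    exact zero_ne_one hslope
  have h1 := mul_lt_mul_of_pos_left (tanhVariance_lt hq) hw
  have h2 : σw ^ 2 * (q * tanhSlope q) = q := by linear_combination q * hslope
  linarith

include hq hfix in
-- `tanhVariance a ≤ (a / q) tanhVariance q`, and the fixed-point equation gives `σ_w² tanhVariance
-- q = q - σ_b²`.
theorem variance_sub_le {a : ℝ} (ha : q ≤ a) :
    σw ^ 2 * tanhVariance a + σb ^ 2 - q ≤ (1 - σb ^ 2 / q) * (a - q) := by
  have h1 := mul_le_mul_of_nonneg_left (mul_tanhVariance_le hq.le ha) (sq_nonneg σw)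
  have h2 : q * (σw ^ 2 * tanhVariance a + σb ^ 2 - q) ≤ q * ((1 - σb ^ 2 / q) * (a - q)) := by
    have h3 : q * ((1 - σb ^ 2 / q) * (a - q)) = (q - σb ^ 2) * (a - q) := by field_simp
    rw [h3]
    have h4 : σw ^ 2 * tanhVariance q = q - σb ^ 2 := by linarith
    nlinarith
  exact le_of_mul_le_mul_left h2 hq

include hq hfix in
theorem sub_variance_le {a : ℝ} (ha0 : 0 ≤ a) (ha : a ≤ q) :
    q - (σw ^ 2 * tanhVariance a + σb ^ 2) ≤ (1 - σb ^ 2 / q) * (q - a) := by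
  have h1 := mul_le_mul_of_nonneg_left (mul_tanhVariance_le ha0 ha) (sq_nonneg σw)
  have h2 : q * (q - (σw ^ 2 * tanhVariance a + σb ^ 2)) ≤ q * ((1 - σb ^ 2 / q) * (q - a)) := by
    have h3 : q * ((1 - σb ^ 2 / q) * (q - a)) = (q - σb ^ 2) * (q - a) := by field_simp
    rw [h3]
    have h4 : σw ^ 2 * tanhVariance q = q - σb ^ 2 := by linarith
    nlinarith
  exact le_of_mul_le_mul_left h2 hq

variable {V : Type*} [Fintype V] [DecidableEq V] {K : V × V → ℝ}

include hq hfix in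
theorem tanhStep_le (hK : IsPSDKernel K) {ε : ℝ} (hε : 0 ≤ ε) (hKε : ∀ p, K p ≤ q + ε)
    (p : V × V) : tanhStep σw σb K p ≤ q + (1 - σb ^ 2 / q) * ε := by
  refine hK.tanhStep.apply_le (fun u => ?_) p
  rw [hK.tanhStep_diag]
  have h1 := variance_sub_le hq hfix (a := q + ε) (by linarith)
  have h2 := mul_le_mul_of_nonneg_left (tanhVariance_mono (hKε (u, u))) (sq_nonneg σw)
  rw [add_sub_cancel_left] at h1
  linarith

omit [DecidableEq V] in
include hq hfix hslope in
-- Raising both variances to `q + ε` only lowers the pairing. There the tangent at covariance `q +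
-- ε` has value at least `q` and, as the slope decreases with the variance, slope at most `1`.
theorem sub_le_tanhStep (hK : IsPSDKernel K) (hK0 : ∀ p, 0 ≤ K p) {ε : ℝ} (hε : 0 ≤ ε)
    (hKε : ∀ p, K p ≤ q + ε) (p : V × V) : K p - ε ≤ tanhStep σw σb K p := by
  have h1 := pairing_tanh_anti (hK.quadratic_nonneg p.1 p.2) (hK0 p) (hKε (p.1, p.1))
    (hKε (p.2, p.2))
  have h2 := tanhVariance_sub_le_pairing (q := q + ε) (by linarith) (hK0 p) (hKε p)
  have h3 := mul_le_mul_of_nonneg_left (h2.trans h1) (sq_nonneg σw)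
  have h4 := mul_le_mul_of_nonneg_left (tanhVariance_mono (show q ≤ q + ε by linarith))
    (sq_nonneg σw)
  have h5 := mul_le_mul_of_nonneg_left (tanhSlope_anti (show q ≤ q + ε by linarith))
    (sq_nonneg σw)
  rw [hslope] at h5
  have h6 := mul_le_mul_of_nonneg_right h5 (sub_nonneg.2 (hKε p))
  rw [tanhStep]
  linarith

/-- The damping of the deficit `q - K` by one layer: only diagonal entries are damped. -/
noncomputable def damping (σb q : ℝ) (p : V × V) : ℝ := if p.1 = p.2 then 1 - σb ^ 2 / q else 1

include hq hfix hslope in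
-- Off the diagonal the slope `1` leaves the deficit undamped; on the diagonal the variance map
-- contracts it.
theorem sub_tanhStep_le (hK : IsPSDKernel K) (hK0 : ∀ p, 0 ≤ K p) {ε : ℝ} (hε : 0 ≤ ε)
    (hKε : ∀ p, K p ≤ q + ε) (p : V × V) :
    max 0 (q - tanhStep σw σb K p) ≤ damping σb q p * max 0 (q - K p) + ε := by
  have hb : 0 ≤ 1 - σb ^ 2 / q := by
    rw [sub_nonneg, div_le_one hq]
    linarith [mul_nonneg (sq_nonneg σw) (tanhVariance_nonneg q)]
  obtain ⟨u, v⟩ := p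
  have hd : 0 ≤ damping σb q (u, v) := by
    unfold damping
    split_ifs
    exacts [hb, zero_le_one]
  have hx := mul_nonneg hd (le_max_left 0 (q - K (u, v)))
  refine max_le (by linarith) ?_
  by_cases huv : u = v
  · subst huv
    rw [hK.tanhStep_diag]
    have hd' : damping σb q (u, u) = 1 - σb ^ 2 / q := if_pos rfl
    rcases le_total (K (u, u)) q with h | h
    · have h1 := sub_variance_le hq hfix (hK.diag_nonneg u) h
      have h2 := mul_le_mul_of_nonneg_left (le_max_right 0 (q - K (u, u))) hb
      rw [hd']
      linarith
    · have h1 := mul_le_mul_of_nonneg_left (tanhVariance_mono h) (sq_nonneg σw)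
      linarith
  · have hd' : damping σb q (u, v) = 1 := if_neg huv
    rw [hd', one_mul]
    linarith [sub_le_tanhStep hq hfix hslope hK hK0 hε hKε (u, v), le_max_right 0 (q - K (u, v))]

omit [Fintype V] in
theorem damping_le_one (hq : 0 < q) (p : V × V) : damping σb q p ≤ 1 := by
  unfold damping
  split_ifs
  · linarith [div_nonneg (sq_nonneg σb) hq.le]
  · exact le_rfl

omit [Fintype V] [DecidableEq V] in
include hq hslope in
-- `tanh'` is Lipschitz, so no rate is lost. The variances contribute `4 / √q`, and half of `4 (a +
-- b - 2 c) ≤ 16 ε` contributes `8`.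
theorem IsGaussianPair.abs_pairing_deriv_tanh_sub_one_le {Ω : Type*} [MeasurableSpace Ω]
    {μ : Measure Ω} [IsProbabilityMeasure μ] {X Y : Ω → ℝ} {a b c ε : ℝ}
    (h : IsGaussianPair μ X Y a b c) (ha : |a - q| ≤ ε) (hb : |b - q| ≤ ε) (hc : |c - q| ≤ ε) :
    |σw ^ 2 * pairing (deriv Real.tanh) (deriv Real.tanh) a b c - 1| ≤
      σw ^ 2 * (4 / √q + 8) * ε := by
  have ha0 : 0 ≤ a := by simpa using h.quadratic_nonneg 1 0
  have hb0 : 0 ≤ b := by simpa using h.quadratic_nonneg 0 1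
  have hX := h.measurable_left
  have hY := h.measurable_right
  have hm := continuous_deriv_tanh.measurable
  have hsub : ∫ ω, (deriv Real.tanh (X ω) - deriv Real.tanh (Y ω)) ^ 2 ∂μ ≤
      4 * (a + b - 2 * c) := by
    rw [← h.integral_sub_sq, ← integral_const_mul]
    refine integral_mono_of_nonneg (Filter.Eventually.of_forall fun ω => sq_nonneg _)
      (h.integrable_sub_sq.const_mul 4) (Filter.Eventually.of_forall fun ω => ?_)
    have h1 := pow_le_pow_left₀ (abs_nonneg _) (abs_deriv_tanh_sub_le (X ω) (Y ω)) 2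
    rw [mul_pow, sq_abs, sq_abs] at h1
    change _ ≤ 4 * _
    linarith
  have hsub0 : 0 ≤ ∫ ω, (deriv Real.tanh (X ω) - deriv Real.tanh (Y ω)) ^ 2 ∂μ :=
    integral_nonneg fun ω => sq_nonneg _
  have hsa := (abs_tanhSlope_sub_le ha0 hq).trans
    (mul_le_mul_of_nonneg_left (div_le_div_of_nonneg_right ha (Real.sqrt_nonneg q)) (by norm_num))
  have hsb := (abs_tanhSlope_sub_le hb0 hq).trans
    (mul_le_mul_of_nonneg_left (div_le_div_of_nonneg_right hb (Real.sqrt_nonneg q)) (by norm_num))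
  have hP := h.pairing_eq_sub continuous_deriv_tanh abs_deriv_tanh_le_one
  change _ = (tanhSlope a + tanhSlope b) / 2 - _ at hP
  have hmain : |pairing (deriv Real.tanh) (deriv Real.tanh) a b c - tanhSlope q| ≤
      (4 / √q + 8) * ε := by
    rw [hP, abs_le]
    rw [abs_le] at ha hb hc hsa hsb
    have h1 : (4 / √q + 8) * ε = 4 * (ε / √q) + 8 * ε := by ring
    rw [h1]
    constructor <;> linarith [hsa.1, hsa.2, hsb.1, hsb.2, ha.1, ha.2, hb.1, hb.2, hc.1, hc.2]
  rw [← hslope, ← mul_sub, abs_mul, abs_of_nonneg (sq_nonneg σw), mul_assoc]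
  exact mul_le_mul_of_nonneg_left hmain (sq_nonneg σw)

end EdgeOfChaos

/-! ### Kernels of the `tanh` network -/

section TanhKernel

variable {V : Type*} [Fintype V] [DecidableEq V] {G : SimpleGraph V} [DecidableRel G.Adj] {δ : ℝ}
  {σw σb q : ℝ} {R d : ℕ} {h : V → EuclideanSpace ℝ (Fin d)}

theorem isPSDKernel_gpk_tanh (hδ0 : 0 < δ) (hδ1 : δ < 1) (l r : ℕ) :
    IsPSDKernel (gpk (residualAggregation G δ) Real.tanh σw σb R h l r) :=
  isPSDKernel_gpk σw σb R h hδ0.le hδ1.le continuous_tanh.measurable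
    (fun x => (abs_tanh_le_one x).trans (by linarith [abs_nonneg x])) l r

theorem gpk_tanh_succ (hδ0 : 0 < δ) (hδ1 : δ < 1) (l r : ℕ) :
    gpk (residualAggregation G δ) Real.tanh σw σb R h l (r + 1) =
      tanhStep σw σb (gpk (residualAggregation G δ) Real.tanh σw σb R h l r) := by
  rw [gpk_succ]
  funext p
  rw [(isPSDKernel_gpk_tanh hδ0 hδ1 l r).gaussianPairing_eq, tanhStep]

variable (hq : 0 < q) (hfix : σw ^ 2 * tanhVariance q + σb ^ 2 = q)
  (hslope : σw ^ 2 * tanhSlope q = 1) (hδ0 : 0 < δ) (hδ1 : δ < 1) (hR : 0 < R)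

include hq hfix hδ0 hδ1 hR in
-- A layer contracts the excess over `q` and averaging does not increase it; one contraction per
-- propagation unit is kept, available since `R > 0`.
theorem exists_gpk_tanh_le : ∃ ε₀ : ℝ, 0 ≤ ε₀ ∧ ∀ l r p,
    gpk (residualAggregation G δ) Real.tanh σw σb R h l r p ≤
      q + ε₀ * (1 - σb ^ 2 / q) ^ l := by
  set K := gpk (residualAggregation G δ) Real.tanh σw σb R h with hK
  have hM := residualAggregation_mem_rowStochastic G hδ0.le hδ1.le
  have hPSD : ∀ l r, IsPSDKernel (K l r) := isPSDKernel_gpk_tanh hδ0 hδ1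
  have hsucc : ∀ l r, K l (r + 1) = tanhStep σw σb (K l r) := gpk_tanh_succ hδ0 hδ1
  set β := 1 - σb ^ 2 / q with hβ
  have hβ0 : 0 ≤ β := by
    rw [hβ, sub_nonneg, div_le_one hq]
    linarith [mul_nonneg (sq_nonneg σw) (tanhVariance_nonneg q)]
  have hβ1 : β ≤ 1 := by
    rw [hβ]
    linarith [div_nonneg (sq_nonneg σb) hq.le]
  refine ⟨‖K 0 0‖, norm_nonneg _, ?_⟩
  have hlayer : ∀ l ε, 0 ≤ ε → (∀ p, K l 0 p ≤ q + ε) → ∀ r,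
      (∀ p, K l r p ≤ q + ε) ∧ ∀ p, K l (r + 1) p ≤ q + β * ε := by
    intro l ε hε h0 r
    have hbε : β * ε ≤ ε := mul_le_of_le_one_left hε hβ1
    induction r with
    | zero =>
      refine ⟨h0, fun p => ?_⟩
      rw [hsucc]
      exact tanhStep_le hq hfix (hPSD l 0) hε h0 p
    | succ r ih =>
      have h1 : ∀ p, K l (r + 1) p ≤ q + ε := fun p => (ih.2 p).trans (by linarith)
      refine ⟨h1, fun p => ?_⟩
      rw [hsucc]
      exact tanhStep_le hq hfix (hPSD l (r + 1)) hε h1 p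
  have hzero : ∀ l p, K l 0 p ≤ q + ‖K 0 0‖ * β ^ l := by
    intro l
    induction l with
    | zero =>
      intro p
      rw [pow_zero, mul_one]
      linarith [(le_abs_self _).trans (abs_apply_le_norm (K 0 0) p)]
    | succ l ih =>
      intro p
      obtain ⟨r, rfl⟩ := Nat.exists_eq_succ_of_ne_zero hR.ne'
      rw [hK, gpk_succ_zero]
      refine mulVec_le_const hM (fun p => ?_) p
      refine ((hlayer l _ (by positivity) ih r).2 p).trans_eq ?_
      ring
  exact fun l r => (hlayer l _ (by positivity) (hzero l) r).1

include hq hfix hslope hδ0 hδ1 hR in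
-- The constant in `DominatesNonneg` starts at `-B` and gains at least `κ` per propagation unit, so
-- it becomes nonnegative.
theorem exists_gpk_tanh_nonneg : ∃ L : ℕ, ∀ l ≥ L, ∀ r p,
    0 ≤ gpk (residualAggregation G δ) Real.tanh σw σb R h l r p := by
  obtain ⟨ε₀, hε₀, hup⟩ := exists_gpk_tanh_le (G := G) (h := h) hq hfix hδ0 hδ1 hR
  set K := gpk (residualAggregation G δ) Real.tanh σw σb R h with hK
  have hb := sq_bias_pos hq hfix hslope
  have hβ0 : 0 ≤ 1 - σb ^ 2 / q := by
    rw [sub_nonneg, div_le_one hq]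
    linarith [mul_nonneg (sq_nonneg σw) (tanhVariance_nonneg q)]
  have hβ1 : 1 - σb ^ 2 / q ≤ 1 := by linarith [div_nonneg (sq_nonneg σb) hq.le]
  have hPSD : ∀ l r, IsPSDKernel (K l r) := isPSDKernel_gpk_tanh hδ0 hδ1
  have hsucc : ∀ l r, K l (r + 1) = tanhStep σw σb (K l r) := gpk_tanh_succ hδ0 hδ1
  set B := q + ε₀ with hB
  have hB0 : 0 < B := by linarith
  have hKB : ∀ l r p, K l r p ≤ B := fun l r p => (hup l r p).trans
    (by linarith [mul_le_of_le_one_right hε₀ (pow_le_one₀ (n := l) hβ0 hβ1)])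
  have hstepB : ∀ l r u, tanhStep σw σb (K l r) (u, u) ≤ B := fun l r u => by
    rw [← hsucc]
    exact hKB l (r + 1) (u, u)
  set κ := (σb ^ 2) ^ 2 / B with hκ
  have hκ0 : 0 < κ := by positivity
  have hstep : ∀ {c : ℝ} (l r : ℕ), DominatesNonneg σb c (K l r) →
      DominatesNonneg σb (c + κ) (K l (r + 1)) := fun l r hd => by
    rw [hsucc]
    exact hd.tanhStep (hPSD l r) hB0 hb (hstepB l r)
  have hlayer : ∀ {c : ℝ} (l : ℕ), DominatesNonneg σb c (K l 1) →
      ∀ r, DominatesNonneg σb c (K l (r + 1)) := by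
    intro c l hd r
    induction r with
    | zero => exact hd
    | succ r ih => exact (hstep l (r + 1) ih).mono (by linarith)
  obtain ⟨n, rfl⟩ := Nat.exists_eq_succ_of_ne_zero hR.ne'
  have hone : ∀ l : ℕ, DominatesNonneg σb (-B + l * κ) (K l 1) ∧
      DominatesNonneg σb (-B + l * κ) (K (l + 1) 0) := by
    have hagg : ∀ {c : ℝ} (l : ℕ), DominatesNonneg σb c (K l 1) →
        DominatesNonneg σb c (K (l + 1) 0) := fun l hd => by
      rw [hK, gpk_succ_zero]
      exact (hlayer l hd n).residualAggregation hδ0.le hδ1.le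
    intro l
    induction l with
    | zero =>
      have h1 : DominatesNonneg σb (-B + (0 : ℕ) * κ) (K 0 1) := by
        rw [hsucc, Nat.cast_zero, zero_mul, add_zero]
        exact .tanhStep_of_isPSDKernel (hPSD 0 0) (hstepB 0 0)
      exact ⟨h1, hagg 0 h1⟩
    | succ l ih =>
      have h1 : DominatesNonneg σb (-B + (l + 1 : ℕ) * κ) (K (l + 1) 1) := by
        have := hstep (l + 1) 0 ih.2
        refine this.mono (le_of_eq ?_)
        push_cast
        ring
      exact ⟨h1, hagg (l + 1) h1⟩
  obtain ⟨L, hL⟩ := exists_nat_ge (B / κ)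
  have hLn : ∀ l ≥ L, 0 ≤ -B + (l : ℝ) * κ := fun l hl => by
    rw [div_le_iff₀ hκ0] at hL
    have : (L : ℝ) ≤ l := Nat.cast_le.2 hl
    nlinarith
  refine ⟨L + 1, fun l hl r p => ?_⟩
  obtain ⟨m, rfl⟩ : ∃ m, l = m + 1 := ⟨l - 1, by omega⟩
  cases r with
  | zero => exact (hone m).2.nonneg (hLn m (by omega)) p
  | succ r => exact (hlayer (m + 1) (hone (m + 1)).1 r).nonneg (hLn (m + 1) (by omega)) p

variable [Nonempty V] (hirr : (aggregation G).IsIrreducible)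

include hq hfix hslope hδ0 hδ1 hR hirr in
-- The excess over `q` is already geometric. From `L` on, the deficits `max 0 (q - K)` are
-- sub-iterates of `Ã` damped at a diagonal pair `(u, u)`, with a forcing term of the size of the
-- excess.
theorem exists_gpk_tanh_limit : ∃ α C : ℝ, 0 < α ∧ α < 1 ∧ 0 < C ∧ ∀ r ≤ R, ∀ p l,
    |gpk (residualAggregation G δ) Real.tanh σw σb R h l r p - q| ≤ C * α ^ l := by
  obtain ⟨ε₀, hε₀, hup⟩ := exists_gpk_tanh_le (G := G) (h := h) hq hfix hδ0 hδ1 hR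
  obtain ⟨L, hL⟩ := exists_gpk_tanh_nonneg (G := G) (h := h) hq hfix hslope hδ0 hδ1 hR
  have hM := residualAggregation_mem_rowStochastic G hδ0.le hδ1.le
  have hpos := exists_pos_pow_residualAggregation G hirr hδ0 hδ1
  have hMn : ∀ i j, 0 ≤ residualAggregation G δ i j := fun _ _ => nonneg_of_mem_rowStochastic hM
  set K := gpk (residualAggregation G δ) Real.tanh σw σb R h with hK
  have hb := sq_bias_pos hq hfix hslope
  set β := 1 - σb ^ 2 / q with hβ
  have hβ0 : 0 ≤ β := by
    rw [hβ, sub_nonneg, div_le_one hq]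
    linarith [mul_nonneg (sq_nonneg σw) (tanhVariance_nonneg q)]
  have hβ1 : β < 1 := by
    rw [hβ]
    linarith [div_pos hb hq]
  have hPSD : ∀ l r, IsPSDKernel (K l r) := isPSDKernel_gpk_tanh hδ0 hδ1
  have hsucc : ∀ l r, K l (r + 1) = tanhStep σw σb (K l r) := gpk_tanh_succ hδ0 hδ1
  set x : ℕ → ℕ → V × V → ℝ := fun l r p => max 0 (q - K l r p) with hx
  have hx0 : ∀ l r p, 0 ≤ x l r p := fun l r p => le_max_left _ _
  have hε : ∀ l, 0 ≤ ε₀ * β ^ l := fun l => by positivity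
  have hstep : ∀ l ≥ L, ∀ r p, x l (r + 1) p ≤ damping σb q p * x l r p + ε₀ * β ^ l := by
    intro l hl r p
    simp only [hx, hsucc]
    exact sub_tanhStep_le hq hfix hslope (hPSD l r) (hL l hl r) (hε l) (hup l r) p
  have hstep' : ∀ l ≥ L, ∀ r p, x l (r + 1) p ≤ x l r p + ε₀ * β ^ l := fun l hl r p =>
    (hstep l hl r p).trans
      (by linarith [mul_le_of_le_one_left (hx0 l r p) (damping_le_one (σb := σb) hq p)])
  -- Only the damping of the first layer of the unit is kept; for the others the factor is bounded
  -- by `1`.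
  have hlayer : ∀ l ≥ L, ∀ r p, x l (r + 1) p ≤
      damping σb q p * x l 0 p + (r + 1) * (ε₀ * β ^ l) := by
    intro l hl r p
    induction r with
    | zero => simpa using hstep l hl 0 p
    | succ r ih =>
      have := hstep' l hl (r + 1) p
      push_cast
      linarith
  obtain ⟨n, rfl⟩ := Nat.exists_eq_succ_of_ne_zero hR.ne'
  have hiter : ∀ l ≥ L, ∀ p, x (l + 1) 0 p ≤
      (residualAggregation G δ *ᵥ (damping σb q * x l 0)) p + (n + 1) * (ε₀ * β ^ l) := by
    intro l hl p
    have h1 := mulVec_mono hMn (x := x l (n + 1))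
      (y := damping σb q * x l 0 + fun _ => (n + 1) * (ε₀ * β ^ l)) (hlayer l hl n) p
    rw [mulVec_add, mulVec_const hM, Pi.add_apply] at h1
    refine le_trans (max_le (const_le_mulVec hM (hx0 l (n + 1)) p) ?_) h1
    have h2 := mulVec_mono hMn (x := (fun _ => q) - K l (n + 1)) (y := x l (n + 1))
      (fun p => le_max_right _ _) p
    rw [mulVec_sub, mulVec_const hM, Pi.sub_apply] at h2
    rw [hK, gpk_succ_zero]
    exact h2
  obtain ⟨u⟩ := ‹Nonempty V›
  have hdu : damping σb q (u, u) = β := if_pos rfl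
  have : Nonempty V := ⟨u⟩
  obtain ⟨α, C, hα, hα', hC, hdecay⟩ := exists_decay_of_damped_iteration hM hpos
    (x := fun l => x (L + l) 0) (fun l => hx0 (L + l) 0) (w := damping σb q) (damping_le_one hq)
    (i₀ := (u, u)) (hdu ▸ hβ0) (hdu ▸ hβ1) (C₀ := (n + 1) * (ε₀ * β ^ L)) (α₀ := β)
    (by positivity) hβ0 hβ1 (fun l p => by
      refine (hiter (L + l) (Nat.le_add_right L l) p).trans_eq ?_
      rw [pow_add]
      ring)
  set a := max α β with ha
  have ha0 : 0 < a := lt_max_of_lt_left hα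
  have ha1 : a < 1 := max_lt hα' hβ1
  set D := C / α ^ L + (n + 1) * ε₀ with hD
  have hD0 : 0 < D := by positivity
  set B := q + ε₀ with hB
  have hev : ∀ r ≤ n + 1, ∀ p, ∀ l ≥ L, |K l r p - q| ≤ D * a ^ l := by
    intro r hr p l hl
    have hβa : β ^ l ≤ a ^ l := pow_le_pow_left₀ hβ0 (le_max_right _ _) l
    have hαa : α ^ l ≤ a ^ l := pow_le_pow_left₀ hα.le (le_max_left _ _) l
    have h1 : x l 0 p ≤ C / α ^ L * a ^ l := by
      obtain ⟨m, rfl⟩ := Nat.exists_eq_add_of_le hl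
      refine (hdecay m p).trans ?_
      refine le_trans (le_of_eq ?_) (mul_le_mul_of_nonneg_left hαa (by positivity))
      rw [pow_add]
      field_simp
    have h2 : x l r p ≤ x l 0 p + r * (ε₀ * β ^ l) := by
      clear hr
      induction r with
      | zero => simp
      | succ r ih =>
        have := hstep' l hl r p
        push_cast
        linarith
    have hr' : (r : ℝ) ≤ n + 1 := by exact_mod_cast hr
    have h3 := mul_le_mul_of_nonneg_left hβa hε₀
    have h4 : (r : ℝ) * (ε₀ * β ^ l) ≤ (n + 1) * (ε₀ * a ^ l) :=
      mul_le_mul hr' h3 (hε l) (by positivity)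
    have h5 : q - K l r p ≤ x l r p := le_max_right _ _
    have h6 := hup l r p
    have h7 : 0 ≤ C / α ^ L * a ^ l := by positivity
    have h8 : 0 ≤ n * (ε₀ * a ^ l) := by positivity
    have h9 : D * a ^ l = C / α ^ L * a ^ l + n * (ε₀ * a ^ l) + ε₀ * a ^ l := by
      rw [hD]
      ring
    rw [h9, abs_le]
    constructor <;> linarith
  have hKB : ∀ l r p, |K l r p - q| ≤ B + q := fun l r p => by
    have h1 : ∀ p, K l r p ≤ B := fun p => (hup l r p).trans
      (by linarith [mul_le_of_le_one_right hε₀ (pow_le_one₀ (n := l) hβ0 hβ1.le)])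
    have h2 := (hPSD l r).neg_le_apply (fun u => h1 (u, u)) p
    have h3 := h1 p
    rw [abs_le]
    constructor <;> linarith
  refine ⟨a, D + (B + q) / a ^ L, ha0, ha1, by positivity, fun r hr p => ?_⟩
  exact exists_bound_of_eventual_bound ha0 ha1.le (fun l => hKB l r p) (by positivity) hD0.le
    (hev r hr p)

include hδ0 hδ1 hirr in
theorem exists_gntk_tanh_asymptotics (hchaos : IsEdgeOfChaos Real.tanh σw σb) {π : V × V → ℝ}
    (hπ : IsStationaryDistribution (residualAggregation G δ) π) :
    ∃ α C : ℝ, 0 < α ∧ α < 1 ∧ 0 < C ∧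
      ∃ v : V × V → ℝ, ∀ r ≤ R, ∃ v' : V × V → ℝ, ∀ (l : ℕ) (u u' : V),
        |gntk (residualAggregation G δ) Real.tanh σw σb R h l r (u, u') -
          π ⬝ᵥ (((R : ℝ) * (l : ℝ)) • v + v')| ≤ C * α ^ l := by
  have hM := residualAggregation_mem_rowStochastic G hδ0.le hδ1.le
  have hpos := exists_pos_pow_residualAggregation G hirr hδ0 hδ1
  rcases Nat.eq_zero_or_pos R with rfl | hR
  · exact exists_gntk_asymptotics hM hpos hπ (q := 0) (C₀ := 0) (α₀ := 0) le_rfl le_rfl one_pos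
      (fun l r hr => absurd hr (Nat.not_lt_zero r)) (fun l r hr => absurd hr (Nat.not_lt_zero r))
  obtain ⟨q, hq, hfix, hslope⟩ := hchaos
  change σw ^ 2 * tanhVariance q + σb ^ 2 = q at hfix
  change σw ^ 2 * tanhSlope q = 1 at hslope
  obtain ⟨α, C, hα, hα', hC, hK⟩ := exists_gpk_tanh_limit (G := G) (h := h) hq hfix hslope hδ0 hδ1
    hR hirr
  set D := σw ^ 2 * (4 / √q + 8) with hD
  have hD0 : 0 ≤ D := by positivity
  refine exists_gntk_asymptotics hM hpos hπ (q := q) (C₀ := C + D * C) (α₀ := α) (by positivity)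
    hα.le hα' (fun l r hr p => ?_) (fun l r hr p => ?_)
  · refine (hK (r + 1) hr p l).trans ?_
    have : 0 ≤ D * C * α ^ l := by positivity
    linarith
  · rw [gpkDeriv, (isPSDKernel_gpk_tanh hδ0 hδ1 l r).gaussianPairing_eq]
    have h1 := ((isPSDKernel_gpk_tanh (G := G) (σw := σw) (σb := σb) (R := R) (h := h)
      hδ0 hδ1 l r).isGaussianPair p.1 p.2).abs_pairing_deriv_tanh_sub_one_le hq hslope
      (hK r hr.le _ l) (hK r hr.le _ l) (hK r hr.le _ l)
    refine h1.trans ?_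
    have : 0 ≤ C * α ^ l := by positivity
    rw [← hD]
    linarith

end TanhKernel

end GNTK
-- Assembly of the theorem
theorem theorem2 {V : Type*} [Fintype V] [DecidableEq V] [Nonempty V]
    (G : SimpleGraph V) [DecidableRel G.Adj]
    (hirr : (GNTK.aggregation G).IsIrreducible)
    (δ : ℝ) (hδ0 : 0 < δ) (hδ1 : δ < 1)
    (φ : ℝ → ℝ) (hφ : φ = GNTK.relu ∨ φ = Real.tanh)
    (σw σb : ℝ) (hchaos : GNTK.IsEdgeOfChaos φ σw σb)
    (R d : ℕ) (h : V → EuclideanSpace ℝ (Fin d)) :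
    GNTK.residualAggregation G δ ∈ rowStochastic ℝ (V × V) ∧
    (∃! π : V × V → ℝ, GNTK.IsStationaryDistribution (GNTK.residualAggregation G δ) π) ∧
    (∀ π : V × V → ℝ, GNTK.IsStationaryDistribution (GNTK.residualAggregation G δ) π →
      ∃ α C : ℝ, 0 < α ∧ α < 1 ∧ 0 < C ∧
        ∃ v : V × V → ℝ, ∀ r ≤ R, ∃ v' : V × V → ℝ, ∀ (l : ℕ) (u u' : V),
          |GNTK.gntk (GNTK.residualAggregation G δ) φ σw σb R h l r (u, u') -
            π ⬝ᵥ (((R : ℝ) * (l : ℝ)) • v + v')| ≤ C * α ^ l) ∧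
    (Nontrivial V → ∃ lam lamRes : ℝ,
      GNTK.IsSecondLargestEigenvalue (GNTK.aggregation G) lam ∧
      GNTK.IsSecondLargestEigenvalue (GNTK.residualAggregation G δ) lamRes ∧
      lamRes = (1 - δ) * lam + δ ∧ lam < lamRes ∧ lamRes < 1) := by
  have hst := GNTK.residualAggregation_mem_rowStochastic G hδ0.le hδ1.le
  refine ⟨hst, GNTK.existsUnique_isStationaryDistribution G hirr hδ0 hδ1, fun π hπ => ?_,
    fun _ => GNTK.exists_secondLargestEigenvalue_aggregation G hirr hδ0 hδ1⟩
  rcases hφ with rfl | rfl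
  · obtain ⟨hw, hb⟩ := hchaos.relu_eq
    exact GNTK.exists_gntk_relu_asymptotics hw hb hδ0 hδ1 hirr hπ
  · exact GNTK.exists_gntk_tanh_asymptotics hδ0 hδ1 hirr hchaos hπ
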